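/- For a measurable, bounded, compactly supported, spherically symmetric potential $V:\mathbb R^3\to[0,\infty)$, write $V(r)=V(x)$ for $|x|=r$ and $$\rho(V)=\sup_{r\ge 0} r^2V(r)+\int_0^\infty r\,V(r)\,dr .$$ Let $f:\mathbb R^3\to\mathbb R$ denote the solution of the zero-energy scattering equation $\left(-\Delta+\tfrac12 V\right)f=0$ on $\mathbb R^3$ (a continuous function, with the equation in the sense of distributions) with the boundary condition $f(x)\to1$ as $|x|\to\infty$. For $N\ge2$ let $$H_N=\sum_{j=1}^N-\Delta_{x_j}+\sum_{1\le i<j\le N}N^2V\big(N(x_i-x_j)\big)$$ be the self-adjoint operator on $L^2(\mathbb R^{3N};\mathbb C)$ with domain $H^2(\mathbb R^{3N})$, and let $L^2_s(\mathbb R^{3N})$ be the subspace of functions $\psi(x_1,\dots,x_N)$, $x_j\in\mathbb R^3$, that are invariant under all permutations of $x_1,\dots,x_N$. Write $\langle\psi,H_N^2\psi\rangle=\|H_N\psi\|^2$ for $\psi$ in the domain of $H_N$ and $\langle\psi,H_N^2\psi\rangle=+\infty$ otherwise. **Proposition.** There is a universal constant $\rho_0>0$ such that for every $V$ as above with $\rho(V)\le\rho_0$,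 every $N\ge2$ and every $\psi_N\in L^2_s(\mathbb R^{3N})$, the function $\psi_N(\mathbf x)/f(N(x_1-x_2))$ is in $L^2(\mathbb R^{3N})$ and $$\langle\psi_N,H_N^2\psi_N\rangle\ \ge\ \frac{N^2}{2}\int_{\mathbb R^{3N}}d\mathbf x\,\left|\nabla_{x_1}\nabla_{x_2}\frac{\psi_N(\mathbf x)}{f(N(x_1-x_2))}\right|^2 .$$ Here $\mathbf x=(x_1,\dots,x_N)$, $|\nabla_{x_1}\nabla_{x_2}\varphi|^2=\sum_{a,b=1}^3|\partial_{x_{1,a}}\partial_{x_{2,b}}\varphi|^2$ with distributional derivatives, and the integral is $+\infty$ if one of these derivatives is not in $L^2(\mathbb R^{3N})$; in particular all of them are in $L^2(\mathbb R^{3N})$ if $\psi_N$ is in the domain of $H_N$. -/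

import Mathlib

open MeasureTheory Filter Topology TemperedDistribution
open scoped ENNReal SchwartzMap LineDeriv Laplacian ContDiff

noncomputable section

namespace GrossPitaevskii

/-- One-particle space `ℝ³`. -/
abbrev Space3 : Type := EuclideanSpace ℝ (Fin 3)

/-- Configuration space `ℝ^{3N}`; the coordinate `(j, a)` is the `a`-th component of the position
of the `j`-th particle. -/
abbrev Config (N : ℕ) : Type := EuclideanSpace ℝ (Fin N × Fin 3)

/-- The Hilbert space `L²(ℝ^{3N}; ℂ)` with Lebesgue measure. -/
abbrev WaveFunction (N : ℕ) : Type := Lp ℂ 2 (volume : Measure (Config N))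

/-- The position `x_j ∈ ℝ³` of the `j`-th particle. -/
def position {N : ℕ} (x : Config N) (j : Fin N) : Space3 :=
  WithLp.toLp 2 fun a => x (j, a)

/-- The configuration `(x_{σ 1}, …, x_{σ N})`. -/
def permute {N : ℕ} (σ : Equiv.Perm (Fin N)) (x : Config N) : Config N :=
  WithLp.toLp 2 fun p => x (σ p.1, p.2)

/-- Membership in `L²_s(ℝ^{3N})`: invariance under all permutations of the particles. -/
def IsPermSymmetric {N : ℕ} (ψ : WaveFunction N) : Prop :=
  ∀ σ : Equiv.Perm (Fin N), (fun x => ψ (permute σ x)) =ᵐ[volume] ψ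

/-- Spherical symmetry. -/
def IsRadial (V : Space3 → ℝ) : Prop := ∀ x y, ‖x‖ = ‖y‖ → V x = V y

/-- The value `V(r) = V(x)`, `|x| = r`, of a radial function, read off along a coordinate axis. -/
def profile (V : Space3 → ℝ) (r : ℝ) : ℝ := V (r • EuclideanSpace.single 0 1)

/-- The strength `ρ = sup_{r ≥ 0} r² V(r) + ∫₀^∞ r V(r) dr` of a radial potential. -/
def strength (V : Space3 → ℝ) : ℝ :=
  (⨆ r : Set.Ici (0 : ℝ), (r : ℝ) ^ 2 * profile V r) + ∫ r in Set.Ioi (0 : ℝ), r * profile V r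

/-- `f` is a solution of the zero-energy scattering equation `(-Δ + V/2) f = 0` on `ℝ³`
(a continuous function, with the equation in the sense of distributions)
with the boundary condition `f(x) → 1` as `|x| → ∞`. -/
structure IsScatteringSolution (V f : Space3 → ℝ) : Prop where
  continuous : Continuous f
  equation : ∀ η : Space3 → ℝ, ContDiff ℝ ∞ η → HasCompactSupport η →
    ∫ x, f x * (-(Δ η x) + 1 / 2 * V x * η x) = 0
  boundary : Tendsto f (cocompact Space3) (𝓝 1)

/-- The interaction `∑_{i<j} N² V(N(x_i - x_j))`. -/
def interaction (V : Space3 → ℝ) (N : ℕ) (x : Config N) : ℝ :=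
  ∑ i : Fin N, ∑ j ∈ Finset.Ioi i,
    (N : ℝ) ^ 2 * V ((N : ℝ) • (position x i - position x j))

theorem toTemperedDistribution_injective {N : ℕ} {u v : WaveFunction N}
    (h : (u : 𝓢'(Config N, ℂ)) = (v : 𝓢'(Config N, ℂ))) : u = v := by
  have hk := Lp.ker_toTemperedDistributionCLM_eq_bot (E := Config N) (F := ℂ) (p := 2)
    (μ := (volume : Measure (Config N)))
  exact LinearMap.ker_eq_bot.mp hk h

theorem exists_laplacian {N : ℕ} {ψ : WaveFunction N}
    (h : MemSobolev 2 2 (ψ : 𝓢'(Config N, ℂ))) :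
    ∃ g : WaveFunction N, Δ (ψ : 𝓢'(Config N, ℂ)) = (g : 𝓢'(Config N, ℂ)) := by
  have := h.laplacian
  rw [sub_self] at this
  exact memSobolev_zero_iff.mp this

/-- The domain of `H_N`: the `ψ` in the Sobolev space `H²(ℝ^{3N})` whose product with the
interaction is in `L²`. For bounded `V` this is all of `H²(ℝ^{3N})`. -/
def hamiltonianDomain (V : Space3 → ℝ) (N : ℕ) : Submodule ℂ (WaveFunction N) where
  carrier := {ψ | MemSobolev 2 2 (ψ : 𝓢'(Config N, ℂ)) ∧
    MemLp (fun x => (interaction V N x : ℂ) * ψ x) 2 (volume : Measure (Config N))}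
  add_mem' := by
    rintro u v ⟨hu, hu'⟩ ⟨hv, hv'⟩
    refine ⟨?_, (memLp_congr_ae ?_).mp (hu'.add hv')⟩
    · have h := hu.add hv
      simp only [← Lp.toTemperedDistributionCLM_apply, ← map_add] at h ⊢
      exact h
    · filter_upwards [Lp.coeFn_add u v] with x hx
      rw [hx]
      simp [mul_add]
  zero_mem' := by
    refine ⟨?_, (memLp_congr_ae ?_).mp (MemLp.zero (ε := ℂ))⟩
    · rw [← Lp.toTemperedDistributionCLM_apply, map_zero]
      exact memSobolev_fun_zero _ _ _ _
    · filter_upwards [Lp.coeFn_zero ℂ 2 (volume : Measure (Config N))] with x hx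
      rw [hx]
      simp
  smul_mem' := by
    rintro c u ⟨hu, hu'⟩
    refine ⟨?_, (memLp_congr_ae ?_).mp (hu'.const_smul c)⟩
    · have h := hu.smul c
      simp only [← Lp.toTemperedDistributionCLM_apply, ← map_smul] at h ⊢
      exact h
    · filter_upwards [Lp.coeFn_smul c u] with x hx
      rw [hx]
      simp [mul_left_comm]

/-- The distributional Laplacian `Δψ ∈ L²` of `ψ ∈ H²`. -/
def laplacianL2 {N : ℕ} (ψ : WaveFunction N)
    (h : MemSobolev 2 2 (ψ : 𝓢'(Config N, ℂ))) : WaveFunction N :=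
  (exists_laplacian h).choose

theorem laplacianL2_spec {N : ℕ} (ψ : WaveFunction N)
    (h : MemSobolev 2 2 (ψ : 𝓢'(Config N, ℂ))) :
    Δ (ψ : 𝓢'(Config N, ℂ)) = (laplacianL2 ψ h : 𝓢'(Config N, ℂ)) :=
  (exists_laplacian h).choose_spec

theorem laplacianL2_add {N : ℕ} (u v : WaveFunction N)
    (hu : MemSobolev 2 2 (u : 𝓢'(Config N, ℂ))) (hv : MemSobolev 2 2 (v : 𝓢'(Config N, ℂ)))
    (huv : MemSobolev 2 2 ((u + v : WaveFunction N) : 𝓢'(Config N, ℂ))) :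
    laplacianL2 (u + v) huv = laplacianL2 u hu + laplacianL2 v hv := by
  apply toTemperedDistribution_injective
  rw [← laplacianL2_spec, ← Lp.toTemperedDistributionCLM_apply,
    ← Lp.toTemperedDistributionCLM_apply (laplacianL2 u hu + laplacianL2 v hv), map_add, map_add,
    ← laplacianCLM_apply, map_add]
  simp only [Lp.toTemperedDistributionCLM_apply, laplacianCLM_apply, laplacianL2_spec u hu,
    laplacianL2_spec v hv]

theorem laplacianL2_smul {N : ℕ} (c : ℂ) (u : WaveFunction N)
    (hu : MemSobolev 2 2 (u : 𝓢'(Config N, ℂ)))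
    (hcu : MemSobolev 2 2 ((c • u : WaveFunction N) : 𝓢'(Config N, ℂ))) :
    laplacianL2 (c • u) hcu = c • laplacianL2 u hu := by
  apply toTemperedDistribution_injective
  rw [← laplacianL2_spec, ← Lp.toTemperedDistributionCLM_apply,
    ← Lp.toTemperedDistributionCLM_apply (c • laplacianL2 u hu), map_smul, map_smul,
    ← laplacianCLM_apply, map_smul]
  simp only [Lp.toTemperedDistributionCLM_apply, laplacianCLM_apply, laplacianL2_spec u hu]

/-- The Hamiltonian `H_N = ∑_j -Δ_{x_j} + ∑_{i<j} N² V(N(x_i - x_j))` as an unbounded operator on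
`L²(ℝ^{3N})`. The sum of the `-Δ_{x_j}` is minus the Laplacian of `ℝ^{3N}`. -/
def hamiltonian (V : Space3 → ℝ) (N : ℕ) : WaveFunction N →ₗ.[ℂ] WaveFunction N where
  domain := hamiltonianDomain V N
  toFun :=
    { toFun := fun ψ => -laplacianL2 ψ.1 ψ.2.1 + MemLp.toLp _ ψ.2.2
      map_add' := by
        rintro ⟨u, hu⟩ ⟨v, hv⟩
        have h' : MemLp.toLp _ (Submodule.add_mem _ hu hv).2 =
            MemLp.toLp _ hu.2 + MemLp.toLp _ hv.2 := by
          rw [← MemLp.toLp_add]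
          apply MemLp.toLp_congr
          filter_upwards [Lp.coeFn_add u v] with x hx
          rw [hx]
          simp [mul_add]
        have h := laplacianL2_add u v hu.1 hv.1 (Submodule.add_mem _ hu hv).1
        change -laplacianL2 (u + v) _ + _ = _
        rw [h]
        erw [h']
        abel
      map_smul' := by
        rintro c ⟨u, hu⟩
        have h' : MemLp.toLp _ (Submodule.smul_mem _ c hu).2 = c • MemLp.toLp _ hu.2 := by
          rw [← MemLp.toLp_const_smul]
          apply MemLp.toLp_congr
          filter_upwards [Lp.coeFn_smul c u] with x hx
          rw [hx]
          simp [mul_left_comm]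
        have h := laplacianL2_smul c u hu.1 (Submodule.smul_mem _ c hu).1
        change -laplacianL2 (c • u) _ + _ = _
        rw [h]
        erw [h']
        rw [RingHom.id_apply, smul_add, smul_neg] }

open Classical in
/-- The quadratic form `⟨ψ, H_N² ψ⟩ = ‖H_N ψ‖²` of the square of the self-adjoint operator `H_N`,
with its usual value `+∞` outside the form domain of `H_N²`, which is the domain of `H_N`. -/
def hamiltonianSqForm (V : Space3 → ℝ) (N : ℕ) (ψ : WaveFunction N) : ℝ≥0∞ :=
  if h : ψ ∈ (hamiltonian V N).domain then ‖hamiltonian V N ⟨ψ, h⟩‖ₑ ^ 2 else ⊤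

/-- `∫ |u|²` for a tempered distribution `u`: the squared `L²` norm if `u` is in `L²`, and `+∞`
otherwise (an infimum over the empty set). -/
def distL2NormSq {N : ℕ} (u : 𝓢'(Config N, ℂ)) : ℝ≥0∞ :=
  ⨅ (g : WaveFunction N) (_ : u = (g : 𝓢'(Config N, ℂ))), ‖g‖ₑ ^ 2

/-- `∫ |∇_{x_i} ∇_{x_j} φ|² = ∑_{a,b} ∫ |∂_{x_{i,a}} ∂_{x_{j,b}} φ|²` with distributional
derivatives; the value is `+∞` if one of these derivatives is not in `L²`. -/
def mixedGradientSq {N : ℕ} (i j : Fin N) (φ : WaveFunction N) : ℝ≥0∞ :=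
  ∑ a : Fin 3, ∑ b : Fin 3,
    distL2NormSq (∂_{(EuclideanSpace.single (i, a) 1 : Config N)}
      (∂_{(EuclideanSpace.single (j, b) 1 : Config N)} (φ : 𝓢'(Config N, ℂ))))

end GrossPitaevskii

end

/-! Split `H_N = ∑ h_i` with `h_i = -Δ_i + ½ ∑_{k ≠ i} N² V(N(x_i - x_k))`, so that `‖H_N ψ‖²` is
the sum over `i, j` of `Re ⟨h_i ψ, h_j ψ⟩`. Everything rests on a lower bound for one pair `i ≠ j`:
`Re ⟨h_i ψ, h_j ψ⟩ ≥ ½ ∫ |∇_i ∇_j (ψ / F)|²`, where `F = f(N(x_i - x_j))`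
(`re_integral_particleOp_ge`).

Put `ψ = F φ`. The scattering equation removes the interaction of `i` with `j`, and `h_i ψ = F (L_i
+ W_i) φ`, where `L_i = -F⁻² ∇_i · F² ∇_i` and `W_i ≥ 0` does not depend on `x_j`
(`particleOp_mul`). Integration by parts makes all terms that contain a `W` nonnegative. In `∫ F²
conj(L_i φ) L_j φ` it produces `∫ F² |∇_i ∇_j φ|²` and an error containing the mixed second
derivatives of `log F`. These are at most a small constant times `|x_i - x_j|⁻²`, so Hardy's
inequality, applied to `∇_i φ` in `x_j` and to `∇_j φ` in `x_i`, absorbs the error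
(`re_integral_pairOp_ge`).

The diagonal terms are not thrown away. Let `T` be the full sum, `D` its diagonal part and `S = T -
D`. Cauchy–Schwarz gives `T ≤ N D`, hence `N S ≤ (N - 1) T` (`sum_pairs_le`). By permutation
symmetry the `N (N - 1)` terms of `S` have the same lower bound `½ I`, and this is precisely `T ≥
(N² / 2) I`.

The smallness of `log F` comes from Newton's theorem. The maximum principle
(`nonpos_of_subharmonic_where_pos`) shows `0 ≤ f ≤ 1` and uniqueness of `f`, hence radial symmetry,
and identifies `f` with `1 - (4π|·|)⁻¹ * (V f / 2)`, for which one-variable formulas give the bounds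
on `f`, `∇f` and `∇²f` in terms of `strength V`.

Since `V` is only bounded and measurable, the pair bound is proved for smooth data. The radial
source `V f / 2` is mollified, which gives smooth profiles `K n` whose potentials `2 ΔF / F` are
bounded and converge almost everywhere (`IsScatteringSolution.exists_smallProfile`). Also `ψ` is
approximated in the graph norm of `Δ` by test functions. In the limit the left side is tested by
duality: `2 Re ⟨φ, ∂∂η⟩ - ‖η‖²` needs only `L²` convergence of the quotients, and the Riesz theorem
then puts the distributional derivatives in `L²` with the right total norm (`sum_distL2NormSq_le`).
The approximants need not be symmetric, so all pairs are kept until the limit, where the symmetry of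
`ψ` is used. -/

noncomputable section

namespace GrossPitaevskii

/-! ### Directional derivatives and integration by parts. -/

section DirectionalDerivative

variable {E : Type*} [NormedAddCommGroup E] [NormedSpace ℝ E]

/-- The directional derivative of a complex-valued function. -/
def pd (v : E) (u : E → ℂ) : E → ℂ := fun x => fderiv ℝ u x v

@[fun_prop]
theorem contDiff_pd {u : E → ℂ} (hu : ContDiff ℝ ∞ u) (v : E) : ContDiff ℝ ∞ (pd v u) :=
  (hu.fderiv_right (m := ∞) (by norm_cast)).clm_apply contDiff_const

theorem hasCompactSupport_pd {u : E → ℂ} (hu : HasCompactSupport u) (v : E) :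
    HasCompactSupport (pd v u) :=
  hu.fderiv_apply ℝ v

theorem pd_mul {u w : E → ℂ} (hu : ContDiff ℝ ∞ u) (hw : ContDiff ℝ ∞ w) (v : E) :
    pd v (fun x => u x * w x) = fun x => pd v u x * w x + u x * pd v w x := by
  funext x
  have hu' := (hu.differentiable (by simp)) x
  have hw' := (hw.differentiable (by simp)) x
  simp only [pd]
  rw [fderiv_fun_mul hu' hw']
  simp [mul_comm, add_comm]

theorem pd_add {u w : E → ℂ} (hu : ContDiff ℝ ∞ u) (hw : ContDiff ℝ ∞ w) (v : E) :
    pd v (fun x => u x + w x) = fun x => pd v u x + pd v w x := by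
  funext x
  have hu' := (hu.differentiable (by simp)) x
  have hw' := (hw.differentiable (by simp)) x
  simp only [pd]
  rw [fderiv_fun_add hu' hw']
  simp

theorem pd_neg (u : E → ℂ) (v : E) : pd v (fun x => -u x) = fun x => -pd v u x := by
  funext x
  simp only [pd]
  rw [fderiv_fun_neg]
  simp

theorem pd_const_mul {u : E → ℂ} (hu : ContDiff ℝ ∞ u) (c : ℂ) (v : E) :
    pd v (fun x => c * u x) = fun x => c * pd v u x := by
  funext x
  have hu' := (hu.differentiable (by simp)) x
  simp only [pd]
  rw [fderiv_const_mul hu']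
  simp

theorem pd_sum {ι : Type*} {s : Finset ι} {u : ι → E → ℂ} (hu : ∀ i ∈ s, ContDiff ℝ ∞ (u i))
    (v : E) : pd v (fun x => ∑ i ∈ s, u i x) = fun x => ∑ i ∈ s, pd v (u i) x := by
  funext x
  simp only [pd]
  rw [fderiv_fun_sum fun i hi => ((hu i hi).differentiable (by simp)) x]
  simp

@[fun_prop]
theorem contDiff_conj {u : E → ℂ} (hu : ContDiff ℝ ∞ u) :
    ContDiff ℝ ∞ (fun x => starRingEnd ℂ (u x)) :=
  Complex.conjCLE.contDiff.comp hu

theorem pd_conj {u : E → ℂ} (hu : ContDiff ℝ ∞ u) (v : E) :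
    pd v (fun x => starRingEnd ℂ (u x)) = fun x => starRingEnd ℂ (pd v u x) := by
  funext x
  have hu' := ((hu.differentiable (by simp)) x).hasFDerivAt
  have := (Complex.conjCLE.toContinuousLinearMap.hasFDerivAt.comp x hu').fderiv
  simp only [pd]
  erw [this]
  simp

theorem pd_comm {u : E → ℂ} (hu : ContDiff ℝ ∞ u) (v w : E) :
    pd v (pd w u) = pd w (pd v u) := by
  funext x
  have hd : DifferentiableAt ℝ (fderiv ℝ u) x :=
    ((hu.fderiv_right (m := ∞) (by norm_cast)).differentiable (by simp)) x
  have key : ∀ v w : E, pd v (pd w u) x = fderiv ℝ (fderiv ℝ u) x v w := by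
    intro v w
    change fderiv ℝ (fun y => fderiv ℝ u y w) x v = _
    rw [fderiv_clm_apply hd (differentiableAt_const w)]
    simp
  rw [key, key]
  exact (hu.contDiffAt.isSymmSndFDerivAt (by simpa using (WithTop.coe_le_coe.2 (le_top : (2 : ℕ∞) ≤ ⊤)))) v w

theorem pd_ofReal {u : E → ℝ} (hu : ContDiff ℝ ∞ u) (v : E) :
    pd v (fun x => (u x : ℂ)) = fun x => ((fderiv ℝ u x v : ℝ) : ℂ) := by
  funext x
  have hu' := ((hu.differentiable (by simp)) x).hasFDerivAt
  have := (Complex.ofRealCLM.hasFDerivAt.comp x hu').fderiv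
  simp only [pd]
  erw [this]
  simp

@[fun_prop]
theorem contDiff_ofReal {u : E → ℝ} (hu : ContDiff ℝ ∞ u) : ContDiff ℝ ∞ (fun x => (u x : ℂ)) :=
  Complex.ofRealCLM.contDiff.comp hu

variable [MeasurableSpace E] [BorelSpace E] {μ : Measure E}

theorem integrable_of_smooth [IsFiniteMeasureOnCompacts μ] {u : E → ℂ} (hu : ContDiff ℝ ∞ u) (hc : HasCompactSupport u) :
    Integrable u μ :=
  hu.continuous.integrable_of_hasCompactSupport hc

variable [FiniteDimensional ℝ E] [μ.IsAddHaarMeasure]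

theorem integral_pd {u : E → ℂ} (hu : ContDiff ℝ ∞ u) (hc : HasCompactSupport u) (v : E) :
    ∫ x, pd v u x ∂μ = 0 := by
  have h := integral_mul_fderiv_eq_neg_fderiv_mul_of_integrable (𝕜 := ℂ) (μ := μ)
    (f := fun _ : E => (1 : ℂ)) (g := u) (v := v) (by simp)
    (by simpa using! integrable_of_smooth (contDiff_pd hu v) (hasCompactSupport_pd hc v))
    (by simpa using integrable_of_smooth hu hc) (by simp)
    (fun x _ => (hu.differentiable (by simp)) x)
  simpa [pd] using h

theorem integral_mul_pd {u w : E → ℂ} (hu : ContDiff ℝ ∞ u) (hw : ContDiff ℝ ∞ w)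
    (hc : HasCompactSupport u) (v : E) :
    ∫ x, u x * pd v w x ∂μ = -∫ x, pd v u x * w x ∂μ := by
  have hc' : HasCompactSupport (fun x => u x * w x) := hc.mul_right
  have h := integral_pd (μ := μ) (hu.mul hw) hc' v
  rw [pd_mul hu hw, integral_add] at h
  · linear_combination h
  · exact integrable_of_smooth ((contDiff_pd hu v).mul hw) (hasCompactSupport_pd hc v).mul_right
  · exact integrable_of_smooth (hu.mul (contDiff_pd hw v)) hc.mul_right

end DirectionalDerivative

/-! ### Second-order operators in divergence form with weight `F²`. -/

section WeightedIntegration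

variable {E : Type*} [NormedAddCommGroup E] [NormedSpace ℝ E]

/-- The operator `-F⁻² ∂ᵥ (F² ∂ᵥ ·)`, written with the logarithmic derivative `l` of `F`. -/
def weightedSnd (v : E) (l φ : E → ℂ) : E → ℂ :=
  fun x => -(pd v (pd v φ) x + 2 * l x * pd v φ x)

@[fun_prop]
theorem contDiff_weightedSnd {l φ : E → ℂ} (hl : ContDiff ℝ ∞ l) (hφ : ContDiff ℝ ∞ φ) (v : E) :
    ContDiff ℝ ∞ (weightedSnd v l φ) := by
  unfold weightedSnd; fun_prop

theorem hasCompactSupport_weightedSnd {l φ : E → ℂ} (hφ : HasCompactSupport φ) (v : E) :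
    HasCompactSupport (weightedSnd v l φ) := by
  have h := hasCompactSupport_pd hφ v
  exact ((hasCompactSupport_pd h v).add (h.mul_left (f := fun x => 2 * l x))).comp_left neg_zero

variable [FiniteDimensional ℝ E] [MeasurableSpace E] [BorelSpace E] {μ : Measure E} [μ.IsAddHaarMeasure]

/-- Multiplied by `F²` the operator is the exact derivative `-∂ᵥ (F² ∂ᵥ φ)`, so a single integration
by parts suffices. -/
theorem integral_weightedSnd_mul {F l φ w : E → ℂ} (hF : ContDiff ℝ ∞ F)
    (hlr : ∀ x, starRingEnd ℂ (l x) = l x)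
    (hφ : ContDiff ℝ ∞ φ) (hc : HasCompactSupport φ) (hw : ContDiff ℝ ∞ w) (v : E)
    (hl : ∀ x, pd v F x = F x * l x) :
    ∫ x, F x ^ 2 * starRingEnd ℂ (weightedSnd v l φ x) * w x ∂μ =
      ∫ x, F x ^ 2 * starRingEnd ℂ (pd v φ x) * pd v w x ∂μ := by
  have hU : ContDiff ℝ ∞ (fun x => F x ^ 2 * starRingEnd ℂ (pd v φ x)) := by fun_prop
  have hUc : HasCompactSupport (fun x => F x ^ 2 * starRingEnd ℂ (pd v φ x)) :=
    ((hasCompactSupport_pd hc v).comp_left (map_zero _)).mul_left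
  rw [integral_mul_pd hU hw hUc v, ← integral_neg]
  congr 1
  funext x
  have h1 : (fun x => F x ^ 2) = fun x => F x * F x := by funext x; ring
  rw [pd_mul (by fun_prop) (by fun_prop), h1, pd_mul hF hF, pd_conj (by fun_prop)]
  simp only [weightedSnd, hl, map_neg, map_add, map_mul, hlr, map_ofNat]
  ring

/-- `∂ᵥ` commutes with the operator in direction `v'` except where it hits the coefficient `l'`.
Thus the only error is `pd v l'`, a mixed second derivative of `log F`. -/
theorem integral_weightedSnd_mul_weightedSnd {F l l' φ : E → ℂ} (hF : ContDiff ℝ ∞ F)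
    (hlr : ∀ x, starRingEnd ℂ (l x) = l x)
    (hl's : ContDiff ℝ ∞ l')
    (hφ : ContDiff ℝ ∞ φ) (hc : HasCompactSupport φ) (v v' : E)
    (hl : ∀ x, pd v F x = F x * l x) (hl' : ∀ x, pd v' F x = F x * l' x) :
    ∫ x, F x ^ 2 * starRingEnd ℂ (weightedSnd v l φ x) * weightedSnd v' l' φ x ∂μ =
      ∫ x, (F x ^ 2 * (starRingEnd ℂ (pd v (pd v' φ) x) * pd v (pd v' φ) x) -
        2 * F x ^ 2 * pd v l' x * (starRingEnd ℂ (pd v φ x) * pd v' φ x)) ∂μ := by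
  rw [integral_weightedSnd_mul hF hlr hφ hc (by fun_prop) v hl]
  have hcv := hasCompactSupport_pd hc v
  have hstar : HasCompactSupport (fun x => starRingEnd ℂ (pd v φ x)) :=
    hcv.comp_left (map_zero _)
  have hcv' := hasCompactSupport_pd (hasCompactSupport_pd hc v') v
  have e1 : ∀ x, pd v (weightedSnd v' l' φ) x =
      -(pd v' (pd v (pd v' φ)) x + 2 * l' x * pd v (pd v' φ) x) - 2 * pd v l' x * pd v' φ x := by
    intro x
    have : weightedSnd v' l' φ = fun x => -(pd v' (pd v' φ) x + (2 * l' x) * pd v' φ x) := rfl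
    rw [this, pd_neg, pd_add (by fun_prop) (by fun_prop), pd_mul (by fun_prop) (by fun_prop),
      pd_const_mul hl's, pd_comm (u := pd v' φ) (by fun_prop) v v']
    ring
  have hW : ContDiff ℝ ∞ (fun x => F x ^ 2 * pd v (pd v' φ) x) := by fun_prop
  have e2 : ∀ x, pd v' (fun x => F x ^ 2 * pd v (pd v' φ) x) x =
      F x ^ 2 * (pd v' (pd v (pd v' φ)) x + 2 * l' x * pd v (pd v' φ) x) := by
    intro x
    have h1 : (fun x => F x ^ 2) = fun x => F x * F x := by funext x; ring
    rw [pd_mul (by fun_prop) (by fun_prop), h1, pd_mul hF hF]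
    simp only [hl']
    ring
  -- Second integration by parts, now in `v'`: by `e2` the non-commutator part of `e1` is again an
  -- exact derivative after multiplication by `F²`.
  have key := integral_mul_pd (μ := μ) (u := fun x => starRingEnd ℂ (pd v φ x)) (by fun_prop) hW
    hstar v'
  rw [pd_conj (by fun_prop), pd_comm hφ v' v] at key
  simp only [e2] at key
  have i1 : Integrable (fun x => starRingEnd ℂ (pd v φ x) *
      (F x ^ 2 * (pd v' (pd v (pd v' φ)) x + 2 * l' x * pd v (pd v' φ) x))) μ :=
    integrable_of_smooth (by fun_prop) hstar.mul_right
  have i2 : Integrable (fun x => starRingEnd ℂ (pd v (pd v' φ) x) *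
      (F x ^ 2 * pd v (pd v' φ) x)) μ :=
    integrable_of_smooth (by fun_prop) (hcv'.comp_left (map_zero (starRingEnd ℂ))).mul_right
  have i3 : Integrable (fun x => 2 * F x ^ 2 * pd v l' x *
      (starRingEnd ℂ (pd v φ x) * pd v' φ x)) μ :=
    integrable_of_smooth (by fun_prop) hstar.mul_right.mul_left
  have e3 : (fun x => F x ^ 2 * starRingEnd ℂ (pd v φ x) * pd v (weightedSnd v' l' φ) x) =
      fun x => -(starRingEnd ℂ (pd v φ x) *
      (F x ^ 2 * (pd v' (pd v (pd v' φ)) x + 2 * l' x * pd v (pd v' φ) x))) -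
      2 * F x ^ 2 * pd v l' x * (starRingEnd ℂ (pd v φ x) * pd v' φ x) := by
    funext x
    rw [e1]; ring
  have e4 : (fun x => F x ^ 2 * (starRingEnd ℂ (pd v (pd v' φ) x) * pd v (pd v' φ) x) -
        2 * F x ^ 2 * pd v l' x * (starRingEnd ℂ (pd v φ x) * pd v' φ x)) =
      fun x => starRingEnd ℂ (pd v (pd v' φ) x) * (F x ^ 2 * pd v (pd v' φ) x) -
        2 * F x ^ 2 * pd v l' x * (starRingEnd ℂ (pd v φ x) * pd v' φ x) := by
    funext x
    ring
  rw [e3, e4, integral_sub i2 i3, integral_sub, integral_neg, key, neg_neg]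
  exacts [i1.neg, i3]

end WeightedIntegration

/-! ### Relative coordinates and functions of the distance of two particles. -/

section Coordinates

variable {N : ℕ}

/-- The partial derivative in the coordinate `(j, a)` of a function on `ℝ^{3N}`. -/
def cpd (p : Fin N × Fin 3) (u : Config N → ℂ) : Config N → ℂ :=
  pd (EuclideanSpace.single p 1) u

/-- The component `a` of `x_i - x_j`. -/
def rel (i j : Fin N) (a : Fin 3) (x : Config N) : ℝ := x (i, a) - x (j, a)

/-- The squared distance of the particles `i` and `j`. -/
def sqDist (i j : Fin N) (x : Config N) : ℝ := ∑ a, rel i j a x ^ 2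

/-- A function of the squared distance of two particles. -/
def pairFun (K : ℝ → ℝ) (i j : Fin N) (x : Config N) : ℂ := (K (sqDist i j x) : ℂ)

theorem sqDist_nonneg (i j : Fin N) (x : Config N) : 0 ≤ sqDist i j x :=
  Finset.sum_nonneg fun _ _ => sq_nonneg _

theorem sqDist_comm (i j : Fin N) (x : Config N) : sqDist i j x = sqDist j i x := by
  unfold sqDist rel
  exact Finset.sum_congr rfl fun a _ => by ring

theorem sqDist_eq (i j : Fin N) (x : Config N) :
    sqDist i j x = ‖position x i - position x j‖ ^ 2 := by
  rw [EuclideanSpace.norm_sq_eq]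
  simp [sqDist, rel, position]

@[fun_prop]
theorem contDiff_rel (i j : Fin N) (a : Fin 3) : ContDiff ℝ ∞ (rel i j a) := by
  unfold rel; fun_prop

@[fun_prop]
theorem contDiff_sqDist (i j : Fin N) : ContDiff ℝ ∞ (sqDist i j) := by
  unfold sqDist; fun_prop

@[fun_prop]
theorem contDiff_pairFun {K : ℝ → ℝ} (hK : ContDiff ℝ ∞ K) (i j : Fin N) :
    ContDiff ℝ ∞ (pairFun K i j) :=
  contDiff_ofReal (hK.comp (contDiff_sqDist i j))

@[fun_prop]
theorem contDiff_cpd {u : Config N → ℂ} (hu : ContDiff ℝ ∞ u) (p : Fin N × Fin 3) :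
    ContDiff ℝ ∞ (cpd p u) := contDiff_pd hu _

theorem conj_pairFun (K : ℝ → ℝ) (i j : Fin N) (x : Config N) :
    starRingEnd ℂ (pairFun K i j x) = pairFun K i j x := Complex.conj_ofReal _

/-- A coordinate of `ℝ^{3N}` as a continuous linear form. -/
def coordCLM (p : Fin N × Fin 3) : Config N →L[ℝ] ℝ := EuclideanSpace.proj p

@[simp]
theorem coordCLM_apply (p : Fin N × Fin 3) (x : Config N) : coordCLM p x = x p := rfl

theorem hasFDerivAt_rel (i j : Fin N) (a : Fin 3) (x : Config N) :
    HasFDerivAt (rel i j a) (coordCLM (i, a) -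
      coordCLM (j, a)) x :=
  (coordCLM (i, a)).hasFDerivAt.sub
    (coordCLM (j, a)).hasFDerivAt

/-- The sign with which `x_k` enters `x_i - x_j`. -/
def pairSign (i j k : Fin N) : ℝ := (if k = i then 1 else 0) - (if k = j then 1 else 0)

theorem fderiv_rel (i j k : Fin N) (a b : Fin 3) (x : Config N) :
    fderiv ℝ (rel i j a) x (EuclideanSpace.single (k, b) 1) =
      if a = b then pairSign i j k else 0 := by
  rw [(hasFDerivAt_rel i j a x).fderiv]
  by_cases h : a = b <;> simp [pairSign, h, eq_comm]

theorem fderiv_sqDist (i j k : Fin N) (b : Fin 3) (x : Config N) :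
    fderiv ℝ (sqDist i j) x (EuclideanSpace.single (k, b) 1) =
      2 * pairSign i j k * rel i j b x := by
  have h : HasFDerivAt (sqDist i j) (∑ a, (2 * rel i j a x) • fderiv ℝ (rel i j a) x) x := by
    unfold sqDist
    refine HasFDerivAt.fun_sum fun a _ => ?_
    have := (((contDiff_rel i j a).differentiable (by simp)) x).hasFDerivAt.pow 2
    simpa using this
  rw [h.fderiv]
  simp [fderiv_rel]
  ring

theorem cpd_pairFun {K : ℝ → ℝ} (hK : ContDiff ℝ ∞ K) (i j k : Fin N) (b : Fin 3) (x : Config N) :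
    cpd (k, b) (pairFun K i j) x =
      2 * pairSign i j k * rel i j b x * pairFun (deriv K) i j x := by
  have hK' := (hK.differentiable (by simp)) (sqDist i j x)
  have hs := ((contDiff_sqDist i j).differentiable (by simp)) x
  have h : (pairFun K i j) = fun x => ((K ∘ sqDist i j) x : ℂ) := rfl
  rw [cpd, h, pd_ofReal (hK.comp (contDiff_sqDist i j))]
  simp only [pairFun]
  rw [(hK'.hasDerivAt.comp_hasFDerivAt x hs.hasFDerivAt).fderiv]
  simp [fderiv_sqDist]
  ring

theorem cpd_rel (i j k : Fin N) (a b : Fin 3) (x : Config N) :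
    cpd (k, b) (fun x => (rel i j a x : ℂ)) x = if a = b then (pairSign i j k : ℂ) else 0 := by
  rw [cpd, pd_ofReal (contDiff_rel i j a)]
  simp only [fderiv_rel]
  split_ifs <;> simp

end Coordinates

/-! ### Hardy's inequality. -/

section Hardy

variable {N : ℕ}

theorem hasCompactSupport_cpd {u : Config N → ℂ} (hu : HasCompactSupport u) (p : Fin N × Fin 3) :
    HasCompactSupport (cpd p u) := hasCompactSupport_pd hu _

theorem integrable_norm_sq {u : Config N → ℂ} (hu : ContDiff ℝ ∞ u) (hc : HasCompactSupport u) :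
    Integrable (fun x => ‖u x‖ ^ 2) := by
  refine Continuous.integrable_of_hasCompactSupport (hu.continuous.norm.pow 2) ?_
  exact hc.norm.comp_left (g := fun t : ℝ => t ^ 2) (by simp)

theorem integrable_inv_mul_norm_sq {u : Config N → ℂ} (hu : ContDiff ℝ ∞ u)
    (hc : HasCompactSupport u) (i j : Fin N) {δ : ℝ} (hδ : 0 < δ) :
    Integrable (fun x => (sqDist i j x + δ)⁻¹ * ‖u x‖ ^ 2) := by
  refine Continuous.integrable_of_hasCompactSupport ?_ ?_
  · refine Continuous.mul ?_ (hu.continuous.norm.pow 2)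
    refine Continuous.inv₀ ?_ fun x => ?_
    · exact (contDiff_sqDist i j).continuous.add continuous_const
    · have := sqDist_nonneg i j x
      positivity
  · exact (hc.norm.comp_left (g := fun t : ℝ => t ^ 2) (by simp)).mul_left

theorem pairSign_left {i j : Fin N} (h : i ≠ j) : pairSign i j i = 1 := by simp [pairSign, h]

theorem pairSign_right {i j : Fin N} (h : i ≠ j) : pairSign i j j = -1 := by
  simp [pairSign, h.symm]

theorem pairSign_of_ne {i j k : Fin N} (hi : k ≠ i) (hj : k ≠ j) : pairSign i j k = 0 := by
  simp [pairSign, hi, hj]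

/-- A regularised Hardy inequality in the position of one particle relative to another. -/
theorem hardy {u : Config N → ℂ} (hu : ContDiff ℝ ∞ u) (hc : HasCompactSupport u) {i j : Fin N}
    (hij : i ≠ j) {δ : ℝ} (hδ : 0 < δ) :
    ∫ x, (sqDist i j x + δ)⁻¹ * ‖u x‖ ^ 2 ≤ 4 * ∑ b, ∫ x, ‖cpd (i, b) u x‖ ^ 2 := by
  set m : Config N → ℂ := fun x => (((sqDist i j x + δ)⁻¹ : ℝ) : ℂ) with hm
  have hpos : ∀ x, 0 < sqDist i j x + δ := fun x => by
    have := sqDist_nonneg i j x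
    positivity
  have hmr : ContDiff ℝ ∞ (fun x => (sqDist i j x + δ)⁻¹) :=
    ContDiff.inv (by fun_prop) fun x => (hpos x).ne'
  have hms : ContDiff ℝ ∞ m := contDiff_ofReal hmr
  have hdm : ∀ b x, cpd (i, b) m x = -(2 * m x ^ 2 * rel i j b x) := by
    intro b x
    rw [cpd, pd_ofReal hmr]
    have hs := ((contDiff_sqDist i j).differentiable (by simp) x).hasFDerivAt
    have : HasFDerivAt (fun x => (sqDist i j x + δ)⁻¹) _ x :=
      (hasDerivAt_inv (hpos x).ne').comp_hasFDerivAt x (hs.add_const δ)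
    simp only [this.fderiv]
    simp [fderiv_sqDist, pairSign_left hij, hm]
    ring
  set U : Config N → ℂ := fun x => starRingEnd ℂ (u x) * u x with hU
  have hUs : ContDiff ℝ ∞ U := by fun_prop
  have hUc : HasCompactSupport U := hc.mul_left
  have hrs : ∀ b, ContDiff ℝ ∞ (fun x => (rel i j b x : ℂ)) := fun b => by fun_prop
  have hd : ∀ b x, cpd (i, b) (fun x => m x * rel i j b x * U x) x =
      (-(2 * m x ^ 2 * rel i j b x) * rel i j b x + m x) * U x +
      m x * rel i j b x * (starRingEnd ℂ (cpd (i, b) u x) * u x +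
        starRingEnd ℂ (u x) * cpd (i, b) u x) := by
    intro b x
    have h1 := cpd_rel i j i b b x
    have h2 := hdm b x
    simp only [if_true, pairSign_left hij, cpd] at h1 h2 ⊢
    rw [pd_mul (by fun_prop) hUs, pd_mul hms (hrs b), hU, pd_mul (by fun_prop) hu, pd_conj hu]
    simp only [h1, h2]
    push_cast
    ring
  have hvc : ∀ b, HasCompactSupport (fun x => m x * rel i j b x * U x) := fun b => hUc.mul_left
  have hvs : ∀ b, ContDiff ℝ ∞ (fun x => m x * rel i j b x * U x) := fun b => by fun_prop
  have hvi : ∀ b, Integrable (cpd (i, b) (fun x => m x * rel i j b x * U x)) := fun b =>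
    integrable_of_smooth (contDiff_cpd (hvs b) _) (hasCompactSupport_cpd (hvc b) _)
  -- The divergence in `x_i` of the compactly supported field `(x_i - x_j) |u|² / (|x_i - x_j|² +
  -- δ)` has integral zero.
  have hzero : ∫ x, (∑ b, cpd (i, b) (fun x => m x * rel i j b x * U x) x).re = 0 := by
    have h1 : ∫ x, ∑ b, cpd (i, b) (fun x => m x * rel i j b x * U x) x = 0 := by
      rw [integral_finsetSum _ fun b _ => hvi b]
      exact Finset.sum_eq_zero fun b _ => integral_pd (hvs b) (hvc b) _
    have h2 := integral_re (integrable_finsetSum Finset.univ fun b _ => hvi b)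
    simp only [RCLike.re_to_complex] at h2
    rw [h2, h1]
    rfl
  have hI1 := integrable_inv_mul_norm_sq hu hc i j hδ
  have hI2 : ∀ b, Integrable (fun x => ‖cpd (i, b) u x‖ ^ 2) := fun b =>
    integrable_norm_sq (contDiff_cpd hu _) (hasCompactSupport_cpd hc _)
  -- With `t = (q + δ)⁻¹` and `q = |x_i - x_j|²`, the divergence is `(3t - 2t²q)|u|²` plus a cross
  -- term. The cross term costs `½ t²q |u|² + 2 |∇_i u|²`, and `t q ≤ 1` leaves `½ t |u|²`.
  have hpt : ∀ x, 1 / 2 * ((sqDist i j x + δ)⁻¹ * ‖u x‖ ^ 2) -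
      2 * ∑ b, ‖cpd (i, b) u x‖ ^ 2 ≤
      (∑ b, cpd (i, b) (fun x => m x * rel i j b x * U x) x).re := by
    intro x
    simp only [hd]
    set t := (sqDist i j x + δ)⁻¹ with ht
    have htpos : 0 < t := inv_pos.2 (hpos x)
    have hts : t * sqDist i j x ≤ 1 := by
      rw [ht, inv_mul_le_one₀ (hpos x)]
      linarith
    have hUx : U x = ((‖u x‖ ^ 2 : ℝ) : ℂ) := by
      simp [hU, Complex.conj_mul']
    have hmx : m x = (t : ℂ) := rfl
    have hterm : ∀ b, ((-(2 * m x ^ 2 * rel i j b x) * rel i j b x + m x) * U x +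
      m x * rel i j b x * (starRingEnd ℂ (cpd (i, b) u x) * u x +
        starRingEnd ℂ (u x) * cpd (i, b) u x)).re =
        (t - 2 * t ^ 2 * rel i j b x ^ 2) * ‖u x‖ ^ 2 +
        2 * t * rel i j b x * (starRingEnd ℂ (u x) * cpd (i, b) u x).re := by
      intro b
      rw [hUx, hmx]
      have : (starRingEnd ℂ (cpd (i, b) u x) * u x + starRingEnd ℂ (u x) * cpd (i, b) u x) =
          ((2 * (starRingEnd ℂ (u x) * cpd (i, b) u x).re : ℝ) : ℂ) := by
        apply Complex.ext <;> simp <;> ring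
      rw [this]
      norm_cast
      ring
    rw [Complex.re_sum, Finset.sum_congr rfl fun b _ => hterm b]
    have hlow : ∀ b, (t - 2 * t ^ 2 * rel i j b x ^ 2) * ‖u x‖ ^ 2 +
        2 * t * rel i j b x * (starRingEnd ℂ (u x) * cpd (i, b) u x).re ≥
        (t - 2 * t ^ 2 * rel i j b x ^ 2) * ‖u x‖ ^ 2 -
        (1 / 2 * t ^ 2 * rel i j b x ^ 2 * ‖u x‖ ^ 2 + 2 * ‖cpd (i, b) u x‖ ^ 2) := by
      intro b
      have h1 : |(starRingEnd ℂ (u x) * cpd (i, b) u x).re| ≤ ‖u x‖ * ‖cpd (i, b) u x‖ := by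
        refine (Complex.abs_re_le_norm _).trans (le_of_eq ?_)
        simp
      have h2 : |2 * t * rel i j b x * (starRingEnd ℂ (u x) * cpd (i, b) u x).re| ≤
          2 * t * |rel i j b x| * (‖u x‖ * ‖cpd (i, b) u x‖) := by
        rw [abs_mul, abs_mul, abs_of_pos (by positivity : (0 : ℝ) < 2 * t)]
        gcongr
      have h3 := neg_abs_le (2 * t * rel i j b x * (starRingEnd ℂ (u x) * cpd (i, b) u x).re)
      have h4 := sq_nonneg (t * |rel i j b x| * ‖u x‖ - 2 * ‖cpd (i, b) u x‖)
      have h5 : (t * |rel i j b x| * ‖u x‖ - 2 * ‖cpd (i, b) u x‖) ^ 2 =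
          t ^ 2 * rel i j b x ^ 2 * ‖u x‖ ^ 2 -
          4 * (t * |rel i j b x| * (‖u x‖ * ‖cpd (i, b) u x‖)) + 4 * ‖cpd (i, b) u x‖ ^ 2 := by
        rw [← sq_abs (rel i j b x)]
        ring
      linarith
    have hsum := Finset.sum_le_sum fun b (_ : b ∈ Finset.univ) => hlow b
    refine le_trans ?_ hsum
    have hs : sqDist i j x = ∑ b, rel i j b x ^ 2 := rfl
    simp only [Fin.sum_univ_three] at hs ⊢
    have h6 : 0 ≤ t * ‖u x‖ ^ 2 * (1 - t * sqDist i j x) := by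
      have := sub_nonneg.2 hts
      positivity
    rw [hs] at h6
    linarith
  have hmono := integral_mono ((hI1.const_mul (1 / 2)).sub
    ((integrable_finsetSum Finset.univ fun b _ => hI2 b).const_mul 2))
    (integrable_finsetSum Finset.univ fun b _ => hvi b).re hpt
  simp only [RCLike.re_to_complex] at hmono
  simp only [Pi.sub_apply] at hmono
  rw [hzero, integral_sub (hI1.const_mul _)
    ((integrable_finsetSum Finset.univ fun b _ => hI2 b).const_mul 2), integral_const_mul,
    integral_const_mul, integral_finsetSum _ fun b _ => hI2 b] at hmono
  linarith

end Hardy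

/-! ### Smooth substitutes for the scattering solution. -/

/-- A smooth function `K` of `q = |x|²` close to `1`, such that `x ↦ K(|x|²)` is subharmonic and
its first and second derivatives are small compared to `|x|⁻¹` and `|x|⁻²`. -/
structure SmallProfile (K : ℝ → ℝ) (δ : ℝ) : Prop where
  smooth : ContDiff ℝ ∞ K
  pos : 0 < δ
  lower : ∀ q, 9 / 10 ≤ K q
  upper : ∀ q, K q ≤ 1
  abs_deriv_le : ∀ q, 0 ≤ q → |deriv K q| ≤ 1 / 1000 * (q + δ)⁻¹
  abs_deriv_deriv_le : ∀ q, 0 ≤ q → |deriv (deriv K) q| ≤ 1 / 1000 * ((q + δ)⁻¹ * (q + δ)⁻¹)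
  subharmonic : ∀ q, 0 ≤ q → 0 ≤ 4 * q * deriv (deriv K) q + 6 * deriv K q

/-- The logarithmic derivative of a profile. -/
def logDer (K : ℝ → ℝ) (q : ℝ) : ℝ := deriv K q / K q

/-- The potential `v` with `Δ F = v F / 2` for `F(x) = K(|x|²)`, as a function of `|x|²`. -/
def profilePotential (K : ℝ → ℝ) (q : ℝ) : ℝ :=
  2 * (4 * q * deriv (deriv K) q + 6 * deriv K q) / K q

namespace SmallProfile

variable {K : ℝ → ℝ} {δ : ℝ} (h : SmallProfile K δ)
include h

theorem ne_zero (q : ℝ) : K q ≠ 0 := by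
  have := h.lower q
  intro h0
  rw [h0] at this
  norm_num at this

theorem contDiff_deriv : ContDiff ℝ ∞ (deriv K) := (contDiff_infty_iff_deriv.1 h.smooth).2

theorem contDiff_deriv_deriv : ContDiff ℝ ∞ (deriv (deriv K)) :=
  (contDiff_infty_iff_deriv.1 h.contDiff_deriv).2

theorem contDiff_logDer : ContDiff ℝ ∞ (logDer K) :=
  h.contDiff_deriv.div h.smooth h.ne_zero

theorem contDiff_profilePotential : ContDiff ℝ ∞ (profilePotential K) := by
  have h1 := h.contDiff_deriv
  have h2 := h.contDiff_deriv_deriv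
  exact ContDiff.div (by fun_prop) h.smooth h.ne_zero

theorem profilePotential_nonneg {q : ℝ} (hq : 0 ≤ q) : 0 ≤ profilePotential K q := by
  have h1 := h.subharmonic q hq
  have h2 := h.lower q
  unfold profilePotential
  positivity

theorem deriv_logDer (q : ℝ) :
    deriv (logDer K) q = deriv (deriv K) q / K q - (deriv K q / K q) ^ 2 := by
  have h1 := (h.contDiff_deriv.differentiable (by simp) q).hasDerivAt
  have h2 := (h.smooth.differentiable (by simp) q).hasDerivAt
  have h3 : HasDerivAt (logDer K) _ q := h1.div h2 (h.ne_zero q)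
  rw [h3.deriv]
  have := h.ne_zero q
  field_simp

theorem abs_logDer_le {q : ℝ} (hq : 0 ≤ q) : |logDer K q| ≤ 1 / 900 * (q + δ)⁻¹ := by
  have h1 := h.abs_deriv_le q hq
  have h2 := h.lower q
  have hδ := h.pos
  rw [logDer, abs_div, abs_of_pos (by linarith : 0 < K q), div_le_iff₀ (by linarith)]
  have : 0 ≤ (q + δ)⁻¹ := by positivity
  nlinarith

/-- The factor `q` stands for the products of components of `x_i - x_j` in the Hessian of `log F`;
since `q ≤ q + δ` it cancels one of the two powers of `(q + δ)⁻¹`. The constants satisfy `1/900 +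
1/900² ≤ 1/800`. -/
theorem abs_deriv_logDer_mul_le {q : ℝ} (hq : 0 ≤ q) :
    |deriv (logDer K) q| * q ≤ 1 / 800 * (q + δ)⁻¹ := by
  have hδ := h.pos
  have h2 := h.lower q
  have h3 := h.abs_deriv_deriv_le q hq
  have h4 := h.abs_logDer_le hq
  set t := (q + δ)⁻¹ with ht
  have htp : 0 < t := by positivity
  have htq : t * q ≤ 1 := by
    rw [ht, inv_mul_le_one₀ (by positivity)]
    linarith
  have h5 : |deriv (deriv K) q / K q| ≤ 1 / 900 * (t * t) := by
    rw [abs_div, abs_of_pos (by linarith : 0 < K q), div_le_iff₀ (by linarith)]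
    have : 0 ≤ t * t := by positivity
    nlinarith
  have h6 : (deriv K q / K q) ^ 2 ≤ 1 / 810000 * (t * t) := by
    have : (deriv K q / K q) ^ 2 = |logDer K q| ^ 2 := by rw [sq_abs, logDer]
    rw [this]
    calc |logDer K q| ^ 2 ≤ (1 / 900 * t) ^ 2 := by gcongr
      _ = _ := by ring
  have h7 : |deriv (logDer K) q| ≤ 1 / 800 * (t * t) := by
    rw [h.deriv_logDer]
    refine (abs_sub _ _).trans ?_
    rw [abs_of_nonneg (sq_nonneg (deriv K q / K q))]
    have : 0 ≤ t * t := by positivity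
    linarith
  calc |deriv (logDer K) q| * q ≤ 1 / 800 * (t * t) * q := by gcongr
    _ = 1 / 800 * t * (t * q) := by ring
    _ ≤ 1 / 800 * t * 1 := by gcongr
    _ = _ := by ring

end SmallProfile

/-! ### The kinetic cross term of a pair. -/

section PairInequality

variable {N : ℕ} {K : ℝ → ℝ} {δ : ℝ}

/-- The logarithmic derivative of `K(|x_i - x_j|²)` in the coordinate `(i, a)`. -/
def logGrad (K : ℝ → ℝ) (i j : Fin N) (a : Fin 3) (x : Config N) : ℂ :=
  2 * rel i j a x * pairFun (logDer K) i j x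

theorem conj_logGrad (K : ℝ → ℝ) (i j : Fin N) (a : Fin 3) (x : Config N) :
    starRingEnd ℂ (logGrad K i j a x) = logGrad K i j a x := by
  simp [logGrad, conj_pairFun, Complex.conj_ofNat]

theorem pairFun_comm (K : ℝ → ℝ) (i j : Fin N) : pairFun K i j = pairFun K j i := by
  funext x
  rw [pairFun, pairFun, sqDist_comm]

theorem contDiff_logGrad (h : SmallProfile K δ) (i j : Fin N) (a : Fin 3) :
    ContDiff ℝ ∞ (logGrad K i j a) := by
  have := h.contDiff_logDer
  unfold logGrad
  fun_prop

theorem cpd_pairFun_eq_mul_logGrad (h : SmallProfile K δ) {i j : Fin N} (hij : i ≠ j) (a : Fin 3)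
    (x : Config N) : cpd (i, a) (pairFun K i j) x = pairFun K i j x * logGrad K i j a x := by
  rw [cpd_pairFun h.smooth, pairSign_left hij, logGrad]
  simp only [pairFun, logDer]
  have : (K (sqDist i j x) : ℂ) ≠ 0 := by exact_mod_cast h.ne_zero _
  push_cast
  field_simp

/-- With `ℓ` the logarithmic derivative of the profile and `r = x_j - x_i`, this mixed derivative of
`log F` is `-(2 δ_ab ℓ + 4 r_a r_b ℓ')`. The constant comes from `2 (1/900 + 2/800) ≤ 3/400`. -/
theorem norm_cpd_logGrad_le (h : SmallProfile K δ) {i j : Fin N} (hij : i ≠ j) (a b : Fin 3)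
    (x : Config N) : ‖cpd (i, a) (logGrad K j i b) x‖ ≤ 3 / 400 * (sqDist i j x + δ)⁻¹ := by
  have e : cpd (i, a) (logGrad K j i b) x =
      ((2 * ((if b = a then -1 else 0) * logDer K (sqDist i j x) -
        2 * (rel j i b x * rel j i a x) * deriv (logDer K) (sqDist i j x)) : ℝ) : ℂ) := by
    have h1 := cpd_rel j i i b a x
    have h2 := cpd_pairFun h.contDiff_logDer j i i a x
    have hr : ContDiff ℝ ∞ (fun x => (rel j i b x : ℂ)) := by fun_prop
    have hL := h.contDiff_logDer
    have h3 : logGrad K j i b = fun x => 2 * ((rel j i b x : ℂ) * pairFun (logDer K) j i x) := by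
      funext x; rw [logGrad, mul_assoc]
    rw [cpd] at h1 h2 ⊢
    rw [h3, pd_const_mul (by fun_prop), pd_mul hr (by fun_prop)]
    simp only [h1, h2, pairSign_right hij.symm, pairFun]
    rw [sqDist_comm j i]
    split_ifs <;> push_cast <;> ring
  rw [e, Complex.norm_real, Real.norm_eq_abs]
  set q := sqDist i j x with hq
  have hq0 : 0 ≤ q := sqDist_nonneg i j x
  have hδ := h.pos
  have h1 := h.abs_logDer_le hq0
  have h2 := h.abs_deriv_logDer_mul_le hq0
  have hr : ∀ c, rel j i c x ^ 2 ≤ q := by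
    intro c
    rw [hq, sqDist_comm]
    exact Finset.single_le_sum (f := fun c => rel j i c x ^ 2) (fun c _ => sq_nonneg _)
      (Finset.mem_univ c)
  have h3 : |rel j i b x * rel j i a x| ≤ q := by
    rw [abs_le]
    constructor <;> nlinarith [hr a, hr b, sq_nonneg (rel j i b x - rel j i a x),
      sq_nonneg (rel j i b x + rel j i a x)]
  have h4 : |rel j i b x * rel j i a x| * |deriv (logDer K) q| ≤ 1 / 800 * (q + δ)⁻¹ := by
    refine le_trans ?_ h2
    rw [mul_comm]
    gcongr
  have h5 : |(if b = a then -1 else 0) * logDer K q| ≤ 1 / 900 * (q + δ)⁻¹ := by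
    split_ifs
    · simpa using h1
    · simpa using by positivity
  have ht : 0 ≤ (q + δ)⁻¹ := by positivity
  rw [abs_mul, abs_two]
  have h6 := abs_sub ((if b = a then -1 else 0) * logDer K q)
    (2 * (rel j i b x * rel j i a x) * deriv (logDer K) q)
  rw [abs_mul (2 * _), abs_mul 2, abs_two] at h6
  linarith

/-- The main term keeps `F² ≥ (9/10)²`. In the commutator term `F² ≤ 1` and `2|B||C| ≤ |B|² + |C|²`
separate the two first derivatives, each with the weight to which Hardy's inequality applies. -/
theorem pair_term_lower_bound (h : SmallProfile K δ) {i j : Fin N} (hij : i ≠ j) {φ : Config N → ℂ}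
    (hφ : ContDiff ℝ ∞ φ) (hc : HasCompactSupport φ) (a b : Fin 3) :
    81 / 100 * (∫ x, ‖cpd (i, a) (cpd (j, b) φ) x‖ ^ 2) -
      3 / 400 * ((∫ x, (sqDist i j x + δ)⁻¹ * ‖cpd (i, a) φ x‖ ^ 2) +
        ∫ x, (sqDist i j x + δ)⁻¹ * ‖cpd (j, b) φ x‖ ^ 2) ≤
    (∫ x, pairFun K i j x ^ 2 *
      starRingEnd ℂ (weightedSnd (EuclideanSpace.single (i, a) 1) (logGrad K i j a) φ x) *
      weightedSnd (EuclideanSpace.single (j, b) 1) (logGrad K j i b) φ x).re := by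
  have hF := contDiff_pairFun h.smooth i j
  have hl := contDiff_logGrad h i j a
  have hl' := contDiff_logGrad h j i b
  have hδ := h.pos
  rw [integral_weightedSnd_mul_weightedSnd hF (conj_logGrad K i j a) hl' hφ hc _ _
    (cpd_pairFun_eq_mul_logGrad h hij a)
    (by rw [pairFun_comm]; exact cpd_pairFun_eq_mul_logGrad h hij.symm b)]
  set f : Config N → ℂ := fun x => pairFun K i j x ^ 2 *
    (starRingEnd ℂ (cpd (i, a) (cpd (j, b) φ) x) * cpd (i, a) (cpd (j, b) φ) x) -
      2 * pairFun K i j x ^ 2 * cpd (i, a) (logGrad K j i b) x *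
        (starRingEnd ℂ (cpd (i, a) φ x) * cpd (j, b) φ x) with hf
  change _ ≤ (∫ x, f x).re
  have hc1 := hasCompactSupport_cpd hc (j, b)
  have hc2 := hasCompactSupport_cpd hc1 (i, a)
  have hfi : Integrable f := by
    refine integrable_of_smooth (by fun_prop) (HasCompactSupport.sub ?_ ?_)
    · exact hc2.mul_left.mul_left
    · exact hc1.mul_left.mul_left
  have hre := integral_re hfi
  simp only [RCLike.re_to_complex] at hre
  rw [← hre]
  have i1 := (integrable_norm_sq (by fun_prop) hc2).const_mul (81 / 100)
  have i2 := (integrable_inv_mul_norm_sq (contDiff_cpd hφ (i, a)) (hasCompactSupport_cpd hc _) i j hδ)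
  have i3 := (integrable_inv_mul_norm_sq (contDiff_cpd hφ (j, b)) hc1 i j hδ)
  have i4 : Integrable (fun x => 3 / 400 * ((sqDist i j x + δ)⁻¹ * ‖cpd (i, a) φ x‖ ^ 2 +
      (sqDist i j x + δ)⁻¹ * ‖cpd (j, b) φ x‖ ^ 2)) := (i2.add i3).const_mul _
  rw [← integral_const_mul, ← integral_add i2 i3, ← integral_const_mul, ← integral_sub i1 i4]
  refine integral_mono (i1.sub i4) hfi.re fun x => ?_
  change _ ≤ (f x).re
  set k := K (sqDist i j x) with hk
  have hk1 : 9 / 10 ≤ k := h.lower _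
  have hk2 : k ≤ 1 := h.upper _
  set A := cpd (i, a) (cpd (j, b) φ) x
  set G := cpd (i, a) (logGrad K j i b) x
  have hG : ‖G‖ ≤ 3 / 400 * (sqDist i j x + δ)⁻¹ := norm_cpd_logGrad_le h hij a b x
  set B := cpd (i, a) φ x
  set C := cpd (j, b) φ x
  have hfx : (f x).re = k ^ 2 * ‖A‖ ^ 2 - 2 * k ^ 2 * (G * (starRingEnd ℂ B * C)).re := by
    have : f x = ((k ^ 2 * ‖A‖ ^ 2 : ℝ) : ℂ) -
        ((2 * k ^ 2 : ℝ) : ℂ) * (G * (starRingEnd ℂ B * C)) := by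
      simp only [hf]
      rw [Complex.conj_mul']
      simp only [pairFun, ← hk]
      push_cast
      ring
    rw [this, Complex.sub_re, Complex.re_ofReal_mul, Complex.ofReal_re]
  rw [hfx]
  have h1 : (G * (starRingEnd ℂ B * C)).re ≤ ‖G‖ * (‖B‖ * ‖C‖) := by
    refine (Complex.re_le_norm _).trans (le_of_eq ?_)
    simp
  have hk3 : 81 / 100 ≤ k ^ 2 := by nlinarith
  have hk4 : k ^ 2 ≤ 1 := by nlinarith
  have h2 : 2 * k ^ 2 * (G * (starRingEnd ℂ B * C)).re ≤
      3 / 400 * (sqDist i j x + δ)⁻¹ * (‖B‖ ^ 2 + ‖C‖ ^ 2) := by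
    have hq := sqDist_nonneg i j x
    calc 2 * k ^ 2 * (G * (starRingEnd ℂ B * C)).re ≤ 2 * k ^ 2 * (‖G‖ * (‖B‖ * ‖C‖)) := by gcongr
      _ ≤ 2 * 1 * (3 / 400 * (sqDist i j x + δ)⁻¹ * (‖B‖ * ‖C‖)) := by gcongr
      _ = 3 / 400 * (sqDist i j x + δ)⁻¹ * (2 * ‖B‖ * ‖C‖) := by ring
      _ ≤ _ := by
        gcongr
        exact two_mul_le_add_sq _ _
  have h3 : 81 / 100 * ‖A‖ ^ 2 ≤ k ^ 2 * ‖A‖ ^ 2 := by gcongr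
  linarith

end PairInequality

/-! ### Ground-state substitution and the lower bound for one pair. -/

section TwoParticleOperators

variable {N : ℕ} {K : ℝ → ℝ} {δ : ℝ}

/-- The operator `-F⁻² ∇_i (F² ∇_i ·) + W` for `F = K(|x_i - x_j|²)`. -/
def pairOp (K : ℝ → ℝ) (i j : Fin N) (W : Config N → ℝ) (φ : Config N → ℂ) (x : Config N) : ℂ :=
  ∑ a, weightedSnd (EuclideanSpace.single (i, a) 1) (logGrad K i j a) φ x + W x * φ x

theorem hardy_comm {u : Config N → ℂ} (hu : ContDiff ℝ ∞ u) (hc : HasCompactSupport u)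
    {i j : Fin N} (hij : i ≠ j) (hδ : 0 < δ) :
    ∫ x, (sqDist i j x + δ)⁻¹ * ‖u x‖ ^ 2 ≤ 4 * ∑ b, ∫ x, ‖cpd (j, b) u x‖ ^ 2 := by
  simp only [sqDist_comm i j]
  exact hardy hu hc hij.symm hδ

theorem cpd_comm {u : Config N → ℂ} (hu : ContDiff ℝ ∞ u) (p q : Fin N × Fin 3) :
    cpd p (cpd q u) = cpd q (cpd p u) := pd_comm hu _ _

/-- Since `W` is constant in the direction of differentiation, integration by parts yields `∫ F² W
|∂φ|²` with no derivative on `W`. -/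
theorem re_integral_weightedSnd_mul_nonneg (h : SmallProfile K δ) {i j : Fin N} (hij : i ≠ j)
    {W : Config N → ℝ} (hW : ContDiff ℝ ∞ W) (hW0 : ∀ x, 0 ≤ W x) (a : Fin 3)
    (hWi : ∀ x, cpd (i, a) (fun x => (W x : ℂ)) x = 0) {φ : Config N → ℂ}
    (hφ : ContDiff ℝ ∞ φ) (hc : HasCompactSupport φ) :
    0 ≤ (∫ x, pairFun K i j x ^ 2 *
      starRingEnd ℂ (weightedSnd (EuclideanSpace.single (i, a) 1) (logGrad K i j a) φ x) *
      (W x * φ x)).re := by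
  have hF := contDiff_pairFun h.smooth i j
  rw [integral_weightedSnd_mul hF (conj_logGrad K i j a) hφ hc (by fun_prop) _
    (cpd_pairFun_eq_mul_logGrad h hij a)]
  have e : ∀ x, pairFun K i j x ^ 2 * starRingEnd ℂ (pd (EuclideanSpace.single (i, a) 1) φ x) *
      pd (EuclideanSpace.single (i, a) 1) (fun x => (W x : ℂ) * φ x) x =
      ((K (sqDist i j x) ^ 2 * W x * ‖pd (EuclideanSpace.single (i, a) 1) φ x‖ ^ 2 : ℝ) : ℂ) := by
    intro x
    have := hWi x
    rw [cpd] at this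
    rw [pd_mul (by fun_prop) hφ]
    simp only [this, pairFun]
    push_cast
    rw [← Complex.conj_mul']
    ring
  simp only [e]
  rw [integral_complex_ofReal, Complex.ofReal_re]
  refine integral_nonneg fun x => ?_
  have := hW0 x
  positivity

/-- Of the four products only the kinetic one can have a negative part: the mixed terms are covered
by `re_integral_weightedSnd_mul_nonneg`, and the last one is `∫ F² W_i W_j |φ|²`. The negative
kinetic part is controlled by Hardy's inequality for first derivatives of `φ`. -/
theorem re_integral_pairOp_ge (h : SmallProfile K δ) {i j : Fin N} (hij : i ≠ j)
    {Wi Wj : Config N → ℝ} (hWi : ContDiff ℝ ∞ Wi) (hWj : ContDiff ℝ ∞ Wj)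
    (hWi0 : ∀ x, 0 ≤ Wi x) (hWj0 : ∀ x, 0 ≤ Wj x)
    (hWi' : ∀ b x, cpd (j, b) (fun x => (Wi x : ℂ)) x = 0)
    (hWj' : ∀ a x, cpd (i, a) (fun x => (Wj x : ℂ)) x = 0) {φ : Config N → ℂ}
    (hφ : ContDiff ℝ ∞ φ) (hc : HasCompactSupport φ) :
    1 / 2 * ∑ a, ∑ b, ∫ x, ‖cpd (i, a) (cpd (j, b) φ) x‖ ^ 2 ≤
      (∫ x, starRingEnd ℂ (pairFun K i j x * pairOp K i j Wi φ x) *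
        (pairFun K i j x * pairOp K j i Wj φ x)).re := by
  have hF := contDiff_pairFun h.smooth i j
  have hl := contDiff_logGrad h i j
  have hl' := contDiff_logGrad h j i
  have hδ := h.pos
  set A : Fin 3 → Config N → ℂ := fun a =>
    weightedSnd (EuclideanSpace.single (i, a) 1) (logGrad K i j a) φ with hA
  set B : Fin 3 → Config N → ℂ := fun b =>
    weightedSnd (EuclideanSpace.single (j, b) 1) (logGrad K j i b) φ with hB
  have hAs : ∀ a, ContDiff ℝ ∞ (A a) := fun a => contDiff_weightedSnd (hl a) hφ _
  have hBs : ∀ b, ContDiff ℝ ∞ (B b) := fun b => contDiff_weightedSnd (hl' b) hφ _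
  have hBc : ∀ b, HasCompactSupport (B b) := fun b => hasCompactSupport_weightedSnd hc _
  have i1 : ∀ a b, Integrable (fun x => pairFun K i j x ^ 2 * starRingEnd ℂ (A a x) * B b x) :=
    fun a b => integrable_of_smooth (by fun_prop) (hBc b).mul_left
  have i2 : ∀ a, Integrable (fun x => pairFun K i j x ^ 2 * starRingEnd ℂ (A a x) *
      (Wj x * φ x)) := fun a => integrable_of_smooth (by fun_prop) hc.mul_left.mul_left
  have i3 : ∀ b, Integrable (fun x => pairFun K i j x ^ 2 * starRingEnd ℂ (Wi x * φ x) * B b x) :=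
    fun b => integrable_of_smooth (by fun_prop) (hBc b).mul_left
  have i4 : Integrable (fun x => pairFun K i j x ^ 2 * starRingEnd ℂ (Wi x * φ x) *
      (Wj x * φ x)) := integrable_of_smooth (by fun_prop) hc.mul_left.mul_left
  have hexp : ∀ x, starRingEnd ℂ (pairFun K i j x * pairOp K i j Wi φ x) *
        (pairFun K i j x * pairOp K j i Wj φ x) =
      ((∑ a, ∑ b, pairFun K i j x ^ 2 * starRingEnd ℂ (A a x) * B b x) +
        ∑ a, pairFun K i j x ^ 2 * starRingEnd ℂ (A a x) * (Wj x * φ x)) +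
      ((∑ b, pairFun K i j x ^ 2 * starRingEnd ℂ (Wi x * φ x) * B b x) +
        pairFun K i j x ^ 2 * starRingEnd ℂ (Wi x * φ x) * (Wj x * φ x)) := by
    intro x
    simp only [pairOp, map_mul, map_add, conj_pairFun, Fin.sum_univ_three, hA, hB]
    ring
  simp only [hexp]
  rw [integral_add, integral_add, integral_add, integral_finsetSum, integral_finsetSum,
    integral_finsetSum]
  rotate_left
  · exact fun b _ => i3 b
  · exact fun a _ => i2 a
  · exact fun a _ => integrable_finsetSum _ fun b _ => i1 a b
  · exact integrable_finsetSum _ fun b _ => i3 b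
  · exact i4
  · exact integrable_finsetSum _ fun a _ => integrable_finsetSum _ fun b _ => i1 a b
  · exact integrable_finsetSum _ fun a _ => i2 a
  · exact (integrable_finsetSum _ fun a _ => integrable_finsetSum _ fun b _ => i1 a b).add
      (integrable_finsetSum _ fun a _ => i2 a)
  · exact (integrable_finsetSum _ fun b _ => i3 b).add i4
  have hin : ∀ a, ∫ x, ∑ b, pairFun K i j x ^ 2 * starRingEnd ℂ (A a x) * B b x =
      ∑ b, ∫ x, pairFun K i j x ^ 2 * starRingEnd ℂ (A a x) * B b x := fun a =>
    integral_finsetSum _ fun b _ => i1 a b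
  simp only [hin, Complex.add_re, Complex.re_sum]
  have t2 : 0 ≤ ∑ a, (∫ x, pairFun K i j x ^ 2 * starRingEnd ℂ (A a x) * (Wj x * φ x)).re :=
    Finset.sum_nonneg fun a _ => re_integral_weightedSnd_mul_nonneg h hij hWj hWj0 a (hWj' a) hφ hc
  have t3 : 0 ≤ ∑ b, (∫ x, pairFun K i j x ^ 2 * starRingEnd ℂ (Wi x * φ x) * B b x).re := by
    refine Finset.sum_nonneg fun b _ => ?_
    have := re_integral_weightedSnd_mul_nonneg h hij.symm hWi hWi0 b (hWi' b) hφ hc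
    rw [pairFun_comm K j i] at this
    have e : ∫ x, pairFun K i j x ^ 2 * starRingEnd ℂ (Wi x * φ x) * B b x =
        starRingEnd ℂ (∫ x, pairFun K i j x ^ 2 * starRingEnd ℂ (B b x) * (Wi x * φ x)) := by
      rw [← integral_conj]
      congr 1
      funext x
      simp only [map_mul, map_pow, conj_pairFun, Complex.conj_conj, Complex.conj_ofReal]
      ring
    rw [e, Complex.conj_re]
    exact this
  have t4 : 0 ≤ (∫ x, pairFun K i j x ^ 2 * starRingEnd ℂ (Wi x * φ x) * (Wj x * φ x)).re := by
    have e : ∀ x, pairFun K i j x ^ 2 * starRingEnd ℂ (Wi x * φ x) * (Wj x * φ x) =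
        ((K (sqDist i j x) ^ 2 * (Wi x * Wj x) * ‖φ x‖ ^ 2 : ℝ) : ℂ) := by
      intro x
      simp only [map_mul, Complex.conj_ofReal, pairFun]
      push_cast
      rw [← Complex.conj_mul']
      ring
    simp only [e]
    rw [integral_complex_ofReal, Complex.ofReal_re]
    refine integral_nonneg fun x => ?_
    have := hWi0 x
    have := hWj0 x
    positivity
  set q : Fin 3 → Fin 3 → ℝ := fun a b => ∫ x, ‖cpd (i, a) (cpd (j, b) φ) x‖ ^ 2 with hq
  set r : Fin 3 → ℝ := fun a => ∫ x, (sqDist i j x + δ)⁻¹ * ‖cpd (i, a) φ x‖ ^ 2 with hr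
  set s : Fin 3 → ℝ := fun b => ∫ x, (sqDist i j x + δ)⁻¹ * ‖cpd (j, b) φ x‖ ^ 2 with hs
  -- Hardy is used in the variable not yet differentiated, so that a mixed derivative appears: in
  -- `x_j` for `∂_{i,a} φ`, in `x_i` for `∂_{j,b} φ`.
  have hr' : ∀ a, r a ≤ 4 * ∑ b, q a b := by
    intro a
    have := hardy_comm (contDiff_cpd hφ (i, a)) (hasCompactSupport_cpd hc _) hij hδ
    have e : ∀ b, cpd (j, b) (cpd (i, a) φ) = cpd (i, a) (cpd (j, b) φ) := fun b => cpd_comm hφ _ _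
    simp only [e] at this
    exact this
  have hs' : ∀ b, s b ≤ 4 * ∑ a, q a b := fun b =>
    hardy (contDiff_cpd hφ (j, b)) (hasCompactSupport_cpd hc _) hij hδ
  have t1 : ∀ a b, 81 / 100 * q a b - 3 / 400 * (r a + s b) ≤
      (∫ x, pairFun K i j x ^ 2 * starRingEnd ℂ (A a x) * B b x).re := fun a b =>
    pair_term_lower_bound h hij hφ hc a b
  have t1' := Finset.sum_le_sum fun a (_ : a ∈ Finset.univ) =>
    Finset.sum_le_sum fun b (_ : b ∈ Finset.univ) => t1 a b
  have hq0 : ∀ a b, 0 ≤ q a b := fun a b => integral_nonneg fun x => sq_nonneg _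
  -- Each `r a` and each `s b` occurs three times, so the loss is at most `3/400 · 3 · (4 + 4) =
  -- 18/100` of the main sum, and `81/100 - 18/100 ≥ 1/2`.
  have t5 : 1 / 2 * ∑ a, ∑ b, q a b ≤
      ∑ a, ∑ b, (81 / 100 * q a b - 3 / 400 * (r a + s b)) := by
    simp only [Fin.sum_univ_three] at hr' hs' ⊢
    linarith [hr' 0, hr' 1, hr' 2, hs' 0, hs' 1, hs' 2, hq0 0 0, hq0 0 1, hq0 0 2, hq0 1 0,
      hq0 1 1, hq0 1 2, hq0 2 0, hq0 2 1, hq0 2 2]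
  linarith

/-- The one-particle part `-Δ_{x_i} + ½ ∑_{k ≠ i} v(|x_i - x_k|²)` of the Hamiltonian. -/
def particleOp (v : ℝ → ℝ) (i : Fin N) (ψ : Config N → ℂ) (x : Config N) : ℂ :=
  -∑ a, cpd (i, a) (cpd (i, a) ψ) x +
    1 / 2 * (∑ k ∈ Finset.univ.erase i, pairFun v i k x) * ψ x

/-- Half of the interaction of the particle `i` with all particles except `j`. -/
def otherPotential (v : ℝ → ℝ) (i j : Fin N) (x : Config N) : ℝ :=
  1 / 2 * ∑ k ∈ (Finset.univ.erase i).erase j, v (sqDist i k x)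

theorem contDiff_otherPotential {v : ℝ → ℝ} (hv : ContDiff ℝ ∞ v) (i j : Fin N) :
    ContDiff ℝ ∞ (otherPotential v i j) := by
  unfold otherPotential
  exact contDiff_const.mul (ContDiff.sum fun k _ => hv.comp (contDiff_sqDist i k))

/-- Only differences `x_i - x_k` with `k ≠ j` enter. This independence is what makes the potential
cross terms nonnegative. -/
theorem cpd_otherPotential {v : ℝ → ℝ} (hv : ContDiff ℝ ∞ v) {i j : Fin N} (hij : i ≠ j)
    (b : Fin 3) (x : Config N) : cpd (j, b) (fun x => (otherPotential v i j x : ℂ)) x = 0 := by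
  have e : (fun x => (otherPotential v i j x : ℂ)) =
      fun x => (1 / 2 : ℂ) * ∑ k ∈ (Finset.univ.erase i).erase j, pairFun v i k x := by
    funext x
    simp [otherPotential, pairFun]
  have hs : ∀ k, ContDiff ℝ ∞ (pairFun v i k) := fun k => contDiff_pairFun hv i k
  rw [e, cpd, pd_const_mul (by fun_prop), pd_sum fun k _ => hs k]
  simp only [mul_eq_zero]
  right
  refine Finset.sum_eq_zero fun k hk => ?_
  have hk' : j ≠ k := ((Finset.mem_erase.1 hk).1).symm
  have := cpd_pairFun hv i k j b x
  rw [pairSign_of_ne hij.symm hk'] at this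
  simpa [cpd] using this

/-- In `Δ_i (F φ)` the term `(Δ_i F) φ` equals `½ v F φ` by the choice of `profilePotential`, and
cancels the interaction of `i` with `j`. The remaining derivatives are collected in the
divergence-form operator. -/
theorem particleOp_mul (h : SmallProfile K δ) {i j : Fin N} (hij : i ≠ j) {φ : Config N → ℂ}
    (hφ : ContDiff ℝ ∞ φ) (x : Config N) :
    particleOp (profilePotential K) i (fun x => pairFun K i j x * φ x) x =
      pairFun K i j x * pairOp K i j (otherPotential (profilePotential K) i j) φ x := by
  have hF := contDiff_pairFun h.smooth i j
  have hF1 := contDiff_pairFun h.contDiff_deriv i j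
  have hl := contDiff_logGrad h i j
  have e1 : ∀ a, cpd (i, a) (pairFun K i j) =
      fun x => (2 * rel i j a x) * pairFun (deriv K) i j x := by
    intro a
    funext x
    rw [cpd_pairFun h.smooth, pairSign_left hij]
    push_cast
    ring
  have e2 : ∀ a, cpd (i, a) (cpd (i, a) (pairFun K i j)) x =
      2 * pairFun (deriv K) i j x +
        4 * rel i j a x ^ 2 * pairFun (deriv (deriv K)) i j x := by
    intro a
    rw [e1]
    have h1 := cpd_rel i j i a a x
    have h2 := cpd_pairFun h.contDiff_deriv i j i a x
    simp only [if_true, pairSign_left hij, cpd] at h1 h2 ⊢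
    rw [pd_mul (by fun_prop) hF1, pd_const_mul (by fun_prop)]
    simp only [h1, h2]
    push_cast
    ring
  have e3 : ∀ a, cpd (i, a) (cpd (i, a) (fun x => pairFun K i j x * φ x)) x =
      -(pairFun K i j x * weightedSnd (EuclideanSpace.single (i, a) 1) (logGrad K i j a) φ x) +
        cpd (i, a) (cpd (i, a) (pairFun K i j)) x * φ x := by
    intro a
    have h1 := cpd_pairFun_eq_mul_logGrad h hij a x
    rw [cpd] at h1
    simp only [cpd]
    rw [pd_mul hF hφ, pd_add (by fun_prop) (by fun_prop), pd_mul (by fun_prop) hφ,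
      pd_mul hF (by fun_prop)]
    simp only [weightedSnd, h1]
    ring
  have e4 : ∑ a, cpd (i, a) (cpd (i, a) (pairFun K i j)) x =
      1 / 2 * pairFun (profilePotential K) i j x * pairFun K i j x := by
    simp only [e2]
    have hq : (sqDist i j x : ℂ) = ∑ a, (rel i j a x : ℂ) ^ 2 := by simp [sqDist]
    simp only [pairFun, profilePotential] at hq ⊢
    have : (K (sqDist i j x) : ℂ) ≠ 0 := by exact_mod_cast h.ne_zero _
    push_cast
    field_simp
    rw [hq]
    simp only [Fin.sum_univ_three]
    ring
  have e5 : ∑ k ∈ Finset.univ.erase i, pairFun (profilePotential K) i k x =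
      pairFun (profilePotential K) i j x +
        2 * (otherPotential (profilePotential K) i j x : ℂ) := by
    rw [← Finset.add_sum_erase _ _ (Finset.mem_erase.2 ⟨hij.symm, Finset.mem_univ j⟩)]
    simp [otherPotential, pairFun]
  simp only [particleOp, pairOp, e3, e5]
  rw [Finset.sum_add_distrib, ← Finset.sum_mul, e4, Finset.sum_neg_distrib, ← Finset.mul_sum]
  ring

theorem re_integral_particleOp_ge (h : SmallProfile K δ) {i j : Fin N} (hij : i ≠ j)
    {ψ : Config N → ℂ} (hψ : ContDiff ℝ ∞ ψ) (hc : HasCompactSupport ψ) :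
    1 / 2 * ∑ a, ∑ b, ∫ x, ‖cpd (i, a) (cpd (j, b) (fun x => ψ x / pairFun K i j x)) x‖ ^ 2 ≤
      (∫ x, starRingEnd ℂ (particleOp (profilePotential K) i ψ x) *
        particleOp (profilePotential K) j ψ x).re := by
  have hne : ∀ x, pairFun K i j x ≠ 0 := fun x => by
    simp only [pairFun]
    exact_mod_cast h.ne_zero _
  have hF := contDiff_pairFun h.smooth i j
  set φ : Config N → ℂ := fun x => ψ x / pairFun K i j x with hφ
  have hφ' : φ = fun x => ψ x * (pairFun K i j x)⁻¹ := by
    funext x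
    exact div_eq_mul_inv _ _
  have hφs : ContDiff ℝ ∞ φ := by
    rw [hφ']
    exact hψ.mul (hF.inv hne)
  have hφc : HasCompactSupport φ := by
    rw [hφ']
    exact hc.mul_right
  have hψφ : ψ = fun x => pairFun K i j x * φ x := by
    funext x
    simp only [hφ]
    rw [mul_div_cancel₀ _ (hne x)]
  have hv := h.contDiff_profilePotential
  have hv0 : ∀ i j : Fin N, ∀ x, 0 ≤ otherPotential (profilePotential K) i j x := fun i j x =>
    mul_nonneg (by norm_num)
      (Finset.sum_nonneg fun k _ => h.profilePotential_nonneg (sqDist_nonneg i k x))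
  have key := re_integral_pairOp_ge h hij (contDiff_otherPotential hv i j)
    (contDiff_otherPotential hv j i) (hv0 i j) (hv0 j i) (cpd_otherPotential hv hij)
    (cpd_otherPotential hv hij.symm) hφs hφc
  have e1 : ∀ x, particleOp (profilePotential K) i ψ x = _ := fun x =>
    (congrArg (fun u => particleOp (profilePotential K) i u x) hψφ).trans (particleOp_mul h hij hφs x)
  have e2 : ∀ x, particleOp (profilePotential K) j ψ x = _ := fun x =>
    (congrArg (fun u => particleOp (profilePotential K) j u x)
      (by rw [← pairFun_comm K i j]; exact hψφ)).trans (particleOp_mul h hij.symm hφs x)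
  simp only [e1, e2, pairFun_comm K j i]
  exact key

end TwoParticleOperators

/-! ### Summing the pair bounds over all particles. -/

section ManyParticles

variable {N : ℕ} {K : ℝ → ℝ} {δ : ℝ}

theorem contDiff_particleOp {v : ℝ → ℝ} (hv : ContDiff ℝ ∞ v) (i : Fin N) {ψ : Config N → ℂ}
    (hψ : ContDiff ℝ ∞ ψ) : ContDiff ℝ ∞ (particleOp v i ψ) := by
  have : ∀ k, ContDiff ℝ ∞ (pairFun v i k) := fun k => contDiff_pairFun hv i k
  unfold particleOp
  fun_prop

theorem hasCompactSupport_particleOp (v : ℝ → ℝ) (i : Fin N) {ψ : Config N → ℂ}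
    (hc : HasCompactSupport ψ) : HasCompactSupport (particleOp v i ψ) := by
  refine HasCompactSupport.add ?_ hc.mul_left
  refine HasCompactSupport.intro hc fun x hx => ?_
  have : ∀ a, cpd (i, a) (cpd (i, a) ψ) x = 0 := fun a => by
    by_contra h0
    have h1 := tsupport_fderiv_apply_subset ℝ (f := ψ) (EuclideanSpace.single (i, a) (1 : ℝ))
    have h2 := tsupport_fderiv_apply_subset ℝ (f := cpd (i, a) ψ)
      (EuclideanSpace.single (i, a) (1 : ℝ))
    exact hx (h1 (h2 (subset_tsupport _ h0)))
  simp [this]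

/-- The `N`-body energy bound for a smooth compactly supported wave function and an interaction
that comes from a smooth profile. -/
theorem sum_pairs_le (h : SmallProfile K δ) {ψ : Config N → ℂ} (hψ : ContDiff ℝ ∞ ψ)
    (hc : HasCompactSupport ψ) :
    N * ∑ i, ∑ j ∈ Finset.univ.erase i, ∑ a, ∑ b,
        ∫ x, ‖cpd (i, a) (cpd (j, b) (fun x => ψ x / pairFun K i j x)) x‖ ^ 2 ≤
      2 * (N - 1) * ∫ x, ‖∑ i, particleOp (profilePotential K) i ψ x‖ ^ 2 := by
  rcases Nat.eq_zero_or_pos N with rfl | hN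
  · simp
  set u : Fin N → Config N → ℂ := fun i => particleOp (profilePotential K) i ψ with hu
  have hus : ∀ i, ContDiff ℝ ∞ (u i) := fun i =>
    contDiff_particleOp h.contDiff_profilePotential i hψ
  have huc : ∀ i, HasCompactSupport (u i) := fun i => hasCompactSupport_particleOp _ i hc
  set c : Fin N → Fin N → ℝ := fun i j => (∫ x, starRingEnd ℂ (u i x) * u j x).re with hcdef
  have hint : ∀ i j, Integrable (fun x => starRingEnd ℂ (u i x) * u j x) := fun i j =>
    integrable_of_smooth (by fun_prop) (huc j).mul_left
  have hcre : ∀ i j, c i j = ∫ x, (starRingEnd ℂ (u i x) * u j x).re := fun i j =>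
    (integral_re (hint i j)).symm
  have hre : ∀ i j, Integrable (fun x => (starRingEnd ℂ (u i x) * u j x).re) := fun i j =>
    (hint i j).re
  have hself : ∀ i x, (starRingEnd ℂ (u i x) * u i x).re = ‖u i x‖ ^ 2 := fun i x => by
    rw [Complex.conj_mul']
    norm_cast
  have hT : ∫ x, ‖∑ i, u i x‖ ^ 2 = ∑ i, ∑ j, c i j := by
    simp only [hcre]
    rw [← Finset.sum_congr rfl fun i _ => integral_finsetSum _ fun j _ => hre i j,
      ← integral_finsetSum _ fun i _ => integrable_finsetSum _ fun j _ => hre i j]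
    congr 1
    funext x
    have : ((‖∑ i, u i x‖ ^ 2 : ℝ) : ℂ) = ∑ i, ∑ j, starRingEnd ℂ (u i x) * u j x := by
      push_cast
      rw [← Complex.conj_mul', map_sum, Finset.sum_mul_sum]
    rw [← Complex.ofReal_re (‖∑ i, u i x‖ ^ 2), this]
    simp only [Complex.re_sum]
  have hcs : ∀ i j, c i j ≤ 1 / 2 * (c i i + c j j) := by
    intro i j
    simp only [hcre]
    rw [← integral_add (hre i i) (hre j j), ← integral_const_mul]
    refine integral_mono (hre i j) (((hre i i).add (hre j j)).const_mul _) fun x => ?_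
    simp only [hself]
    have h1 : (starRingEnd ℂ (u i x) * u j x).re ≤ ‖u i x‖ * ‖u j x‖ := by
      refine (Complex.re_le_norm _).trans (le_of_eq ?_)
      simp
    nlinarith [sq_nonneg (‖u i x‖ - ‖u j x‖)]
  have hlow : ∀ i, ∀ j ∈ Finset.univ.erase i, 1 / 2 * ∑ a, ∑ b,
      ∫ x, ‖cpd (i, a) (cpd (j, b) (fun x => ψ x / pairFun K i j x)) x‖ ^ 2 ≤ c i j :=
    fun i j hj => re_integral_particleOp_ge h (Finset.ne_of_mem_erase hj).symm hψ hc
  have hsum := Finset.sum_le_sum fun i (_ : i ∈ Finset.univ) => Finset.sum_le_sum (hlow i)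
  simp only [← Finset.mul_sum] at hsum
  have hsplit : ∑ i, ∑ j, c i j = ∑ i, c i i + ∑ i, ∑ j ∈ Finset.univ.erase i, c i j := by
    rw [← Finset.sum_add_distrib]
    exact Finset.sum_congr rfl fun i _ => (Finset.add_sum_erase _ _ (Finset.mem_univ i)).symm
  -- The diagonal carries at least a fraction `1/N` of the total; this is Cauchy–Schwarz for the sum
  -- of the `u i`.
  have hoff : ∑ i, ∑ j, c i j ≤ N * ∑ i, c i i := by
    refine (Finset.sum_le_sum fun i _ => Finset.sum_le_sum fun j _ => hcs i j).trans (le_of_eq ?_)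
    simp only [mul_add, Finset.sum_add_distrib, ← Finset.mul_sum, Finset.sum_const,
      Finset.card_univ, Fintype.card_fin, nsmul_eq_mul]
    ring
  rw [hT]
  set D := ∑ i, c i i
  set S := ∑ i, ∑ j ∈ Finset.univ.erase i, c i j
  have hN1 : (1 : ℝ) ≤ N := by exact_mod_cast hN
  rw [hsplit] at hoff ⊢
  -- From `D + S ≤ N D` follows `N S ≤ (N - 1)(D + S)`; the factor `2` in the goal undoes the `½` in
  -- `hsum`.
  nlinarith

/-- Each unordered pair is counted once from either particle, with weight `½`. -/
theorem sum_particleOp (v : ℝ → ℝ) (ψ : Config N → ℂ) (x : Config N) :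
    ∑ i, particleOp v i ψ x = -∑ p : Fin N × Fin 3, cpd p (cpd p ψ) x +
      (∑ i, ∑ j ∈ Finset.Ioi i, pairFun v i j x) * ψ x := by
  simp only [particleOp, Finset.sum_add_distrib, Finset.sum_neg_distrib, Fintype.sum_prod_type]
  congr 1
  rw [← Finset.sum_mul, ← Finset.mul_sum]
  congr 1
  have h1 : ∀ i : Fin N, ∑ k ∈ Finset.univ.erase i, pairFun v i k x =
      ∑ k ∈ Finset.Ioi i, pairFun v i k x + ∑ k ∈ Finset.Iio i, pairFun v i k x := by
    intro i
    rw [← Finset.sum_union]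
    · congr 1
      ext k
      simp only [Finset.mem_erase, Finset.mem_univ, Finset.mem_union, Finset.mem_Ioi,
        Finset.mem_Iio, and_true]
      exact ⟨fun h => h.lt_or_gt.symm, fun h => h.elim (fun h => h.ne') fun h => h.ne⟩
    · rw [Finset.disjoint_left]
      intro k hk hk'
      exact absurd (Finset.mem_Ioi.1 hk) (Finset.mem_Iio.1 hk').not_gt
  have h2 : ∑ i, ∑ k ∈ Finset.Iio i, pairFun v i k x =
      ∑ i, ∑ k ∈ Finset.Ioi i, pairFun v i k x := by
    rw [Finset.sum_comm' (t' := Finset.univ) (s' := fun k => Finset.Ioi k) (by simp)]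
    exact Finset.sum_congr rfl fun i _ => Finset.sum_congr rfl fun k _ => by
      rw [pairFun_comm]
  simp only [h1, Finset.sum_add_distrib, h2]
  ring

end ManyParticles

/-! ### Newton potentials of radial charges in the variable `q = |x|²`. -/

section NewtonPotential

/-- `1 - (4π|·|)⁻¹ * w` for the radial charge density `w(x) = ϱ(|x|²)` on `ℝ³`, as a function of
`q = |x|²`, by Newton's theorem. -/
def newton (ϱ : ℝ → ℝ) (q : ℝ) : ℝ :=
  1 - 1 / 2 * ∫ τ in Set.Ioi (0 : ℝ), ϱ τ * (√τ / max √τ √q)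

/-- A smooth compactly supported charge density on `(0, ∞)` bounded by `C / τ`. -/
structure SmoothSource (ϱ : ℝ → ℝ) (ε C : ℝ) : Prop where
  smooth : ContDiff ℝ ∞ ϱ
  compact : HasCompactSupport ϱ
  pos : 0 < ε
  zero : ∀ τ, τ ≤ ε → ϱ τ = 0
  nonneg : ∀ τ, 0 ≤ ϱ τ
  mul_le : ∀ τ, ϱ τ * τ ≤ C

/-- The charge in the ball of squared radius `q`, up to a constant. -/
def charge (ϱ : ℝ → ℝ) (q : ℝ) : ℝ := ∫ τ in (0 : ℝ)..q, √τ * ϱ τ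

theorem newtonWeight_nonneg (τ q : ℝ) : 0 ≤ √τ / max √τ √q := by positivity

theorem newtonWeight_le_one (τ q : ℝ) : √τ / max √τ √q ≤ 1 :=
  div_le_one_of_le₀ (le_max_left _ _) (by positivity)

theorem measurable_newtonWeight (q : ℝ) : Measurable (fun τ : ℝ => √τ / max √τ √q) := by
  fun_prop

theorem integrableOn_mul_newtonWeight {ϱ : ℝ → ℝ} (hω : IntegrableOn ϱ (Set.Ioi 0)) (q : ℝ) :
    IntegrableOn (fun τ => ϱ τ * (√τ / max √τ √q)) (Set.Ioi 0) := by
  refine Integrable.mul_bdd (c := 1) hω (measurable_newtonWeight q).aestronglyMeasurable ?_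
  filter_upwards with τ
  rw [Real.norm_of_nonneg (newtonWeight_nonneg τ q)]
  exact newtonWeight_le_one τ q

theorem newton_le_one {ϱ : ℝ → ℝ} (h0 : ∀ τ, 0 < τ → 0 ≤ ϱ τ) (q : ℝ) : newton ϱ q ≤ 1 := by
  have : 0 ≤ ∫ τ in Set.Ioi (0 : ℝ), ϱ τ * (√τ / max √τ √q) :=
    setIntegral_nonneg measurableSet_Ioi fun τ hτ =>
      mul_nonneg (h0 τ hτ) (newtonWeight_nonneg τ q)
  unfold newton
  linarith

theorem le_newton {ϱ : ℝ → ℝ} (h0 : ∀ τ, 0 < τ → 0 ≤ ϱ τ) (hω : IntegrableOn ϱ (Set.Ioi 0))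
    (q : ℝ) : 1 - 1 / 2 * ∫ τ in Set.Ioi (0 : ℝ), ϱ τ ≤ newton ϱ q := by
  have : ∫ τ in Set.Ioi (0 : ℝ), ϱ τ * (√τ / max √τ √q) ≤ ∫ τ in Set.Ioi (0 : ℝ), ϱ τ :=
    setIntegral_mono_on (integrableOn_mul_newtonWeight hω q) hω measurableSet_Ioi fun τ hτ =>
      mul_le_of_le_one_right (h0 τ hτ) (newtonWeight_le_one τ q)
  unfold newton
  linarith

namespace SmoothSource

variable {ϱ : ℝ → ℝ} {ε C : ℝ} (h : SmoothSource ϱ ε C)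
include h

theorem integrable : Integrable ϱ := h.smooth.continuous.integrable_of_hasCompactSupport h.compact

/-- The source vanishes for `τ ≤ ε`, so the singularity of the square root at `0` is never seen. The
same device gives smoothness of `newton` and of its derivative below. -/
theorem contDiff_sqrt_mul : ContDiff ℝ ∞ (fun τ => √τ * ϱ τ) := by
  have hε := h.pos
  rw [contDiff_iff_contDiffAt]
  intro τ
  rcases lt_or_ge τ ε with hτ | hτ
  · refine (contDiffAt_const (c := (0 : ℝ))).congr_of_eventuallyEq ?_
    filter_upwards [Iio_mem_nhds hτ] with t ht
    rw [h.zero t (le_of_lt ht), mul_zero]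
  · exact (Real.contDiffAt_sqrt (by linarith : τ ≠ 0)).mul h.smooth.contDiffAt

theorem hasDerivAt_charge (q : ℝ) : HasDerivAt (charge ϱ) (√q * ϱ q) q := by
  have hc : Continuous (fun τ => √τ * ϱ τ) := h.contDiff_sqrt_mul.continuous
  exact intervalIntegral.integral_hasDerivAt_right (hc.intervalIntegrable _ _)
    (hc.stronglyMeasurableAtFilter _ _) hc.continuousAt

theorem contDiff_charge : ContDiff ℝ ∞ (charge ϱ) := by
  rw [contDiff_infty_iff_deriv]
  refine ⟨fun q => (h.hasDerivAt_charge q).differentiableAt, ?_⟩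
  have : deriv (charge ϱ) = fun q => √q * ϱ q := funext fun q => (h.hasDerivAt_charge q).deriv
  rw [this]
  exact h.contDiff_sqrt_mul

theorem charge_eq_zero {q : ℝ} (hq : q ≤ ε) : charge ϱ q = 0 := by
  have hε := h.pos
  refine (intervalIntegral.integral_congr (g := fun _ => (0 : ℝ)) fun τ hτ => ?_).trans (by simp)
  have : τ ≤ ε := by
    rw [Set.mem_uIcc] at hτ
    rcases hτ with hτ | hτ <;> linarith [hτ.1, hτ.2]
  simp [h.zero τ this]

theorem charge_nonneg {q : ℝ} (hq : 0 ≤ q) : 0 ≤ charge ϱ q :=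
  intervalIntegral.integral_nonneg hq fun τ _ => mul_nonneg (Real.sqrt_nonneg _) (h.nonneg τ)

/-- The integrand is at most `C / √τ`, whose primitive is `2 C √τ`; derivatives are compared because
this bound is singular at `0`. -/
theorem charge_le {q : ℝ} (hq : 0 ≤ q) : charge ϱ q ≤ 2 * C * √q := by
  have hmono : MonotoneOn (fun q => 2 * C * √q - charge ϱ q) (Set.Ici 0) := by
    refine monotoneOn_of_hasDerivWithinAt_nonneg (convex_Ici 0)
      (f' := fun q => 2 * C * (1 / (2 * √q)) - √q * ϱ q) ?_ ?_ ?_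
    · exact ((continuous_const.mul Real.continuous_sqrt).sub
        h.contDiff_charge.continuous).continuousOn
    · intro q hq
      rw [interior_Ici] at hq
      exact (((Real.hasDerivAt_sqrt (ne_of_gt hq)).const_mul (2 * C)).sub
        (h.hasDerivAt_charge q)).hasDerivWithinAt
    · intro q hq
      rw [interior_Ici] at hq
      have hs : 0 < √q := Real.sqrt_pos.2 hq
      have h1 := h.mul_le q
      have h2 : √q * √q = q := Real.mul_self_sqrt (le_of_lt hq)
      have h3 : 2 * C * (1 / (2 * √q)) - √q * ϱ q = (C - ϱ q * q) / √q := by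
        rw [← h2]
        field_simp
        rw [Real.sqrt_sq hs.le]
      simp only [h3]
      exact div_nonneg (by linarith) hs.le
  have := hmono (Set.mem_Ici.2 le_rfl) (Set.mem_Ici.2 hq) hq
  simp [charge] at this
  simp only [charge]
  linarith

theorem newton_eq_of_le {q : ℝ} (hq : q ≤ ε) :
    newton ϱ q = 1 - 1 / 2 * ∫ τ in Set.Ioi (0 : ℝ), ϱ τ := by
  unfold newton
  congr 2
  refine setIntegral_congr_fun measurableSet_Ioi fun τ hτ => ?_
  rcases le_or_gt τ ε with h1 | h1
  · rw [h.zero τ h1, zero_mul]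
  · have h2 : √q ≤ √τ := Real.sqrt_le_sqrt (by linarith)
    rw [max_eq_left h2, div_self (Real.sqrt_pos.2 hτ).ne', mul_one]

/-- Splitting at `τ = q`: charge inside acts as if it were at the origin, charge outside contributes
a constant potential from each shell. -/
theorem newton_eq_of_pos {q : ℝ} (hq : 0 < q) :
    newton ϱ q = 1 - 1 / 2 * (charge ϱ q / √q + ((∫ τ in Set.Ioi (0 : ℝ), ϱ τ) -
      ∫ τ in (0 : ℝ)..q, ϱ τ)) := by
  have hω := h.integrable
  have hw := integrableOn_mul_newtonWeight hω.integrableOn q (ϱ := ϱ)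
  have hsplit : Set.Ioi (0 : ℝ) = Set.Ioc 0 q ∪ Set.Ioi q := (Set.Ioc_union_Ioi_eq_Ioi hq.le).symm
  have hdis : Disjoint (Set.Ioc (0 : ℝ) q) (Set.Ioi q) := Set.Ioc_disjoint_Ioi le_rfl
  unfold newton
  congr 2
  have e1 : ∫ τ in Set.Ioi (0 : ℝ), ϱ τ = (∫ τ in (0 : ℝ)..q, ϱ τ) + ∫ τ in Set.Ioi q, ϱ τ := by
    rw [hsplit, setIntegral_union hdis measurableSet_Ioi hω.integrableOn hω.integrableOn,
      intervalIntegral.integral_of_le hq.le]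
  rw [e1, hsplit, setIntegral_union hdis measurableSet_Ioi (hw.mono_set (by rw [hsplit]; simp))
    (hw.mono_set (by rw [hsplit]; simp))]
  have e2 : ∫ τ in Set.Ioc 0 q, ϱ τ * (√τ / max √τ √q) = charge ϱ q / √q := by
    rw [charge, intervalIntegral.integral_of_le hq.le, ← integral_div]
    refine setIntegral_congr_fun measurableSet_Ioc fun τ hτ => ?_
    rw [max_eq_right (Real.sqrt_le_sqrt hτ.2)]
    ring
  have e3 : ∫ τ in Set.Ioi q, ϱ τ * (√τ / max √τ √q) = ∫ τ in Set.Ioi q, ϱ τ := by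
    refine setIntegral_congr_fun measurableSet_Ioi fun τ hτ => ?_
    have hτ' : q < τ := hτ
    rw [max_eq_left (Real.sqrt_le_sqrt hτ'.le), div_self (Real.sqrt_pos.2 (hq.trans hτ')).ne',
      mul_one]
  rw [e2, e3]
  ring

/-- The contributions of the shell at `q` cancel when the splitting point moves, so the field
depends only on the enclosed charge. -/
theorem hasDerivAt_newton (q : ℝ) :
    HasDerivAt (newton ϱ) (charge ϱ q / (4 * (q * √q))) q := by
  have hε := h.pos
  rcases lt_or_ge q ε with hq | hq
  · rw [h.charge_eq_zero hq.le, zero_div]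
    refine (hasDerivAt_const q (1 - 1 / 2 * ∫ τ in Set.Ioi (0 : ℝ), ϱ τ)).congr_of_eventuallyEq ?_
    filter_upwards [Iio_mem_nhds hq] with t ht using h.newton_eq_of_le (le_of_lt ht)
  · have hq0 : 0 < q := by linarith
    have hc := h.smooth.continuous
    have hs : 0 < √q := Real.sqrt_pos.2 hq0
    have h1 : HasDerivAt (fun q => ∫ τ in (0 : ℝ)..q, ϱ τ) (ϱ q) q :=
      intervalIntegral.integral_hasDerivAt_right (hc.intervalIntegrable _ _)
        (hc.stronglyMeasurableAtFilter _ _) hc.continuousAt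
    have h2 := (h.hasDerivAt_charge q).div (Real.hasDerivAt_sqrt hq0.ne') hs.ne'
    have h3 := (((h2.add (h1.const_sub (∫ τ in Set.Ioi (0 : ℝ), ϱ τ))).const_mul
      (1 / 2)).const_sub 1)
    refine (h3.congr_of_eventuallyEq ?_).congr_deriv ?_
    · filter_upwards [Ioi_mem_nhds hq0] with t ht using h.newton_eq_of_pos ht
    · have h4 : q = √q * √q := (Real.mul_self_sqrt hq0.le).symm
      set s := √q
      rw [h4]
      field_simp
      ring

theorem deriv_newton : deriv (newton ϱ) = fun q => charge ϱ q / (4 * (q * √q)) :=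
  funext fun q => (h.hasDerivAt_newton q).deriv

theorem contDiff_deriv_newton : ContDiff ℝ ∞ (deriv (newton ϱ)) := by
  have hε := h.pos
  rw [h.deriv_newton, contDiff_iff_contDiffAt]
  intro q
  rcases lt_or_ge q ε with hq | hq
  · refine (contDiffAt_const (c := (0 : ℝ))).congr_of_eventuallyEq ?_
    filter_upwards [Iio_mem_nhds hq] with t ht
    rw [h.charge_eq_zero (le_of_lt ht), zero_div]
  · have hq0 : 0 < q := by linarith
    refine h.contDiff_charge.contDiffAt.div (contDiffAt_const.mul
      (contDiffAt_id.mul (Real.contDiffAt_sqrt hq0.ne'))) ?_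
    have : 0 < √q := Real.sqrt_pos.2 hq0
    positivity

theorem contDiff_newton : ContDiff ℝ ∞ (newton ϱ) := by
  rw [contDiff_infty_iff_deriv]
  exact ⟨fun q => (h.hasDerivAt_newton q).differentiableAt, h.contDiff_deriv_newton⟩

theorem deriv_newton_eq_zero {q : ℝ} (hq : q ≤ ε) : deriv (newton ϱ) q = 0 := by
  rw [h.deriv_newton]
  simp [h.charge_eq_zero hq]

theorem deriv_deriv_newton_eq_zero {q : ℝ} (hq : q < ε) : deriv (deriv (newton ϱ)) q = 0 := by
  have : deriv (newton ϱ) =ᶠ[𝓝 q] fun _ => 0 := by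
    filter_upwards [Iio_mem_nhds hq] with t ht using h.deriv_newton_eq_zero (le_of_lt ht)
  rw [this.deriv_eq, deriv_const]

/-- The radial form of `Δ = ϱ`. -/
theorem radial_laplacian_newton (q : ℝ) :
    4 * q * deriv (deriv (newton ϱ)) q + 6 * deriv (newton ϱ) q = ϱ q := by
  have hε := h.pos
  rcases lt_or_ge q ε with hq' | hq'
  · rw [h.deriv_deriv_newton_eq_zero hq', h.deriv_newton_eq_zero hq'.le, h.zero q hq'.le]
    ring
  · have hq0 : 0 < q := by linarith
    have hs : 0 < √q := Real.sqrt_pos.2 hq0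
    have h1 := (h.hasDerivAt_charge q).div (((hasDerivAt_id q).mul
        (Real.hasDerivAt_sqrt hq0.ne')).const_mul 4) (by simp only [Pi.mul_apply, id]; positivity)
    rw [h.deriv_newton, HasDerivAt.deriv (f := fun q => charge ϱ q / (4 * (q * √q))) h1]
    have h4 : q = √q * √q := (Real.mul_self_sqrt hq0.le).symm
    simp only [Pi.mul_apply, id]
    set s := √q
    set w := ϱ q
    set c := charge ϱ q
    rw [h4]
    field_simp
    ring

theorem deriv_newton_nonneg {q : ℝ} (hq : 0 ≤ q) : 0 ≤ deriv (newton ϱ) q := by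
  have := h.charge_nonneg hq
  rw [h.deriv_newton]
  positivity

theorem deriv_newton_mul_le {q : ℝ} (hq : 0 ≤ q) : deriv (newton ϱ) q * q ≤ C / 2 := by
  have hC : 0 ≤ C := by simpa using h.mul_le 0
  rcases hq.eq_or_lt with rfl | hq0
  · simpa using by positivity
  · have hs : 0 < √q := Real.sqrt_pos.2 hq0
    have h1 := h.charge_le hq
    simp only [h.deriv_newton]
    rw [div_mul_eq_mul_div, div_le_iff₀ (by positivity)]
    nlinarith

/-- Solve the radial equation for the second derivative: `4q²K'' = ϱ q - 6 q K'` lies between `-3C`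
and `C`, since `0 ≤ q K' ≤ C/2`. -/
theorem abs_deriv_deriv_newton_mul_le {q : ℝ} (hq : 0 ≤ q) :
    |deriv (deriv (newton ϱ)) q| * (q * q) ≤ 3 / 4 * C := by
  have h1 := h.radial_laplacian_newton q
  have h2 := h.deriv_newton_nonneg hq
  have h3 := h.deriv_newton_mul_le hq
  have h4 := h.mul_le q
  have h5 := h.nonneg q
  have hC : 0 ≤ C := by simpa using h.mul_le 0
  rw [← abs_of_nonneg (mul_nonneg hq hq), ← abs_mul, abs_le]
  constructor <;> nlinarith [mul_nonneg h5 hq, mul_nonneg h2 hq]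

/-- Both derivatives vanish where `M q < ε`, and elsewhere `q + ε/M ≤ 2q`. This turns bounds in
`q⁻¹` and `q⁻²` into bounds in `(q + δ)⁻¹` and its square, at the cost of factors `2` and `4`. The
second derivative is the critical one: `4 · ¾ C = 3C ≤ 1/1000`. The total charge `≤ 1/5` gives the
lower bound `1 - 1/10`. -/
theorem smallProfile {M : ℝ} (hM : 0 < M) (hC : C ≤ 1 / 3000)
    (hI : ∫ τ in Set.Ioi (0 : ℝ), ϱ τ ≤ 1 / 5) :
    SmallProfile (fun q => newton ϱ (M * q)) (ε / M) := by
  have hε := h.pos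
  have hd : deriv (fun q => newton ϱ (M * q)) = fun q => M * deriv (newton ϱ) (M * q) := by
    funext q
    rw [deriv_comp_mul_left]
    simp
  have hdd : deriv (deriv (fun q => newton ϱ (M * q))) =
      fun q => M * (M * deriv (deriv (newton ϱ)) (M * q)) := by
    rw [hd]
    funext q
    rw [deriv_const_mul_field, deriv_comp_mul_left]
    simp
  have hC0 : 0 ≤ C := by simpa using h.mul_le 0
  refine ⟨h.contDiff_newton.comp (contDiff_const.mul contDiff_id), by positivity, fun q => ?_,
    fun q => newton_le_one (fun τ _ => h.nonneg τ) _, fun q hq => ?_, fun q hq => ?_,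
    fun q hq => ?_⟩
  · have := le_newton (fun τ _ => h.nonneg τ) h.integrable.integrableOn (M * q)
    linarith
  · simp only [hd]
    have hMq : 0 ≤ M * q := by positivity
    rw [abs_of_nonneg (mul_nonneg hM.le (h.deriv_newton_nonneg hMq)), ← div_eq_mul_inv]
    rcases le_or_gt (M * q) ε with h1 | h1
    · rw [h.deriv_newton_eq_zero h1]
      have : 0 ≤ q + ε / M := by positivity
      simpa using by positivity
    · have hq0 : 0 < q := by
        by_contra hcon
        have : q = 0 := le_antisymm (not_lt.1 hcon) hq
        rw [this, mul_zero] at h1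
        linarith
      have h2 : ε / M ≤ q := by
        rw [div_le_iff₀ hM]
        linarith
      have h3 := h.deriv_newton_mul_le hMq
      have h4 := mul_nonneg hM.le (h.deriv_newton_nonneg hMq)
      rw [le_div_iff₀ (by positivity)]
      nlinarith
  · simp only [hdd]
    have hMq : 0 ≤ M * q := by positivity
    rcases lt_or_ge (M * q) ε with h1 | h1
    · rw [h.deriv_deriv_newton_eq_zero h1]
      have : 0 ≤ q + ε / M := by positivity
      simpa using by positivity
    · have h2 : ε / M ≤ q := by
        rw [div_le_iff₀ hM]
        linarith
      have hq0 : 0 < q := lt_of_lt_of_le (by positivity) h2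
      have h3 := h.abs_deriv_deriv_newton_mul_le hMq
      rw [abs_mul, abs_mul, abs_of_pos hM, ← mul_inv, ← div_eq_mul_inv, le_div_iff₀ (by positivity)]
      set D := |deriv (deriv (newton ϱ)) (M * q)|
      have h5 : (q + ε / M) * (q + ε / M) ≤ (2 * q) * (2 * q) := by
        have : 0 ≤ ε / M := by positivity
        gcongr <;> linarith
      calc M * (M * D) * ((q + ε / M) * (q + ε / M)) ≤ M * (M * D) * ((2 * q) * (2 * q)) := by
            gcongr
        _ = 4 * (D * (M * q * (M * q))) := by ring
        _ ≤ 4 * (3 / 4 * C) := by gcongr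
        _ ≤ _ := by linarith
  · rw [hdd, hd]
    have h1 := h.radial_laplacian_newton (M * q)
    have h2 := h.nonneg (M * q)
    have : 4 * q * (M * (M * deriv (deriv (newton ϱ)) (M * q))) + 6 * (M * deriv (newton ϱ) (M * q))
        = M * ϱ (M * q) := by
      rw [← h1]
      ring
    simp only [this]
    positivity

theorem profilePotential_newton (M q : ℝ) :
    profilePotential (fun q => newton ϱ (M * q)) q = M * (2 * ϱ (M * q) / newton ϱ (M * q)) := by
  have hd : deriv (fun q => newton ϱ (M * q)) = fun q => M * deriv (newton ϱ) (M * q) := by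
    funext q
    rw [deriv_comp_mul_left]
    simp
  have hdd : deriv (deriv (fun q => newton ϱ (M * q))) q =
      M * (M * deriv (deriv (newton ϱ)) (M * q)) := by
    rw [hd, deriv_const_mul_field, deriv_comp_mul_left]
    simp
  rw [profilePotential, hdd, hd, ← h.radial_laplacian_newton (M * q)]
  ring

end SmoothSource

end NewtonPotential

/-! ### The Laplacian in Cartesian coordinates. -/

section LaplacianCoordinates

variable {ι : Type*} [Fintype ι] [DecidableEq ι] {F : Type*} [NormedAddCommGroup F]
  [NormedSpace ℝ F]

theorem laplacian_eq_sum_fderiv {u : EuclideanSpace ℝ ι → F} (hu : ContDiff ℝ 2 u)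
    (x : EuclideanSpace ℝ ι) :
    Δ u x = ∑ a, fderiv ℝ (fun y => fderiv ℝ u y (EuclideanSpace.single a 1)) x
      (EuclideanSpace.single a 1) := by
  rw [InnerProductSpace.laplacian_eq_iteratedFDeriv_orthonormalBasis u
    (EuclideanSpace.basisFun ι ℝ)]
  refine Finset.sum_congr rfl fun a _ => ?_
  rw [iteratedFDeriv_two_apply]
  have hd : DifferentiableAt ℝ (fderiv ℝ u) x :=
    ((hu.fderiv_right (m := 1) (by norm_num)).differentiable (by simp)) x
  rw [fderiv_clm_apply hd (differentiableAt_const _)]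
  simp

end LaplacianCoordinates

/-! ### The maximum principle in the sense of distributions. -/

section MaximumPrinciple

/-- If `c > 0`, the second-derivative test makes `0` a local minimum as well; then `h` is locally
constant and `c = 0`. -/
theorem deriv_nonpos_of_isLocalMax {h h' : ℝ → ℝ} {c : ℝ} (hh : ∀ t, HasDerivAt h (h' t) t)
    (hc : HasDerivAt h' c 0) (hm : IsLocalMax h 0) : c ≤ 0 := by
  by_contra hpos
  rw [not_le] at hpos
  have hd : deriv h = h' := funext fun t => (hh t).deriv
  have hdd : deriv (deriv h) 0 = c := by rw [hd, hc.deriv]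
  have hmin : IsLocalMin h 0 := isLocalMin_of_deriv_deriv_pos (by rw [hdd]; exact hpos)
    hm.deriv_eq_zero (hh 0).continuousAt
  have hconst : h =ᶠ[𝓝 0] fun _ => h 0 := by
    filter_upwards [hm, hmin] with t h1 h2 using le_antisymm h1 h2
  have h1 : deriv h =ᶠ[𝓝 0] fun _ => 0 := by
    have := hconst.deriv
    simpa using! this
  have h2 := h1.deriv_eq
  rw [hdd, deriv_const] at h2
  exact hpos.ne' h2

theorem fderiv_comp_const_sub {E F : Type*} [NormedAddCommGroup E] [NormedSpace ℝ E]
    [NormedAddCommGroup F] [NormedSpace ℝ F] {u : E → F} (hu : Differentiable ℝ u) (c y v : E) :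
    fderiv ℝ (fun y => u (c - y)) y v = -fderiv ℝ u (c - y) v := by
  have h1 : HasFDerivAt (fun y => c - y) (-ContinuousLinearMap.id ℝ E) y :=
    (hasFDerivAt_id y).const_sub c
  have h2 := (hu (c - y)).hasFDerivAt.comp y h1
  have h3 : fderiv ℝ (fun y => u (c - y)) y = _ := h2.fderiv
  rw [h3]
  simp

theorem laplacian_comp_const_sub {χ : Space3 → ℝ} (hχ : ContDiff ℝ ∞ χ) (c y : Space3) :
    Δ (fun y => χ (c - y)) y = Δ χ (c - y) := by
  have h2 : (2 : WithTop ℕ∞) ≤ ((⊤ : ℕ∞) : WithTop ℕ∞) := WithTop.coe_le_coe.2 le_top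
  have hs : ContDiff ℝ ∞ (fun y => χ (c - y)) := hχ.comp (contDiff_const.sub contDiff_id)
  have hd : ∀ v, ContDiff ℝ ∞ (fun y => fderiv ℝ χ y v) := fun v =>
    (hχ.fderiv_right (m := ∞) (by norm_cast)).clm_apply contDiff_const
  rw [laplacian_eq_sum_fderiv (hs.of_le h2), laplacian_eq_sum_fderiv (hχ.of_le h2)]
  refine Finset.sum_congr rfl fun a _ => ?_
  simp only [fderiv_comp_const_sub (hχ.differentiable (by simp))]
  rw [fderiv_fun_neg, _root_.neg_apply,
    fderiv_comp_const_sub ((hd _).differentiable (by simp)), neg_neg]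

open Convolution in
theorem hasFDerivAt_convolution_apply {g χ : Space3 → ℝ} (hg : Continuous g)
    (hχ : ContDiff ℝ ∞ χ) (hc : HasCompactSupport χ) (x v : Space3) :
    HasDerivAt (fun t : ℝ => ∫ y, g y * χ (x + t • v - y)) (∫ y, g y * fderiv ℝ χ (x - y) v) 0 := by
  have hχ1 : ContDiff ℝ 1 χ := hχ.of_le (WithTop.coe_le_coe.2 le_top)
  have h1 := hc.hasFDerivAt_convolution_right (ContinuousLinearMap.mul ℝ ℝ)
    (hg.locallyIntegrable (μ := volume)) hχ1 (x + (0 : ℝ) • v)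
  have h2 : HasDerivAt (fun t : ℝ => x + t • v) v 0 := by
    simpa using ((hasDerivAt_id (0 : ℝ)).smul_const v).const_add x
  have h3 := h1.comp_hasDerivAt 0 h2
  refine h3.congr_deriv ?_
  rw [convolution_precompR_apply _ hg.locallyIntegrable (hc.fderiv ℝ)
    (hχ1.continuous_fderiv (by simp))]
  simp [convolution]

/-- The maximum principle for continuous distributional subsolutions on `ℝ³`. -/
theorem nonpos_of_subharmonic_where_pos {g w : Space3 → ℝ} (hg : Continuous g)
    (hw : ∀ η : Space3 → ℝ, ContDiff ℝ ∞ η → HasCompactSupport η →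
      ∫ x, g x * Δ η x = ∫ x, w x * η x)
    (hpos : ∀ x, 0 < g x → 0 ≤ w x) {c : ℝ} (hc : c ≤ 0) (hlim : Tendsto g (cocompact Space3) (𝓝 c))
    (x₀ : Space3) : g x₀ ≤ 0 := by
  by_contra hx₀
  rw [not_le] at hx₀
  set m := g x₀ with hm
  obtain ⟨R, hR⟩ : ∃ R : ℝ, ∀ x, R ≤ ‖x‖ → g x < m / 8 := by
    have h1 : ∀ᶠ x in cocompact Space3, g x < m / 8 := hlim.eventually_lt_const (by linarith)
    rw [← Metric.cobounded_eq_cocompact, ← comap_norm_atTop, eventually_comap] at h1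
    obtain ⟨R, hR⟩ := eventually_atTop.1 h1
    exact ⟨R, fun x hx => hR ‖x‖ hx x rfl⟩
  set S := max R 0 + ‖x₀‖ + 1 with hS
  have hS0 : 0 < S := by positivity
  have hRS : R ≤ S := by
    have := le_max_left R 0
    have := norm_nonneg x₀
    linarith
  have hx₀S : ‖x₀‖ < S := by
    have := le_max_right R 0
    linarith
  obtain ⟨ε, hε, hε1, hunif⟩ : ∃ ε > 0, ε ≤ 1 ∧ ∀ x, ‖x‖ ≤ S → ∀ y, dist y x < ε →
      dist (g y) (g x) ≤ m / 8 := by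
    have hK : IsCompact (Metric.closedBall (0 : Space3) (S + 1)) := isCompact_closedBall _ _
    have hu := hK.uniformContinuousOn_of_continuous hg.continuousOn
    obtain ⟨ε, hε, h⟩ := Metric.uniformContinuousOn_iff.1 hu (m / 8) (by linarith)
    refine ⟨min ε 1, by positivity, min_le_right _ _, fun x hx y hy => ?_⟩
    refine (h y ?_ x ?_ (lt_of_lt_of_le hy (min_le_left _ _))).le
    · rw [mem_closedBall_zero_iff]
      have h1 := (lt_of_lt_of_le hy (min_le_right ε 1)).le
      rw [dist_eq_norm] at h1
      have h2 := norm_le_norm_add_norm_sub' y x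
      linarith
    · rw [mem_closedBall_zero_iff]
      linarith
  -- Second derivatives are available only after mollification; the radius `ε` is chosen so that `G`
  -- stays within `m / 8` of `g` on the ball of radius `S`.
  set φ : ContDiffBump (0 : Space3) := ⟨ε / 2, ε, by positivity, by linarith⟩ with hφ
  set χ : Space3 → ℝ := φ.normed volume with hχ
  have hχs : ContDiff ℝ ∞ χ := φ.contDiff_normed
  have hχc : HasCompactSupport χ := φ.hasCompactSupport_normed
  set G : Space3 → ℝ := fun x => ∫ y, g y * χ (x - y) with hG
  have hGg : ∀ x, ‖x‖ ≤ S → |G x - g x| ≤ m / 8 := by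
    intro x hx
    have h1 := φ.dist_normed_convolution_le (μ := volume) (g := g) (x₀ := x) (ε := m / 8)
      hg.aestronglyMeasurable fun y hy => hunif x hx y hy
    rw [convolution_eq_swap, Real.dist_eq] at h1
    have h2 : G x = ∫ t, ContinuousLinearMap.lsmul ℝ ℝ (χ (x - t)) (g t) := by
      simp only [hG, ContinuousLinearMap.lsmul_apply, smul_eq_mul, mul_comm]
    rw [h2]
    exact h1
  have hGc : Continuous G := by
    have := hχc.contDiff_convolution_right (n := 0) (ContinuousLinearMap.mul ℝ ℝ)
      (hg.locallyIntegrable (μ := volume)) (hχs.of_le (by simp))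
    exact this.continuous
  -- A small quadratic term makes the subsolution strict; this coefficient keeps it below `m / 8` on
  -- the ball.
  set d := m / (8 * S ^ 2) with hd
  have hd0 : 0 < d := by positivity
  have hdS : d * S ^ 2 = m / 8 := by
    rw [hd]
    field_simp
  set H : Space3 → ℝ := fun x => G x + d * ‖x‖ ^ 2 with hH
  obtain ⟨z, hz, hzmax⟩ := (isCompact_closedBall (0 : Space3) S).exists_isMaxOn
    ⟨x₀, by rw [mem_closedBall_zero_iff]; exact hx₀S.le⟩
    (f := H) (hGc.add (continuous_const.mul (continuous_norm.pow 2))).continuousOn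
  rw [mem_closedBall_zero_iff] at hz
  have hHx₀ : 7 * m / 8 ≤ H z := by
    have h1 := hzmax (by rw [mem_closedBall_zero_iff]; exact hx₀S.le : x₀ ∈ Metric.closedBall 0 S)
    have h2 := abs_le.1 (hGg x₀ hx₀S.le)
    have h3 : 0 ≤ d * ‖x₀‖ ^ 2 := by positivity
    have h4 : H x₀ ≤ H z := h1
    have h5 : H x₀ = G x₀ + d * ‖x₀‖ ^ 2 := rfl
    linarith [h2.1]
  have hzS : d * ‖z‖ ^ 2 ≤ m / 8 := by
    rw [← hdS]
    gcongr
  have hHz : H z = G z + d * ‖z‖ ^ 2 := rfl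
  have hgz := abs_le.1 (hGg z hz)
  -- On the sphere `g < m/8`, so `H < 3m/8`, which is below the value `7m/8` reached inside.
  have hzlt : ‖z‖ < S := by
    rcases hz.lt_or_eq with h | h
    · exact h
    · have := hR z (by rw [h]; exact hRS)
      linarith [hgz.2]
  -- This integral is the Laplacian of `G` at `z`. Since `g z ≥ 5m/8`, `g` is positive on the
  -- support of `χ(z - ·)`, where therefore `w ≥ 0`.
  have hLap : 0 ≤ ∫ y, g y * Δ χ (z - y) := by
    have h1 := hw (fun y => χ (z - y)) (hχs.comp (contDiff_const.sub contDiff_id))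
      (hχc.comp_homeomorph (Homeomorph.subLeft z))
    simp only [laplacian_comp_const_sub hχs] at h1
    rw [h1]
    refine integral_nonneg fun y => ?_
    simp only [Pi.zero_apply]
    by_cases hy : χ (z - y) = 0
    · rw [hy, mul_zero]
    · have h2 : z - y ∈ Function.support χ := hy
      rw [hχ, φ.support_normed_eq, mem_ball_zero_iff] at h2
      have h3 := hunif z hz y (by rw [dist_comm, dist_eq_norm]; exact h2)
      rw [Real.dist_eq] at h3
      have h4 := abs_le.1 h3
      exact mul_nonneg (hpos y (by linarith [h4.1, hgz.2])) (φ.nonneg_normed _)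
  -- Second-derivative test for `H` at the interior maximum `z` along each axis. The three
  -- inequalities add up to `∫ g Δχ(z - ·) + 6d ≤ 0`, against `hLap`.
  have hsecond : ∀ a : Fin 3, (∫ y, g y * fderiv ℝ (fun y => fderiv ℝ χ y
      (EuclideanSpace.single a 1)) (z - y) (EuclideanSpace.single a 1)) + 2 * d ≤ 0 := by
    intro a
    set e : Space3 := EuclideanSpace.single a 1 with he
    have hen : ‖e‖ = 1 := by simp [he]
    have hχe : ContDiff ℝ ∞ (fun y => fderiv ℝ χ y e) :=
      (hχs.fderiv_right (m := ∞) (by norm_cast)).clm_apply contDiff_const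
    have hnorm : ∀ t : ℝ, ‖z + t • e‖ ^ 2 = ‖z‖ ^ 2 + 2 * t * inner ℝ z e + t ^ 2 := by
      intro t
      rw [norm_add_sq_real, inner_smul_right, norm_smul, hen]
      simp only [Real.norm_eq_abs, mul_one, sq_abs]
      ring
    refine deriv_nonpos_of_isLocalMax (h := fun t : ℝ => H (z + t • e))
      (h' := fun t : ℝ => (∫ y, g y * fderiv ℝ χ (z + t • e - y) e) +
        (2 * d * inner ℝ z e + 2 * d * t)) ?_ ?_ ?_
    · intro t
      have h1 := hasFDerivAt_convolution_apply hg hχs hχc (z + t • e) e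
      have h2 : HasDerivAt (fun s : ℝ => s - t) 1 t := (hasDerivAt_id t).sub_const t
      have h3 := HasDerivAt.comp_of_eq t h1 h2 (by simp)
      have h4 : HasDerivAt (fun s : ℝ => d * (‖z‖ ^ 2 + 2 * s * inner ℝ z e + s ^ 2))
          (d * (2 * inner ℝ z e + 2 * t)) t := by
        have h5 := (((hasDerivAt_id t).const_mul 2).mul_const (inner ℝ z e)).const_add (‖z‖ ^ 2)
        have h6 := (h5.add (hasDerivAt_pow 2 t)).const_mul d
        refine h6.congr_deriv ?_
        simp
      have h7 := h3.add h4
      refine (h7.congr_of_eventuallyEq (Eventually.of_forall fun s => ?_)).congr_deriv ?_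
      · simp only [hH, hnorm, hG, Function.comp, Pi.add_apply]
        congr 2
        funext y
        congr 2
        rw [sub_smul]
        abel
      · ring
    · have h1 := hasFDerivAt_convolution_apply hg hχe (hχc.fderiv_apply ℝ e) z e
      have h2 : HasDerivAt (fun t : ℝ => 2 * d * inner ℝ z e + 2 * d * t) (2 * d) 0 := by
        simpa using ((hasDerivAt_id (0 : ℝ)).const_mul (2 * d)).const_add (2 * d * inner ℝ z e)
      exact h1.add h2
    · have hcont : ContinuousAt (fun t : ℝ => z + t • e) 0 := by fun_prop
      have h1 : ∀ᶠ t : ℝ in 𝓝 0, z + t • e ∈ Metric.ball (0 : Space3) S := by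
        refine hcont.eventually_mem (Metric.isOpen_ball.mem_nhds ?_)
        simpa using hzlt
      filter_upwards [h1] with t ht
      have h2 : H (z + t • e) ≤ H z := hzmax (Metric.ball_subset_closedBall ht)
      simpa using h2
  have hi : ∀ a : Fin 3, Integrable (fun y => g y * fderiv ℝ (fun y => fderiv ℝ χ y
      (EuclideanSpace.single a 1)) (z - y) (EuclideanSpace.single a 1)) := by
    intro a
    have hχe : ContDiff ℝ ∞ (fun y => fderiv ℝ χ y (EuclideanSpace.single a (1 : ℝ))) :=
      (hχs.fderiv_right (m := ∞) (by norm_cast)).clm_apply contDiff_const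
    have hχee : ContDiff ℝ ∞ (fun y => fderiv ℝ (fun y => fderiv ℝ χ y
        (EuclideanSpace.single a (1 : ℝ))) y (EuclideanSpace.single a 1)) :=
      (hχe.fderiv_right (m := ∞) (by norm_cast)).clm_apply contDiff_const
    refine Continuous.integrable_of_hasCompactSupport
      (hg.mul (hχee.continuous.comp (continuous_const.sub continuous_id))) ?_
    exact (((hχc.fderiv_apply ℝ _).fderiv_apply ℝ _).comp_homeomorph (Homeomorph.subLeft z)).mul_left
  have hsum : ∫ y, g y * Δ χ (z - y) = ∑ a : Fin 3, ∫ y, g y * fderiv ℝ (fun y => fderiv ℝ χ y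
      (EuclideanSpace.single a 1)) (z - y) (EuclideanSpace.single a 1) := by
    rw [← integral_finsetSum _ fun a _ => hi a]
    congr 1
    funext y
    rw [laplacian_eq_sum_fderiv (hχs.of_le (WithTop.coe_le_coe.2 le_top)), Finset.mul_sum]
  rw [hsum, Fin.sum_univ_three] at hLap
  linarith [hsecond 0, hsecond 1, hsecond 2]

end MaximumPrinciple

/-! ### Green's identity and rotation invariance of the Laplacian. -/

section Green

theorem two_le_smooth : (2 : WithTop ℕ∞) ≤ ((⊤ : ℕ∞) : WithTop ℕ∞) := WithTop.coe_le_coe.2 le_top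

theorem contDiff_fderiv_apply {u : Space3 → ℝ} (hu : ContDiff ℝ ∞ u) (v : Space3) :
    ContDiff ℝ ∞ (fun x => fderiv ℝ u x v) :=
  (hu.fderiv_right (m := ∞) (by norm_cast)).clm_apply contDiff_const

theorem integral_mul_fderiv_of_smooth {u η : Space3 → ℝ} (hu : ContDiff ℝ ∞ u)
    (hη : ContDiff ℝ ∞ η) (hc : HasCompactSupport η) (v : Space3) :
    ∫ x, u x * fderiv ℝ η x v = -∫ x, fderiv ℝ u x v * η x := by
  refine integral_mul_fderiv_eq_neg_fderiv_mul_of_integrable ?_ ?_ ?_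
    (fun x _ => hu.differentiable (by simp) x) (fun x _ => hη.differentiable (by simp) x)
  · exact ((contDiff_fderiv_apply hu v).continuous.mul hη.continuous).integrable_of_hasCompactSupport
      hc.mul_left
  · exact (hu.continuous.mul
      (contDiff_fderiv_apply hη v).continuous).integrable_of_hasCompactSupport
      (hc.fderiv_apply ℝ v).mul_left
  · exact (hu.continuous.mul hη.continuous).integrable_of_hasCompactSupport hc.mul_left

theorem continuous_laplacian {η : Space3 → ℝ} (hη : ContDiff ℝ ∞ η) : Continuous (Δ η) := by
  have : Δ η = fun x => ∑ a, fderiv ℝ (fun y => fderiv ℝ η y (EuclideanSpace.single a 1)) x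
      (EuclideanSpace.single a 1) :=
    funext fun x => laplacian_eq_sum_fderiv (hη.of_le two_le_smooth) x
  rw [this]
  exact continuous_finsetSum _ fun a _ =>
    (contDiff_fderiv_apply (contDiff_fderiv_apply hη _) _).continuous

theorem hasCompactSupport_laplacian {η : Space3 → ℝ} (hη : ContDiff ℝ ∞ η)
    (hc : HasCompactSupport η) : HasCompactSupport (Δ η) := by
  have : Δ η = fun x => ∑ a, fderiv ℝ (fun y => fderiv ℝ η y (EuclideanSpace.single a 1)) x
      (EuclideanSpace.single a 1) :=
    funext fun x => laplacian_eq_sum_fderiv (hη.of_le two_le_smooth) x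
  rw [this]
  simp only [Fin.sum_univ_three]
  have h : ∀ a : Fin 3, HasCompactSupport (fun x =>
      fderiv ℝ (fun y => fderiv ℝ η y (EuclideanSpace.single a 1)) x
        (EuclideanSpace.single a 1)) := fun a => (hc.fderiv_apply ℝ _).fderiv_apply ℝ _
  exact ((h 0).add (h 1)).add (h 2)

theorem integral_mul_laplacian {u η : Space3 → ℝ} (hu : ContDiff ℝ ∞ u)
    (hη : ContDiff ℝ ∞ η) (hc : HasCompactSupport η) :
    ∫ x, u x * Δ η x = ∫ x, Δ u x * η x := by
  simp only [laplacian_eq_sum_fderiv (hη.of_le two_le_smooth),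
    laplacian_eq_sum_fderiv (hu.of_le two_le_smooth), Finset.mul_sum, Finset.sum_mul]
  rw [integral_finsetSum, integral_finsetSum]
  · refine Finset.sum_congr rfl fun a _ => ?_
    rw [integral_mul_fderiv_of_smooth hu (contDiff_fderiv_apply hη _) (hc.fderiv_apply ℝ _),
      integral_mul_fderiv_of_smooth (contDiff_fderiv_apply hu _) hη hc, neg_neg]
  · intro a _
    exact ((contDiff_fderiv_apply (contDiff_fderiv_apply hu _) _).continuous.mul
      hη.continuous).integrable_of_hasCompactSupport hc.mul_left
  · intro a _
    exact (hu.continuous.mul (contDiff_fderiv_apply (contDiff_fderiv_apply hη _)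
      _).continuous).integrable_of_hasCompactSupport ((hc.fderiv_apply ℝ _).fderiv_apply ℝ _).mul_left

/-- The Laplacian may be computed in any orthonormal basis, in particular in the image under `R` of
the standard one. -/
theorem laplacian_comp_linearIsometryEquiv {η : Space3 → ℝ} (hη : ContDiff ℝ ∞ η)
    (R : Space3 ≃ₗᵢ[ℝ] Space3) (x : Space3) : Δ (fun y => η (R y)) x = Δ η (R x) := by
  set b := EuclideanSpace.basisFun (Fin 3) ℝ
  rw [InnerProductSpace.laplacian_eq_iteratedFDeriv_orthonormalBasis _ b,
    InnerProductSpace.laplacian_eq_iteratedFDeriv_orthonormalBasis _ (b.map R)]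
  refine Finset.sum_congr rfl fun a _ => ?_
  have h := ContinuousLinearMap.iteratedFDeriv_comp_right
    (R.toContinuousLinearEquiv : Space3 →L[ℝ] Space3) hη x (i := 2) (by exact two_le_smooth)
  have h' : iteratedFDeriv ℝ 2 (fun y => η (R y)) x = _ := h
  rw [h']
  simp only [ContinuousMultilinearMap.compContinuousLinearMap_apply, OrthonormalBasis.map_apply]
  congr 1
  funext k
  fin_cases k <;> rfl

theorem integral_laplacian {η : Space3 → ℝ} (hη : ContDiff ℝ ∞ η) (hc : HasCompactSupport η) :
    ∫ x, Δ η x = 0 := by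
  have := integral_mul_laplacian (u := fun _ => 1) contDiff_const hη hc
  simpa using this

end Green

/-! ### Bounds, uniqueness and radial symmetry of the scattering solution. -/

section Scattering

variable {V f : Space3 → ℝ}

theorem integrable_mul_laplacian {g η : Space3 → ℝ} (hg : Continuous g) (hη : ContDiff ℝ ∞ η)
    (hc : HasCompactSupport η) : Integrable (fun x => g x * Δ η x) :=
  (hg.mul (continuous_laplacian hη)).integrable_of_hasCompactSupport
    (hasCompactSupport_laplacian hη hc).mul_left

theorem integrable_bdd_mul_of_compact {V g η : Space3 → ℝ} (hV : Measurable V) {M : ℝ}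
    (hM : ∀ x, |V x| ≤ M) (hg : Continuous g) (hη : Continuous η) (hc : HasCompactSupport η) :
    Integrable (fun x => (1 / 2 * V x * g x) * η x) := by
  have h1 : Integrable (fun x => g x * η x) :=
    (hg.mul hη).integrable_of_hasCompactSupport hc.mul_left
  have h2 : Integrable (fun x => V x * (g x * η x)) := h1.bdd_mul hV.aestronglyMeasurable
    (ae_of_all _ fun x => by rw [Real.norm_eq_abs]; exact hM x)
  refine (h2.const_mul (1 / 2)).congr (ae_of_all _ fun x => ?_)
  simp only
  ring

theorem IsScatteringSolution.integral_mul_laplacian (hf : IsScatteringSolution V f)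
    (hV : Measurable V) {M : ℝ} (hM : ∀ x, |V x| ≤ M) {η : Space3 → ℝ} (hη : ContDiff ℝ ∞ η)
    (hc : HasCompactSupport η) :
    ∫ x, f x * Δ η x = ∫ x, (1 / 2 * V x * f x) * η x := by
  have h := hf.equation η hη hc
  have h1 := integrable_mul_laplacian hf.continuous hη hc
  have h2 := integrable_bdd_mul_of_compact hV hM hf.continuous hη.continuous hc
  have e : (fun x => f x * (-(Δ η x) + 1 / 2 * V x * η x)) =
      fun x => (1 / 2 * V x * f x) * η x - f x * Δ η x := by
    funext x
    ring
  rw [e, integral_sub h2 h1] at h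
  linarith

/-- Where `-f` is positive, its Laplacian `-V f / 2` is nonnegative, so the maximum principle
applies to `-f`, with limit `-1`. -/
theorem IsScatteringSolution.nonneg (hf : IsScatteringSolution V f) (hV : Measurable V)
    (hV0 : ∀ x, 0 ≤ V x) {M : ℝ} (hM : ∀ x, |V x| ≤ M) (x : Space3) : 0 ≤ f x := by
  have := nonpos_of_subharmonic_where_pos (g := fun x => -f x)
    (w := fun x => -(1 / 2 * V x * f x)) hf.continuous.neg (fun η hη hc => ?_) (fun x hx => ?_)
    (by norm_num : (-1 : ℝ) ≤ 0) hf.boundary.neg x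
  · linarith
  · simp only [neg_mul, integral_neg]
    rw [hf.integral_mul_laplacian hV hM hη hc]
  · have := hV0 x
    nlinarith

theorem IsScatteringSolution.le_one (hf : IsScatteringSolution V f) (hV : Measurable V)
    (hV0 : ∀ x, 0 ≤ V x) {M : ℝ} (hM : ∀ x, |V x| ≤ M) (x : Space3) : f x ≤ 1 := by
  have := nonpos_of_subharmonic_where_pos (g := fun x => f x - 1)
    (w := fun x => 1 / 2 * V x * f x) (hf.continuous.sub continuous_const) (fun η hη hc => ?_)
    (fun x hx => ?_) le_rfl (by simpa using hf.boundary.sub_const 1) x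
  · linarith
  · have h1 := integrable_mul_laplacian hf.continuous hη hc
    have h2 := integrable_mul_laplacian (g := fun _ => 1) continuous_const hη hc
    have e : (fun x => (f x - 1) * Δ η x) = fun x => f x * Δ η x - 1 * Δ η x := by
      funext x
      ring
    rw [e, integral_sub h1 h2, hf.integral_mul_laplacian hV hM hη hc]
    simp [integral_laplacian hη hc]
  · have h1 := hV0 x
    have h2 := hf.nonneg hV hV0 hM x
    positivity

/-- The difference solves the same equation and tends to `0`. Exchanging the two solutions gives
uniqueness. -/
theorem IsScatteringSolution.le_of_isScatteringSolution {f' : Space3 → ℝ}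
    (hf : IsScatteringSolution V f) (hf' : IsScatteringSolution V f') (hV : Measurable V)
    (hV0 : ∀ x, 0 ≤ V x) {M : ℝ} (hM : ∀ x, |V x| ≤ M) (x : Space3) : f x ≤ f' x := by
  have := nonpos_of_subharmonic_where_pos (g := fun x => f x - f' x)
    (w := fun x => 1 / 2 * V x * (f x - f' x)) (hf.continuous.sub hf'.continuous)
    (fun η hη hc => ?_) (fun x hx => ?_) le_rfl (by simpa using hf.boundary.sub hf'.boundary) x
  · linarith
  · have h1 := integrable_mul_laplacian hf.continuous hη hc
    have h2 := integrable_mul_laplacian hf'.continuous hη hc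
    have h3 := integrable_bdd_mul_of_compact hV hM hf.continuous hη.continuous hc
    have h4 := integrable_bdd_mul_of_compact hV hM hf'.continuous hη.continuous hc
    simp only [sub_mul, mul_sub]
    rw [integral_sub h1 h2, integral_sub h3 h4, hf.integral_mul_laplacian hV hM hη hc,
      hf'.integral_mul_laplacian hV hM hη hc]
  · have := hV0 x
    positivity

theorem IsScatteringSolution.comp_linearIsometryEquiv (hf : IsScatteringSolution V f)
    (hVr : IsRadial V) (R : Space3 ≃ₗᵢ[ℝ] Space3) :
    IsScatteringSolution V (fun x => f (R x)) := by
  refine ⟨hf.continuous.comp R.continuous, fun η hη hc => ?_, ?_⟩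
  · have h := hf.equation (fun y => η (R.symm y)) (hη.comp R.symm.contDiff)
      (hc.comp_homeomorph R.symm.toHomeomorph)
    simp only [laplacian_comp_linearIsometryEquiv hη] at h
    have e := (R.measurePreserving).integral_comp R.toHomeomorph.measurableEmbedding
      (fun x => f x * (-Δ η (R.symm x) + 1 / 2 * V x * η (R.symm x)))
    rw [h] at e
    simpa only [R.symm_apply_apply, hVr (R _) _ (R.norm_map _)] using e
  · exact hf.boundary.comp R.toHomeomorph.isClosedEmbedding.tendsto_cocompact

/-- Two points of equal norm are exchanged by a reflection, and composing `f` with it gives another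
solution, hence `f` again. -/
theorem IsScatteringSolution.isRadial (hf : IsScatteringSolution V f) (hVr : IsRadial V)
    (hV : Measurable V) (hV0 : ∀ x, 0 ≤ V x) {M : ℝ} (hM : ∀ x, |V x| ≤ M) : IsRadial f := by
  intro x y hxy
  set R := Submodule.reflection (Submodule.span ℝ {x - y})ᗮ
  have hR : R x = y := Submodule.reflection_sub hxy
  have hf' := hf.comp_linearIsometryEquiv hVr R
  have h1 := hf.le_of_isScatteringSolution hf' hV hV0 hM x
  have h2 := hf'.le_of_isScatteringSolution hf hV hV0 hM x
  rw [← hR]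
  exact le_antisymm h1 h2

theorem laplacian_radial {K : ℝ → ℝ} (hK : ContDiff ℝ ∞ K) (x : Space3) :
    Δ (fun x : Space3 => K (‖x‖ ^ 2)) x =
      4 * ‖x‖ ^ 2 * deriv (deriv K) (‖x‖ ^ 2) + 6 * deriv K (‖x‖ ^ 2) := by
  have hK' : ContDiff ℝ ∞ (deriv K) := (contDiff_infty_iff_deriv.1 hK).2
  have hns : ContDiff ℝ ∞ (fun x : Space3 => ‖x‖ ^ 2) := contDiff_norm_sq ℝ
  have hd : ∀ {L : ℝ → ℝ}, ContDiff ℝ ∞ L → ∀ x : Space3,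
      HasFDerivAt (fun x : Space3 => L (‖x‖ ^ 2))
        (deriv L (‖x‖ ^ 2) • (2 • (innerSL ℝ x))) x := by
    intro L hL x
    exact (hL.differentiable (by simp) _).hasDerivAt.comp_hasFDerivAt x
      (hasStrictFDerivAt_norm_sq x).hasFDerivAt
  have hKs : ContDiff ℝ ∞ (fun x : Space3 => K (‖x‖ ^ 2)) := hK.comp hns
  rw [laplacian_eq_sum_fderiv (hKs.of_le two_le_smooth)]
  have e : ∀ a : Fin 3, fderiv ℝ (fun y => fderiv ℝ (fun x : Space3 => K (‖x‖ ^ 2)) y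
      (EuclideanSpace.single a 1)) x (EuclideanSpace.single a 1) =
      4 * x a ^ 2 * deriv (deriv K) (‖x‖ ^ 2) + 2 * deriv K (‖x‖ ^ 2) := by
    intro a
    have h1 : (fun y => fderiv ℝ (fun x : Space3 => K (‖x‖ ^ 2)) y (EuclideanSpace.single a 1)) =
        fun y => deriv K (‖y‖ ^ 2) * (2 * y a) := by
      funext y
      rw [(hd hK y).fderiv]
      simp [EuclideanSpace.inner_single_right]
    rw [h1]
    have h2 : HasFDerivAt (fun y : Space3 => 2 * y a)
        ((2 : ℝ) • (EuclideanSpace.proj a : Space3 →L[ℝ] ℝ)) x :=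
      (EuclideanSpace.proj a : Space3 →L[ℝ] ℝ).hasFDerivAt.const_mul 2
    have h3 : HasFDerivAt (fun y : Space3 => deriv K (‖y‖ ^ 2) * (2 * y a)) _ x :=
      (hd hK' x).mul h2
    rw [h3.fderiv]
    simp [EuclideanSpace.inner_single_right]
    ring
  rw [Finset.sum_congr rfl fun a _ => e a, EuclideanSpace.norm_sq_eq]
  simp only [Fin.sum_univ_three, Real.norm_eq_abs, sq_abs]
  ring

end Scattering

/-! ### Mollification of bounded radial charges. -/

section Mollification

/-- A bounded charge density on `(0, T]` bounded by `C / τ`. -/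
structure BoundedSource (ϱ : ℝ → ℝ) (B T C : ℝ) : Prop where
  measurable : Measurable ϱ
  nonneg : ∀ τ, 0 ≤ ϱ τ
  le : ∀ τ, ϱ τ ≤ B
  zero_left : ∀ τ, τ ≤ 0 → ϱ τ = 0
  zero_right : ∀ τ, T < τ → ϱ τ = 0
  mul_le : ∀ τ, ϱ τ * τ ≤ C

/-- The bump functions used for mollification. -/
def mollifier (n : ℕ) : ContDiffBump (0 : ℝ) where
  rIn := 1 / (2 * (n + 1))
  rOut := 1 / (n + 1)
  rIn_pos := by positivity
  rIn_lt_rOut := one_div_lt_one_div_of_lt (by positivity) (by linarith [n.cast_nonneg (α := ℝ)])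

/-- Convolution with a bump function. -/
def smear (n : ℕ) (ϱ : ℝ → ℝ) : ℝ → ℝ :=
  convolution ((mollifier n).normed volume) ϱ (ContinuousLinearMap.lsmul ℝ ℝ) volume

/-- A smooth approximation of a charge density on `(0, ∞)`. -/
def mollify (n : ℕ) (ϱ : ℝ → ℝ) (τ : ℝ) : ℝ :=
  Real.smoothTransition ((n + 1) * τ - 2) * smear n ϱ τ

theorem smear_eq (n : ℕ) (ϱ : ℝ → ℝ) (τ : ℝ) :
    smear n ϱ τ = ∫ t, (mollifier n).normed volume t * ϱ (τ - t) := by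
  simp [smear, convolution]

theorem mollifier_eq_zero {n : ℕ} {t : ℝ} (ht : 1 / (n + 1 : ℝ) ≤ |t|) :
    (mollifier n).normed volume t = 0 := by
  have : t ∉ Function.support ((mollifier n).normed volume) := by
    rw [ContDiffBump.support_normed_eq, Metric.mem_ball, dist_zero_right, Real.norm_eq_abs]
    exact not_lt.2 ht
  simpa using this

theorem smear_nonneg {ϱ : ℝ → ℝ} (h : ∀ τ, 0 ≤ ϱ τ) (n : ℕ) (τ : ℝ) : 0 ≤ smear n ϱ τ := by
  rw [smear_eq]
  exact integral_nonneg fun t => mul_nonneg (ContDiffBump.nonneg_normed _ _) (h _)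

theorem smear_le {ϱ : ℝ → ℝ} (h : ∀ τ, 0 ≤ ϱ τ) {n : ℕ} {τ c : ℝ}
    (hc : ∀ s, |τ - s| < 1 / (n + 1) → ϱ s ≤ c) : smear n ϱ τ ≤ c := by
  rw [smear_eq]
  have h1 : ∫ t, (mollifier n).normed volume t * c = c := by
    rw [integral_mul_const, ContDiffBump.integral_normed, one_mul]
  refine (integral_mono_of_nonneg (ae_of_all _ fun t =>
    mul_nonneg (ContDiffBump.nonneg_normed _ _) (h _))
    ((ContDiffBump.integrable_normed _).mul_const c) (ae_of_all _ fun t => ?_)).trans h1.le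
  rcases lt_or_ge |t| (1 / (n + 1)) with ht | ht
  · exact mul_le_mul_of_nonneg_left (hc _ (by rwa [sub_sub_cancel]))
      (ContDiffBump.nonneg_normed _ _)
  · simp only [mollifier_eq_zero ht, zero_mul, le_refl]

namespace BoundedSource

variable {ϱ : ℝ → ℝ} {B T C : ℝ} (h : BoundedSource ϱ B T C)
include h

theorem integrable : Integrable ϱ := by
  have h1 : IntegrableOn (fun _ : ℝ => B) (Set.Icc 0 T) := integrableOn_const (by simp)
  have h2 : Integrable ((Set.Icc 0 T).indicator fun _ : ℝ => B) :=
    h1.integrable_indicator measurableSet_Icc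
  refine h2.mono' h.measurable.aestronglyMeasurable (ae_of_all _ fun τ => ?_)
  rw [Real.norm_of_nonneg (h.nonneg τ)]
  by_cases hτ : τ ∈ Set.Icc 0 T
  · rw [Set.indicator_of_mem hτ]
    exact h.le τ
  · rw [Set.indicator_of_notMem hτ]
    rw [Set.mem_Icc, not_and_or, not_le, not_le] at hτ
    rcases hτ with hτ | hτ
    · rw [h.zero_left τ hτ.le]
    · rw [h.zero_right τ hτ]

theorem mollify_eq_zero_right {n : ℕ} {τ : ℝ} (hτ : T + 1 < τ) : mollify n ϱ τ = 0 := by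
  have h1 : (1 : ℝ) / (n + 1) ≤ 1 := by
    rw [div_le_one (by positivity)]
    linarith [n.cast_nonneg (α := ℝ)]
  have : smear n ϱ τ ≤ 0 := smear_le h.nonneg fun s hs => by
    rw [h.zero_right s (by linarith [(abs_lt.1 hs).2])]
  rw [mollify, le_antisymm this (smear_nonneg h.nonneg n τ), mul_zero]

theorem mollify_nonneg (n : ℕ) (τ : ℝ) : 0 ≤ mollify n ϱ τ :=
  mul_nonneg (Real.smoothTransition.nonneg _) (smear_nonneg h.nonneg n τ)

theorem mollify_le (n : ℕ) (τ : ℝ) : mollify n ϱ τ ≤ B :=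
  (mul_le_of_le_one_left (smear_nonneg h.nonneg n τ) (Real.smoothTransition.le_one _)).trans
    (smear_le h.nonneg fun s _ => h.le s)

omit h in
theorem mollify_eq_zero_left {n : ℕ} {τ : ℝ} (hτ : τ ≤ 2 / (n + 1)) : mollify n ϱ τ = 0 := by
  rw [mollify, Real.smoothTransition.zero_of_nonpos, zero_mul]
  rw [le_div_iff₀ (by positivity)] at hτ
  linarith

/-- The cutoff at `2 / (n + 1)` is twice the mollification radius. Hence only points `s ≥ τ / 2` are
averaged at a `τ` where the result can be nonzero, and `C / s ≤ 2C / τ`. -/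
theorem smoothSource_mollify (n : ℕ) : SmoothSource (mollify n ϱ) (2 / (n + 1)) (2 * C) where
  smooth := by
    refine (Real.smoothTransition.contDiff.comp ((contDiff_const.mul contDiff_id).sub
      contDiff_const)).mul ?_
    exact (ContDiffBump.hasCompactSupport_normed _).contDiff_convolution_left _
      (ContDiffBump.contDiff_normed _) h.integrable.locallyIntegrable
  compact := by
    refine HasCompactSupport.intro (K := Set.Icc 0 (T + 1)) isCompact_Icc fun τ hτ => ?_
    rw [Set.mem_Icc, not_and_or, not_le, not_le] at hτ
    rcases hτ with hτ | hτ
    · exact mollify_eq_zero_left (hτ.le.trans (by positivity))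
    · exact h.mollify_eq_zero_right hτ
  pos := by positivity
  zero τ hτ := mollify_eq_zero_left hτ
  nonneg := h.mollify_nonneg n
  mul_le τ := by
    have hC : 0 ≤ C := by simpa using h.mul_le 0
    rcases le_or_gt τ (2 / (n + 1)) with hτ | hτ
    · rw [mollify_eq_zero_left hτ]
      linarith
    · have hτ0 : 0 < τ := lt_trans (by positivity) hτ
      rw [← le_div_iff₀ hτ0]
      refine (mul_le_of_le_one_left (smear_nonneg h.nonneg n τ)
        (Real.smoothTransition.le_one _)).trans (smear_le h.nonneg fun s hs => ?_)
      have h1 : (2 : ℝ) / (n + 1) = 2 * (1 / (n + 1)) := by ring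
      have h2 : τ / 2 ≤ s := by linarith [(abs_lt.1 hs).2]
      have h3 := h.mul_le s
      rw [le_div_iff₀ hτ0]
      nlinarith [h.nonneg s]

/-- Lebesgue's differentiation theorem for the averages; at each `τ > 0` the cutoff is eventually
`1`. -/
theorem ae_tendsto_mollify :
    ∀ᵐ τ, Tendsto (fun n => mollify n ϱ τ) atTop (𝓝 (ϱ τ)) := by
  have hr : Tendsto (fun n => (mollifier n).rOut) atTop (𝓝 0) :=
    tendsto_one_div_add_atTop_nhds_zero_nat
  have h1 := ContDiffBump.ae_convolution_tendsto_right_of_locallyIntegrable (μ := volume)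
    (φ := mollifier) (l := atTop) (K := 2) hr (Eventually.of_forall fun n => by
      simp only [mollifier]
      rw [show (2 : ℝ) * (1 / (2 * (n + 1))) = 1 / (n + 1) by field_simp])
    h.integrable.locallyIntegrable
  filter_upwards [h1] with τ hτ
  rcases le_or_gt τ 0 with h0 | h0
  · rw [h.zero_left τ h0]
    refine tendsto_const_nhds.congr fun n => (mollify_eq_zero_left (h0.trans (by positivity))).symm
  · have h2 : Tendsto (fun n : ℕ => ((n : ℝ) + 1) * τ - 2) atTop atTop :=
      tendsto_atTop_add_const_right _ _
        ((tendsto_atTop_add_const_right _ _ tendsto_natCast_atTop_atTop).atTop_mul_const h0)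
    refine hτ.congr' ?_
    filter_upwards [h2.eventually_ge_atTop 1] with n hn
    rw [mollify, Real.smoothTransition.one_of_one_le hn, one_mul]
    rfl

theorem tendsto_integral_mollify_mul {w : ℝ → ℝ} (hw : Measurable w) (hw1 : ∀ τ, ‖w τ‖ ≤ 1) :
    Tendsto (fun n => ∫ τ in Set.Ioi (0 : ℝ), mollify n ϱ τ * w τ) atTop
      (𝓝 (∫ τ in Set.Ioi (0 : ℝ), ϱ τ * w τ)) := by
  have h1 : IntegrableOn (fun _ : ℝ => B) (Set.Icc 0 (T + 1)) := integrableOn_const (by simp)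
  have h2 : Integrable ((Set.Icc 0 (T + 1)).indicator fun _ : ℝ => B) :=
    h1.integrable_indicator measurableSet_Icc
  refine tendsto_integral_of_dominated_convergence _ (fun n =>
    ((h.smoothSource_mollify n).smooth.continuous.measurable.mul hw).aestronglyMeasurable)
    h2.integrableOn (fun n => ?_) ?_
  · refine ae_restrict_of_ae (ae_of_all _ fun τ => ?_)
    rw [norm_mul, Real.norm_of_nonneg (h.mollify_nonneg n τ)]
    refine (mul_le_of_le_one_right (h.mollify_nonneg n τ) (hw1 τ)).trans ?_
    by_cases hτ : τ ∈ Set.Icc 0 (T + 1)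
    · rw [Set.indicator_of_mem hτ]
      exact h.mollify_le n τ
    · rw [Set.indicator_of_notMem hτ]
      rw [Set.mem_Icc, not_and_or, not_le, not_le] at hτ
      rcases hτ with hτ | hτ
      · rw [mollify_eq_zero_left (hτ.le.trans (by positivity))]
      · rw [h.mollify_eq_zero_right hτ]
  · refine ae_restrict_of_ae ?_
    filter_upwards [h.ae_tendsto_mollify] with τ hτ using hτ.mul_const _

theorem tendsto_integral_mollify :
    Tendsto (fun n => ∫ τ in Set.Ioi (0 : ℝ), mollify n ϱ τ) atTop
      (𝓝 (∫ τ in Set.Ioi (0 : ℝ), ϱ τ)) := by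
  simpa using h.tendsto_integral_mollify_mul (w := fun _ => 1) measurable_const (by simp)

theorem tendsto_newton_mollify (q : ℝ) :
    Tendsto (fun n => newton (mollify n ϱ) q) atTop (𝓝 (newton ϱ q)) := by
  refine ((h.tendsto_integral_mollify_mul (measurable_newtonWeight q) fun τ => ?_).const_mul
    (1 / 2)).const_sub 1
  rw [Real.norm_of_nonneg (newtonWeight_nonneg τ q)]
  exact newtonWeight_le_one τ q

theorem continuous_newton : Continuous (newton ϱ) := by
  have hI := h.integrable
  refine continuous_const.sub (continuous_const.mul ?_)
  refine continuous_of_dominated (bound := ϱ) (fun q =>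
    (h.measurable.mul (measurable_newtonWeight q)).aestronglyMeasurable) (fun q => ?_)
    hI.integrableOn ?_
  · refine ae_of_all _ fun τ => ?_
    rw [norm_mul, Real.norm_of_nonneg (h.nonneg τ), Real.norm_of_nonneg (newtonWeight_nonneg τ q)]
    exact mul_le_of_le_one_right (h.nonneg τ) (newtonWeight_le_one τ q)
  · refine (ae_restrict_iff' measurableSet_Ioi).2 (ae_of_all _ fun τ hτ => ?_)
    refine continuous_const.mul (continuous_const.div
      (continuous_const.max Real.continuous_sqrt) fun q => ?_)
    exact (lt_max_of_lt_left (Real.sqrt_pos.2 hτ)).ne'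

/-- Dominated convergence: the weights are at most `1` and tend to `0` as `q` grows. -/
theorem tendsto_newton : Tendsto (newton ϱ) atTop (𝓝 1) := by
  have hI := h.integrable
  have h1 : Tendsto (fun q => ∫ τ in Set.Ioi (0 : ℝ), ϱ τ * (√τ / max √τ √q)) atTop
      (𝓝 (∫ τ in Set.Ioi (0 : ℝ), (0 : ℝ))) := by
    refine tendsto_integral_filter_of_dominated_convergence ϱ (Eventually.of_forall fun q =>
      (h.measurable.mul (measurable_newtonWeight q)).aestronglyMeasurable)
      (Eventually.of_forall fun q => ae_of_all _ fun τ => ?_) hI.integrableOn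
      (ae_of_all _ fun τ => ?_)
    · rw [norm_mul, Real.norm_of_nonneg (h.nonneg τ), Real.norm_of_nonneg (newtonWeight_nonneg τ q)]
      exact mul_le_of_le_one_right (h.nonneg τ) (newtonWeight_le_one τ q)
    · have h2 : Tendsto (fun q => max √τ √q) atTop atTop :=
        tendsto_atTop_mono (fun q => le_max_right _ _) Real.tendsto_sqrt_atTop
      simpa using (tendsto_const_nhds.div_atTop h2).const_mul (ϱ τ)
  have h2 := (h1.const_mul (1 / 2)).const_sub 1
  simp only [integral_zero, mul_zero, sub_zero] at h2
  exact h2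

theorem tendsto_newton_norm_sq :
    Tendsto (fun x : Space3 => newton ϱ (‖x‖ ^ 2)) (cocompact Space3) (𝓝 1) :=
  h.tendsto_newton.comp ((tendsto_pow_atTop two_ne_zero).comp (tendsto_norm_cocompact_atTop))

end BoundedSource

end Mollification

/-! ### Null sets under `x ↦ |x|²` and under relative coordinates. -/

section Radial

/-- Null sets of squared radii give null sets of `ℝ³`. -/
theorem ae_comp_norm_sq {p : ℝ → Prop} (hp : ∀ᵐ τ : ℝ, p τ) : ∀ᵐ x : Space3, p (‖x‖ ^ 2) := by
  have hd : DifferentiableOn ℝ Real.sqrt ({τ | ¬p τ} ∩ Set.Ioi 0) := fun τ hτ =>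
    (Real.hasDerivAt_sqrt (ne_of_gt hτ.2)).differentiableAt.differentiableWithinAt
  -- The square root is differentiable on `(0, ∞)`, so it maps null sets to null sets. Polar
  -- coordinates then carry a null set of radii to a null set of `ℝ³`.
  have h0 : volume (Real.sqrt '' ({τ | ¬p τ} ∩ Set.Ioi 0)) = 0 :=
    addHaar_image_eq_zero_of_differentiableOn_of_addHaar_eq_zero volume hd
      (measure_mono_null Set.inter_subset_left hp)
  set s := toMeasurable volume (Real.sqrt '' ({τ | ¬p τ} ∩ Set.Ioi 0)) with hs
  have hs0 : volume s = 0 := by rw [hs, measure_toMeasurable, h0]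
  have hsm : MeasurableSet s := measurableSet_toMeasurable _ _
  set g : ℝ → ℝ := s.indicator fun _ => 1
  have hg : ∀ᵐ r : ℝ, g r = 0 := by
    filter_upwards [compl_mem_ae_iff.2 hs0] with r hr using Set.indicator_of_notMem hr _
  have hg' : ∀ k : ℕ, (fun r : ℝ => r ^ k • g r) =ᵐ[volume.restrict (Set.Ioi 0)] fun _ => 0 :=
    fun k => ae_restrict_of_ae (by filter_upwards [hg] with r hr; simp [hr])
  have h1 : Integrable (fun x : Space3 => g ‖x‖) :=
    (integrable_fun_norm_addHaar volume (f := g)).2 ((integrable_zero _ _ _).congr (hg' _).symm)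
  have h2 : ∫ x : Space3, g ‖x‖ = 0 := by
    rw [integral_fun_norm_addHaar volume g, integral_congr_ae (hg' _)]
    simp
  rw [integral_eq_zero_iff_of_nonneg (fun x => Set.indicator_nonneg (fun _ _ => zero_le_one) _) h1]
    at h2
  have h3 : ∀ᵐ x : Space3, x ≠ 0 := compl_mem_ae_iff.2 (measure_singleton 0)
  filter_upwards [h2, h3] with x hx hx0
  by_contra hcon
  have hpos : 0 < ‖x‖ := norm_pos_iff.2 hx0
  have : ‖x‖ ∈ s := subset_toMeasurable _ _
    ⟨‖x‖ ^ 2, ⟨hcon, Set.mem_Ioi.2 (by positivity)⟩, Real.sqrt_sq hpos.le⟩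
  simp [this] at hx

/-- Preimages of null sets under a surjective linear map are null. -/
theorem ae_comp_pair {p : Space3 → Prop} (hp : ∀ᵐ y : Space3, p y) {N : ℕ} {i j : Fin N}
    (hij : i ≠ j) {c : ℝ} (hc : c ≠ 0) :
    ∀ᵐ x : Config N, p (c • (position x i - position x j)) := by
  let L : Config N →ₗ[ℝ] Space3 :=
    { toFun := fun x => c • (position x i - position x j)
      map_add' := fun x y => by
        ext a
        simp [position]
        ring
      map_smul' := fun r x => by
        ext a
        simp [position]
        ring }
  have hL : Function.Surjective L := fun y => by
    refine ⟨WithLp.toLp 2 fun p => if p.1 = i then c⁻¹ * y p.2 else 0, ?_⟩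
    ext a
    simp [L, position, hij.symm, hc]
  set s := toMeasurable volume {y | ¬p y}
  have hs : ∀ᵐ y : Space3, y ∈ sᶜ := compl_mem_ae_iff.2 (by rw [measure_toMeasurable]; exact hp)
  have h := (ae_comp_linearMap_mem_iff L volume volume hL
    (measurableSet_toMeasurable _ _).compl).2 hs
  filter_upwards [h] with x hx
  by_contra hcon
  exact hx (subset_toMeasurable _ _ hcon)

end Radial

/-! ### The charge `V f / 2` and its bounds in terms of `strength`. -/

section ScatteringSource

variable {V f : Space3 → ℝ}

theorem IsRadial.profile_norm (hV : IsRadial V) (x : Space3) : profile V ‖x‖ = V x :=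
  hV _ _ (by simp [norm_smul])

/-- The charge density `V f / 2` as a function of the squared radius. -/
def scatteringSource (V f : Space3 → ℝ) (τ : ℝ) : ℝ :=
  if 0 < τ then 1 / 2 * profile V √τ * profile f √τ else 0

theorem scatteringSource_norm_sq (hV : IsRadial V) (hf : IsRadial f) {x : Space3} (hx : x ≠ 0) :
    scatteringSource V f (‖x‖ ^ 2) = 1 / 2 * V x * f x := by
  have : 0 < ‖x‖ := norm_pos_iff.2 hx
  rw [scatteringSource, if_pos (by positivity), Real.sqrt_sq this.le, hV.profile_norm,
    hf.profile_norm]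

theorem measurable_profile (hV : Measurable V) : Measurable (profile V) :=
  hV.comp (by fun_prop)

theorem exists_profile_eq_zero (hc : HasCompactSupport V) :
    ∃ R : ℝ, 0 < R ∧ ∀ r, R < r → profile V r = 0 := by
  obtain ⟨R, hR, h⟩ := hc.isCompact.isBounded.subset_closedBall_lt 0 0
  refine ⟨R, hR, fun r hr => ?_⟩
  by_contra hne
  have := h (subset_tsupport _ hne)
  simp [norm_smul, abs_of_pos (hR.trans hr)] at this
  linarith

theorem bddAbove_sq_mul_profile (hc : HasCompactSupport V) (hV0 : ∀ x, 0 ≤ V x) {M : ℝ}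
    (hM : ∀ x, V x ≤ M) :
    BddAbove (Set.range fun r : Set.Ici (0 : ℝ) => (r : ℝ) ^ 2 * profile V r) := by
  obtain ⟨R, hR, h⟩ := exists_profile_eq_zero hc
  refine ⟨R ^ 2 * M, ?_⟩
  rintro _ ⟨⟨r, hr⟩, rfl⟩
  have hM0 : 0 ≤ M := (hV0 0).trans (hM 0)
  rcases le_or_gt r R with h1 | h1
  · have hr0 : 0 ≤ r := hr
    have := hM (r • EuclideanSpace.single 0 1)
    have h2 : 0 ≤ profile V r := hV0 _
    simp only [profile] at h2 ⊢
    gcongr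
  · simp only [h r h1, mul_zero]
    positivity

theorem strength_integral_nonneg (hV0 : ∀ x, 0 ≤ V x) :
    0 ≤ ∫ r in Set.Ioi (0 : ℝ), r * profile V r :=
  setIntegral_nonneg measurableSet_Ioi fun _ hr => mul_nonneg (le_of_lt hr) (hV0 _)

/-- With `τ = r²` and `0 ≤ f ≤ 1`, the bound `C / τ` is the supremum part of `strength`, halved by
the factor in `V f / 2`. -/
theorem boundedSource_scatteringSource (hV : Measurable V) (hV0 : ∀ x, 0 ≤ V x)
    (hc : HasCompactSupport V) {M : ℝ} (hM : ∀ x, V x ≤ M) (hf : Measurable f)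
    (hf0 : ∀ x, 0 ≤ f x) (hf1 : ∀ x, f x ≤ 1) :
    ∃ T, BoundedSource (scatteringSource V f) M T (strength V / 2) := by
  obtain ⟨R, hR, h⟩ := exists_profile_eq_zero hc
  have hM0 : 0 ≤ M := (hV0 0).trans (hM 0)
  have hp0 : ∀ r, 0 ≤ profile V r := fun r => hV0 _
  have hq0 : ∀ r, 0 ≤ profile f r := fun r => hf0 _
  have hq1 : ∀ r, profile f r ≤ 1 := fun r => hf1 _
  have hs : ∀ r, 0 ≤ r → r ^ 2 * profile V r ≤ strength V := fun r hr =>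
    (le_ciSup (bddAbove_sq_mul_profile hc hV0 hM) ⟨r, hr⟩).trans
      (le_add_of_nonneg_right (strength_integral_nonneg hV0))
  refine ⟨R ^ 2, ?_, fun τ => ?_, fun τ => ?_, fun τ hτ => ?_, fun τ hτ => ?_, fun τ => ?_⟩
  · refine Measurable.ite measurableSet_Ioi ?_ measurable_const
    exact (measurable_const.mul ((measurable_profile hV).comp Real.continuous_sqrt.measurable)).mul
      ((measurable_profile hf).comp Real.continuous_sqrt.measurable)
  · unfold scatteringSource
    split_ifs
    · exact mul_nonneg (mul_nonneg (by norm_num) (hp0 _)) (hq0 _)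
    · exact le_rfl
  · unfold scatteringSource
    split_ifs
    · have h1 : profile V √τ ≤ M := hM _
      nlinarith [hp0 √τ, hq0 √τ, hq1 √τ]
    · exact hM0
  · rw [scatteringSource, if_neg (not_lt.2 hτ)]
  · have : R < √τ := Real.lt_sqrt_of_sq_lt hτ
    unfold scatteringSource
    rw [h _ this]
    simp
  · unfold scatteringSource
    split_ifs with hτ
    · have h1 := hs √τ (Real.sqrt_nonneg _)
      rw [Real.sq_sqrt hτ.le] at h1
      nlinarith [mul_nonneg hτ.le (hp0 √τ), hq0 √τ, hq1 √τ]
    · have h1 := hs 0 le_rfl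
      simp at h1 ⊢
      linarith

/-- Replace `f` by `1` and substitute `τ = r²`; the factor in `dτ = 2 r dr` cancels the `½`. -/
theorem integral_scatteringSource_le (hV : Measurable V) (hV0 : ∀ x, 0 ≤ V x)
    (hc : HasCompactSupport V) {M : ℝ} (hM : ∀ x, V x ≤ M) (hf : Measurable f)
    (hf0 : ∀ x, 0 ≤ f x) (hf1 : ∀ x, f x ≤ 1) :
    ∫ τ in Set.Ioi (0 : ℝ), scatteringSource V f τ ≤ strength V := by
  obtain ⟨T, h⟩ := boundedSource_scatteringSource hV hV0 hc hM hf hf0 hf1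
  obtain ⟨T', h'⟩ := boundedSource_scatteringSource (f := fun _ => 1) hV hV0 hc hM measurable_const
    (fun _ => zero_le_one) (fun _ => le_rfl)
  have h1 : ∫ τ in Set.Ioi (0 : ℝ), scatteringSource V f τ ≤
      ∫ τ in Set.Ioi (0 : ℝ), scatteringSource V (fun _ => 1) τ := by
    refine setIntegral_mono_on h.integrable.integrableOn h'.integrable.integrableOn
      measurableSet_Ioi fun τ hτ => ?_
    rw [scatteringSource, scatteringSource, if_pos (Set.mem_Ioi.1 hτ), if_pos (Set.mem_Ioi.1 hτ)]
    exact mul_le_mul_of_nonneg_left (hf1 _) (mul_nonneg (by norm_num) (hV0 _))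
  have h2 : ∫ τ in Set.Ioi (0 : ℝ), scatteringSource V (fun _ => 1) τ =
      ∫ r in Set.Ioi (0 : ℝ), r * profile V r := by
    rw [← integral_comp_rpow_Ioi_of_pos two_pos]
    refine setIntegral_congr_fun measurableSet_Ioi fun r hr => ?_
    have hr' : (0 : ℝ) < r := hr
    have e : r ^ (2 : ℝ) = r ^ 2 := by norm_cast
    have e' : r ^ ((2 : ℝ) - 1) = r := by norm_num
    simp only [e, e', smul_eq_mul]
    rw [scatteringSource, if_pos (by positivity), Real.sqrt_sq hr'.le]
    simp only [profile]
    ring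
  have h3 : 0 ≤ ⨆ r : Set.Ici (0 : ℝ), (r : ℝ) ^ 2 * profile V r :=
    Real.iSup_nonneg fun r => mul_nonneg (by positivity) (hV0 _)
  rw [h2] at h1
  unfold strength
  linarith

end ScatteringSource

/-! ### The scattering solution as a Newton potential, and its approximation. -/

section NewtonRepresentation

theorem SmoothSource.laplacian_newton {ϱ : ℝ → ℝ} {ε C : ℝ} (h : SmoothSource ϱ ε C) (x : Space3) :
    Δ (fun x : Space3 => newton ϱ (‖x‖ ^ 2)) x = ϱ (‖x‖ ^ 2) := by
  rw [laplacian_radial h.contDiff_newton, h.radial_laplacian_newton]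

theorem abs_newton_le {ϱ : ℝ → ℝ} (h0 : ∀ τ, 0 < τ → 0 ≤ ϱ τ) (hω : IntegrableOn ϱ (Set.Ioi 0))
    (q : ℝ) : |newton ϱ q| ≤ 1 + 1 / 2 * ∫ τ in Set.Ioi (0 : ℝ), ϱ τ := by
  have h1 := newton_le_one h0 q
  have h2 := le_newton h0 hω q
  have h3 : 0 ≤ ∫ τ in Set.Ioi (0 : ℝ), ϱ τ := setIntegral_nonneg measurableSet_Ioi h0
  rw [abs_le]
  constructor <;> linarith

/-- Green's identity for the mollified charges, with dominated convergence on both sides. -/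
theorem BoundedSource.integral_newton_mul_laplacian {ϱ : ℝ → ℝ} {B T C : ℝ}
    (h : BoundedSource ϱ B T C) {η : Space3 → ℝ} (hη : ContDiff ℝ ∞ η)
    (hc : HasCompactSupport η) :
    ∫ x : Space3, newton ϱ (‖x‖ ^ 2) * Δ η x = ∫ x : Space3, ϱ (‖x‖ ^ 2) * η x := by
  have hLc := continuous_laplacian hη
  have hLi : Integrable (Δ η) :=
    hLc.integrable_of_hasCompactSupport (hasCompactSupport_laplacian hη hc)
  have hηi : Integrable η := hη.continuous.integrable_of_hasCompactSupport hc
  have h1 : Tendsto (fun n => ∫ x : Space3, newton (mollify n ϱ) (‖x‖ ^ 2) * Δ η x) atTop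
      (𝓝 (∫ x : Space3, newton ϱ (‖x‖ ^ 2) * Δ η x)) := by
    refine tendsto_integral_filter_of_dominated_convergence
      (fun x => (1 + 1 / 2 * ((∫ τ in Set.Ioi (0 : ℝ), ϱ τ) + 1)) * ‖Δ η x‖)
      (Eventually.of_forall fun n => ?_) ?_ (hLi.norm.const_mul _) (ae_of_all _ fun x => ?_)
    · exact (((h.smoothSource_mollify n).contDiff_newton.continuous.comp
        (continuous_norm.pow 2)).mul hLc).aestronglyMeasurable
    · filter_upwards [h.tendsto_integral_mollify.eventually_le_const
        (lt_add_of_pos_right _ zero_lt_one)] with n hn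
      refine ae_of_all _ fun x => ?_
      rw [norm_mul, Real.norm_eq_abs]
      have := abs_newton_le (fun τ _ => h.mollify_nonneg n τ)
        (h.smoothSource_mollify n).integrable.integrableOn (‖x‖ ^ 2)
      gcongr
      linarith
    · exact (h.tendsto_newton_mollify _).mul_const _
  have h2 : Tendsto (fun n => ∫ x : Space3, mollify n ϱ (‖x‖ ^ 2) * η x) atTop
      (𝓝 (∫ x : Space3, ϱ (‖x‖ ^ 2) * η x)) := by
    refine tendsto_integral_of_dominated_convergence (fun x => B * ‖η x‖) (fun n => ?_)
      (hηi.norm.const_mul _) (fun n => ae_of_all _ fun x => ?_) ?_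
    · exact (((h.smoothSource_mollify n).smooth.continuous.comp
        (continuous_norm.pow 2)).mul hη.continuous).aestronglyMeasurable
    · rw [norm_mul, Real.norm_of_nonneg (h.mollify_nonneg n _)]
      exact mul_le_mul_of_nonneg_right (h.mollify_le n _) (norm_nonneg _)
    · filter_upwards [ae_comp_norm_sq h.ae_tendsto_mollify] with x hx using hx.mul_const _
  refine tendsto_nhds_unique h1 (h2.congr fun n => ?_)
  have hs := h.smoothSource_mollify n
  have := integral_mul_laplacian (u := fun x : Space3 => newton (mollify n ϱ) (‖x‖ ^ 2))
    (hs.contDiff_newton.comp (contDiff_norm_sq ℝ)) hη hc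
  rw [this]
  simp only [hs.laplacian_newton]

/-- Both functions have the distributional Laplacian `V f / 2` and the limit `1`; the maximum
principle with `w = 0` is applied to their difference in both orders. -/
theorem IsScatteringSolution.eq_newton {V f : Space3 → ℝ} (hf : IsScatteringSolution V f)
    (hVr : IsRadial V) (hfr : IsRadial f) (hV : Measurable V) {M : ℝ} (hM : ∀ x, |V x| ≤ M)
    {B T C : ℝ} (h : BoundedSource (scatteringSource V f) B T C) (x : Space3) :
    f x = newton (scatteringSource V f) (‖x‖ ^ 2) := by
  set g : Space3 → ℝ := fun x => newton (scatteringSource V f) (‖x‖ ^ 2)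
  have hg : Continuous g := h.continuous_newton.comp (continuous_norm.pow 2)
  have h0 : ∀ η : Space3 → ℝ, ContDiff ℝ ∞ η → HasCompactSupport η →
      ∫ x, f x * Δ η x = ∫ x, g x * Δ η x := by
    intro η hη hc
    rw [hf.integral_mul_laplacian hV hM hη hc, h.integral_newton_mul_laplacian hη hc]
    refine integral_congr_ae ?_
    have h3 : ∀ᵐ x : Space3, x ≠ 0 := compl_mem_ae_iff.2 (measure_singleton 0)
    filter_upwards [h3] with x hx
    rw [scatteringSource_norm_sq hVr hfr hx]
  have h1 := nonpos_of_subharmonic_where_pos (g := fun x => f x - g x) (w := fun _ => 0)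
    (hf.continuous.sub hg) (fun η hη hc => ?_) (fun _ _ => le_rfl) le_rfl
    (by simpa using hf.boundary.sub h.tendsto_newton_norm_sq) x
  have h2 := nonpos_of_subharmonic_where_pos (g := fun x => g x - f x) (w := fun _ => 0)
    (hg.sub hf.continuous) (fun η hη hc => ?_) (fun _ _ => le_rfl) le_rfl
    (by simpa using h.tendsto_newton_norm_sq.sub hf.boundary) x
  · linarith
  all_goals
    have i1 := integrable_mul_laplacian hf.continuous hη hc
    have i2 := integrable_mul_laplacian hg hη hc
    simp only [sub_mul, zero_mul, integral_zero]
    first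
    | rw [integral_sub i1 i2, h0 η hη hc, sub_self]
    | rw [integral_sub i2 i1, h0 η hη hc, sub_self]

/-- Smooth approximations of the scattering solution and of the interaction. -/
theorem IsScatteringSolution.exists_smallProfile {V f : Space3 → ℝ}
    (hf : IsScatteringSolution V f) (hV : Measurable V) (hV0 : ∀ x, 0 ≤ V x) (hVr : IsRadial V)
    (hc : HasCompactSupport V) (hM : ∃ M : ℝ, ∀ x, V x ≤ M) (hρ : strength V ≤ 1 / 3000) {N : ℕ}
    (hN : N ≠ 0) :
    ∃ (K : ℕ → ℝ → ℝ) (δ : ℕ → ℝ) (B : ℝ), (∀ n, SmallProfile (K n) (δ n)) ∧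
      (∀ (i j : Fin N) (x : Config N), Tendsto (fun n => K n (sqDist i j x)) atTop
        (𝓝 (f ((N : ℝ) • (position x i - position x j))))) ∧
      (∀ n q, |profilePotential (K n) q| ≤ B) ∧
      ∀ i j : Fin N, i ≠ j → ∀ᵐ x : Config N,
        Tendsto (fun n => profilePotential (K n) (sqDist i j x)) atTop
          (𝓝 ((N : ℝ) ^ 2 * V ((N : ℝ) • (position x i - position x j)))) := by
  obtain ⟨M, hM⟩ := hM
  have hM' : ∀ x, |V x| ≤ M := fun x => by rw [abs_of_nonneg (hV0 x)]; exact hM x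
  have hM0 : 0 ≤ M := (hV0 0).trans (hM 0)
  have hf0 := hf.nonneg hV hV0 hM'
  have hf1 := hf.le_one hV hV0 hM'
  have hfr := hf.isRadial hVr hV hV0 hM'
  obtain ⟨T, h⟩ := boundedSource_scatteringSource hV hV0 hc hM hf.continuous.measurable hf0 hf1
  have hI := integral_scatteringSource_le hV hV0 hc hM hf.continuous.measurable hf0 hf1
  have hrep := hf.eq_newton hVr hfr hV hM' h
  set ϱ := scatteringSource V f
  have hNpos : (0 : ℝ) < (N : ℝ) ^ 2 := by positivity
  have harg : ∀ (i j : Fin N) (x : Config N), (N : ℝ) ^ 2 * sqDist i j x =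
      ‖(N : ℝ) • (position x i - position x j)‖ ^ 2 := fun i j x => by
    rw [sqDist_eq, norm_smul, mul_pow]
    simp
  -- The mollified charges satisfy the required bound `1/5` only eventually, so the sequence is
  -- shifted by `n₀`.
  obtain ⟨n₀, hn₀⟩ := eventually_atTop.1 (h.tendsto_integral_mollify.eventually_le_const
    (show (∫ τ in Set.Ioi (0 : ℝ), ϱ τ) < 1 / 5 by linarith))
  have hK : ∀ n, SmallProfile (fun q => newton (mollify (n + n₀) ϱ) ((N : ℝ) ^ 2 * q))
      (2 / ((n + n₀ : ℕ) + 1) / (N : ℝ) ^ 2) := fun n =>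
    (h.smoothSource_mollify (n + n₀)).smallProfile hNpos (by linarith) (hn₀ _ (by omega))
  refine ⟨fun n q => newton (mollify (n + n₀) ϱ) ((N : ℝ) ^ 2 * q), _,
    (N : ℝ) ^ 2 * (2 * M / (9 / 10)), hK, fun i j x => ?_, fun n q => ?_, fun i j hij => ?_⟩
  · rw [hrep, ← harg]
    exact (h.tendsto_newton_mollify _).comp (tendsto_add_atTop_nat n₀)
  · have h1 := (hK n).lower q
    have h2 := h.mollify_nonneg (n + n₀) ((N : ℝ) ^ 2 * q)
    have h3 := h.mollify_le (n + n₀) ((N : ℝ) ^ 2 * q)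
    rw [(h.smoothSource_mollify (n + n₀)).profilePotential_newton, abs_of_nonneg (by positivity)]
    gcongr
  · have hne : (N : ℝ) ≠ 0 := by positivity
    have h3 : ∀ᵐ y : Space3, y ≠ 0 := compl_mem_ae_iff.2 (measure_singleton 0)
    filter_upwards [ae_comp_pair (ae_comp_norm_sq h.ae_tendsto_mollify) hij hne,
      ae_comp_pair h3 hij hne] with x hx hx0
    -- The limiting potential is `N² · 2 (V f / 2) / f`, and to cancel `f` it must not vanish.
    have hfx : f ((N : ℝ) • (position x i - position x j)) ≠ 0 := by
      rw [hrep]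
      have := le_newton (fun τ _ => h.nonneg τ) h.integrable.integrableOn
        (‖(N : ℝ) • (position x i - position x j)‖ ^ 2)
      intro h0
      linarith
    simp only [(h.smoothSource_mollify _).profilePotential_newton, harg]
    have h4 := (hx.const_mul 2).div (h.tendsto_newton_mollify
      (‖(N : ℝ) • (position x i - position x j)‖ ^ 2)) (by rwa [← hrep])
    have h5 := (h4.comp (tendsto_add_atTop_nat n₀)).const_mul ((N : ℝ) ^ 2)
    rw [← hrep, show ϱ (‖(N : ℝ) • (position x i - position x j)‖ ^ 2) = _ from
      scatteringSource_norm_sq hVr hfr hx0] at h5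
    convert h5 using 2
    · rfl
    · field_simp

end NewtonRepresentation

/-! ### Square integrability of distributions by duality. -/

section Duality

variable {N : ℕ}

theorem denseRange_toLp : DenseRange fun η : 𝓢(Config N, ℂ) => η.toLp 2 :=
  SchwartzMap.denseRange_toLpCLM (E := Config N) (F := ℂ) (p := 2) ENNReal.ofNat_ne_top

/-- Multiplying `η` by a phase and a real `t` turns the hypothesis into a quadratic inequality in
`t`, whose optimum is the claim. -/
theorem norm_le_of_two_re_sub_sq_le {u : 𝓢'(Config N, ℂ)} {c : ℝ}
    (h : ∀ η : 𝓢(Config N, ℂ), 2 * (u η).re - ‖η.toLp 2‖ ^ 2 ≤ c) (η : 𝓢(Config N, ℂ)) :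
    ‖u η‖ ≤ √c * ‖η.toLp 2‖ := by
  have hc : 0 ≤ c := by simpa [SchwartzMap.norm_toLp] using h 0
  obtain ⟨z, hz, hzu⟩ : ∃ z : ℂ, ‖z‖ = 1 ∧ z * u η = ‖u η‖ := by
    rcases eq_or_ne (u η) 0 with h0 | h0
    · exact ⟨1, by simp, by simp [h0]⟩
    · have hn : (‖u η‖ : ℂ) ≠ 0 := by simpa using h0
      refine ⟨(starRingEnd ℂ) (u η) / ‖u η‖, by simp [h0], ?_⟩
      rw [div_mul_eq_mul_div, mul_comm, Complex.mul_conj, Complex.normSq_eq_norm_sq]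
      push_cast
      field_simp
  have key : ∀ t : ℝ, 2 * (t * ‖u η‖) - t ^ 2 * ‖η.toLp 2‖ ^ 2 ≤ c := by
    intro t
    have h1 := h (((t : ℂ) * z) • η)
    have h2 : (((t : ℂ) * z) • η).toLp 2 = ((t : ℂ) * z) • (η.toLp 2 : WaveFunction N) :=
      map_smul (SchwartzMap.toLpCLM ℂ ℂ 2 (volume : Measure (Config N))) _ η
    rw [map_smul, h2, norm_smul, smul_eq_mul, mul_assoc, hzu] at h1
    simpa [hz, mul_pow] using h1
  set b := ‖u η‖
  set n := ‖η.toLp 2‖ with hn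
  have hb : 0 ≤ b := norm_nonneg _
  have hn0 : 0 ≤ n := norm_nonneg _
  rw [← Real.sqrt_sq hn0, ← Real.sqrt_mul hc]
  refine Real.le_sqrt_of_sq_le ?_
  rcases hn0.eq_or_lt with h0 | h0
  -- If `‖η‖ = 0` the inequality is linear in `t`, and this value violates it unless `b = 0`.
  · have h1 := key ((c + 1) / 2 / b)
    rw [← h0] at h1 ⊢
    rcases hb.eq_or_lt with h2 | h2
    · rw [← h2]
      simp
    · field_simp at h1
      nlinarith
  · have h1 := key (b / n ^ 2)
    field_simp at h1
    nlinarith [sq_pos_of_pos h0]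

/-- A distribution that is bounded in `L²` extends to a bounded functional on `L²`. -/
theorem exists_functional_of_norm_le {u : 𝓢'(Config N, ℂ)} {C : ℝ}
    (h : ∀ η : 𝓢(Config N, ℂ), ‖u η‖ ≤ C * ‖η.toLp 2‖) :
    ∃ T : WaveFunction N →L[ℂ] ℂ, ∀ η : 𝓢(Config N, ℂ), T (η.toLp 2) = u η := by
  have hd : DenseRange (SchwartzMap.toLpCLM ℂ ℂ 2 (volume : Measure (Config N))).toLinearMap :=
    denseRange_toLp
  refine ⟨LinearMap.extendOfNorm (u : 𝓢(Config N, ℂ) →ₗ[ℂ] ℂ)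
    (SchwartzMap.toLpCLM ℂ ℂ 2 (volume : Measure (Config N))).toLinearMap, fun η => ?_⟩
  exact LinearMap.extendOfNorm_eq hd ⟨C, h⟩ η

/-- The Riesz representation theorem for distributions that are bounded in `L²`. -/
theorem eq_star_of_functional {u : 𝓢'(Config N, ℂ)} {T : WaveFunction N →L[ℂ] ℂ}
    (hT : ∀ η : 𝓢(Config N, ℂ), T (η.toLp 2) = u η) :
    u = (star ((InnerProductSpace.toDual ℂ (WaveFunction N)).symm T) : WaveFunction N) := by
  set g := (InnerProductSpace.toDual ℂ (WaveFunction N)).symm T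
  ext η
  have hg : T (η.toLp 2) = inner ℂ g (η.toLp 2) :=
    (InnerProductSpace.toDual_symm_apply (𝕜 := ℂ)).symm
  rw [Lp.toTemperedDistribution_apply, ← hT, hg, L2.inner_def]
  refine integral_congr_ae ?_
  filter_upwards [Lp.coeFn_star g, η.coeFn_toLp 2] with x hx hx'
  -- The inner product conjugates its first argument and the pairing of distributions does not,
  -- which is why the representative is the `star` of the Riesz vector.
  rw [hx, hx', RCLike.inner_apply]
  simp

theorem norm_star_waveFunction (g : WaveFunction N) : ‖(star g : WaveFunction N)‖ = ‖g‖ := by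
  rw [Lp.norm_def, Lp.norm_def]
  congr 1
  refine eLpNorm_congr_norm_ae ?_
  filter_upwards [Lp.coeFn_star g] with x hx
  rw [hx, Pi.star_apply, norm_star]

/-- The supremum of `∑ (2 Re u_k(η_k) - ‖η_k‖²)` is `∑ ‖u_k‖²`, attained at the Riesz vectors.
Treating all `k` together bounds the sum of the norms by a single `c`. -/
theorem sum_distL2NormSq_le {ι : Type*} [Fintype ι] {u : ι → 𝓢'(Config N, ℂ)} {c : ℝ}
    (h : ∀ η : ι → 𝓢(Config N, ℂ), ∑ k, (2 * (u k (η k)).re - ‖(η k).toLp 2‖ ^ 2) ≤ c) :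
    ∑ k, distL2NormSq (u k) ≤ ENNReal.ofReal c := by
  classical
  have h1 : ∀ k, ∃ T : WaveFunction N →L[ℂ] ℂ, ∀ η : 𝓢(Config N, ℂ), T (η.toLp 2) = u k η := by
    refine fun k => exists_functional_of_norm_le
      (norm_le_of_two_re_sub_sq_le (c := c) fun η => ?_)
    -- Testing with one nonzero component shows that each `u k` is bounded in `L²`.
    have := h (Pi.single k η)
    rw [Finset.sum_eq_single k] at this
    · simpa using this
    · intro l _ hl
      simp [hl, SchwartzMap.norm_toLp]
    · simp
  choose T hT using h1
  set g : ι → WaveFunction N := fun k => (InnerProductSpace.toDual ℂ (WaveFunction N)).symm (T k)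
    with hg
  have h2 : ∀ v : ι → WaveFunction N, ∑ k, (2 * (T k (v k)).re - ‖v k‖ ^ 2) ≤ c := by
    have hd : DenseRange fun (η : ι → 𝓢(Config N, ℂ)) k => ((η k).toLp 2 : WaveFunction N) :=
      DenseRange.piMap fun _ => denseRange_toLp
    intro v
    refine hd.induction_on (p := fun v => ∑ k, (2 * (T k (v k)).re - ‖v k‖ ^ 2) ≤ c) v
      (isClosed_le (by fun_prop) continuous_const) fun η => ?_
    simpa only [hT] using h η
  have h3 : ∑ k, ‖g k‖ ^ 2 ≤ c := by
    refine le_trans (le_of_eq (Finset.sum_congr rfl fun k _ => ?_)) (h2 g)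
    have : T k (g k) = (‖g k‖ ^ 2 : ℝ) := by
      rw [← InnerProductSpace.toDual_symm_apply (𝕜 := ℂ), inner_self_eq_norm_sq_to_K]
      simp [g]
    rw [this, Complex.ofReal_re]
    ring
  calc ∑ k, distL2NormSq (u k) ≤ ∑ k, ‖(star (g k) : WaveFunction N)‖ₑ ^ 2 :=
        Finset.sum_le_sum fun k _ => by
          unfold distL2NormSq
          exact iInf₂_le (star (g k)) (eq_star_of_functional (hT k))
    _ = ∑ k, ENNReal.ofReal (‖g k‖ ^ 2) := by
        refine Finset.sum_congr rfl fun k _ => ?_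
        rw [← ofReal_norm, norm_star_waveFunction, ENNReal.ofReal_pow (norm_nonneg _)]
    _ = ENNReal.ofReal (∑ k, ‖g k‖ ^ 2) :=
        (ENNReal.ofReal_sum_of_nonneg fun k _ => by positivity).symm
    _ ≤ ENNReal.ofReal c := ENNReal.ofReal_le_ofReal h3

end Duality

/-! ### Schwartz functions are dense in `H²` for the graph norm of the Laplacian. -/

section Approximation

variable {N : ℕ}

theorem tendsto_eLpNorm_two_zero {α : Type*} [MeasurableSpace α] {μ : Measure α} {F : ℕ → α → ℂ}
    {G : α → ℝ} (hF : ∀ n, AEStronglyMeasurable (F n) μ) (hG : MemLp G 2 μ)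
    (hb : ∀ n, ∀ᵐ x ∂μ, ‖F n x‖ ≤ G x) (hlim : ∀ᵐ x ∂μ, Tendsto (fun n => F n x) atTop (𝓝 0)) :
    Tendsto (fun n => eLpNorm (F n) 2 μ) atTop (𝓝 0) := by
  have hsq : ∀ f : α → ℂ, eLpNorm f 2 μ = (∫⁻ x, ‖f x‖ₑ ^ (2 : ℝ) ∂μ) ^ (1 / 2 : ℝ) := fun f => by
    have := eLpNorm_nnreal_pow_eq_lintegral (f := f) (μ := μ) (p := 2) two_ne_zero
    simp only [NNReal.coe_ofNat, ENNReal.coe_ofNat] at this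
    rw [← this, ← ENNReal.rpow_mul]
    norm_num
  have hGfin : ∫⁻ x, ‖G x‖ₑ ^ (2 : ℝ) ∂μ ≠ ⊤ := by
    have := eLpNorm_nnreal_pow_eq_lintegral (f := G) (μ := μ) (p := 2) two_ne_zero
    simp only [NNReal.coe_ofNat, ENNReal.coe_ofNat] at this
    rw [← this]
    exact ENNReal.rpow_ne_top_of_nonneg (by norm_num) hG.2.ne
  have h1 : Tendsto (fun n => ∫⁻ x, ‖F n x‖ₑ ^ (2 : ℝ) ∂μ) atTop (𝓝 (∫⁻ _, 0 ∂μ)) := by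
    refine tendsto_lintegral_of_dominated_convergence' (fun x => ‖G x‖ₑ ^ (2 : ℝ))
      (fun n => (hF n).enorm.pow_const _) (fun n => ?_) hGfin ?_
    · filter_upwards [hb n] with x hx
      gcongr
      exact enorm_le_iff_norm_le.2 (hx.trans (le_abs_self _))
    · filter_upwards [hlim] with x hx
      simpa using (hx.enorm).ennrpow_const 2
  simp only [hsq]
  simpa using h1.ennrpow_const (1 / 2)

open scoped BoundedContinuousFunction FourierTransform in
/-- Bounded Fourier multipliers are bounded on `L²`. -/
theorem exists_fourierMultiplier {g : Config N → ℂ} (hg : g.HasTemperateGrowth) {C : ℝ}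
    (hC : ∀ x, ‖g x‖ ≤ C) (v : WaveFunction N) :
    ∃ w : WaveFunction N, fourierMultiplierCLM ℂ g (v : 𝓢'(Config N, ℂ)) = w ∧
      ‖w‖ ≤ C * ‖v‖ := by
  have hC0 : 0 ≤ C := (norm_nonneg _).trans (hC 0)
  set g' : Config N →ᵇ ℂ := BoundedContinuousFunction.ofNormedAddCommGroup g hg.1.continuous C hC
  have hg' : MemLp g' ⊤ (volume : Measure (Config N)) := g'.memLp_top
  refine ⟨FourierTransformInv.fourierInv ((hg'.toLp _) • (FourierTransform.fourier v) :
    WaveFunction N), ?_, ?_⟩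
  · rw [fourierMultiplierCLM_apply, Lp.fourier_toTemperedDistribution_eq,
      ← Lp.fourierInv_toTemperedDistribution_eq,
      MeasureTheory.Lp.toTemperedDistribution_smul_eq (by apply hg)]
    rfl
  · have h1 : ‖(FourierTransformInv.fourierInv ((hg'.toLp _) • (FourierTransform.fourier v) :
        WaveFunction N) : WaveFunction N)‖ =
        ‖((hg'.toLp _) • (FourierTransform.fourier v) : WaveFunction N)‖ :=
      (Lp.fourierTransformₗᵢ (Config N) ℂ).symm.norm_map _
    rw [h1]
    refine (Lp.norm_smul_le _ _).trans ?_
    rw [Lp.norm_fourier_eq]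
    gcongr
    rw [Lp.norm_toLp]
    refine ENNReal.toReal_le_of_le_ofReal hC0 ?_
    rw [eLpNorm_exponent_top]
    exact eLpNormEssSup_le_of_ae_bound (ae_of_all _ hC)

/-- A Schwartz function as an element of `L²`. -/
def schwartzL2 (φ : 𝓢(Config N, ℂ)) : WaveFunction N := φ.toLp 2

theorem schwartzL2_toTemperedDistribution (φ : 𝓢(Config N, ℂ)) :
    (schwartzL2 φ : 𝓢'(Config N, ℂ)) = φ.toTemperedDistributionCLM (Config N) ℂ volume :=
  Lp.toTemperedDistribution_toLp_eq φ

theorem coeFn_schwartzL2 (φ : 𝓢(Config N, ℂ)) : schwartzL2 φ =ᵐ[volume] φ := φ.coeFn_toLp 2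

theorem norm_schwartzL2_multiplier_sub_le {g : Config N → ℂ} (hg : g.HasTemperateGrowth) {C : ℝ}
    (hC : ∀ x, ‖g x‖ ≤ C) {u ψ : WaveFunction N}
    (hψ : (ψ : 𝓢'(Config N, ℂ)) = fourierMultiplierCLM ℂ g (u : 𝓢'(Config N, ℂ)))
    (S : 𝓢(Config N, ℂ)) :
    ‖schwartzL2 (SchwartzMap.fourierMultiplierCLM ℂ g S) - ψ‖ ≤ C * ‖schwartzL2 S - u‖ := by
  obtain ⟨w, hw, hw'⟩ := exists_fourierMultiplier hg hC (schwartzL2 S - u)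
  have hsub : ∀ v w : WaveFunction N, ((v - w : WaveFunction N) : 𝓢'(Config N, ℂ)) =
      (v : 𝓢'(Config N, ℂ)) - (w : 𝓢'(Config N, ℂ)) := fun v w => by
    simp only [← Lp.toTemperedDistributionCLM_apply, map_sub]
  have : schwartzL2 (SchwartzMap.fourierMultiplierCLM ℂ g S) - ψ = w := by
    apply toTemperedDistribution_injective
    rw [← hw, hsub, hsub, map_sub, hψ, schwartzL2_toTemperedDistribution,
      schwartzL2_toTemperedDistribution, fourierMultiplierCLM_toTemperedDistributionCLM_eq hg]
  rwa [this]

/-- The symbol of `(1 - (2π)⁻² Δ)⁻¹`. -/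
def resolventSymbol (x : Config N) : ℂ := (((1 + ‖x‖ ^ 2) ^ (-2 / 2 : ℝ) : ℝ) : ℂ)

theorem hasTemperateGrowth_resolventSymbol : (resolventSymbol (N := N)).HasTemperateGrowth := by
  unfold resolventSymbol
  fun_prop

theorem resolventSymbol_eq (x : Config N) : resolventSymbol x = (((1 + ‖x‖ ^ 2)⁻¹ : ℝ) : ℂ) := by
  rw [resolventSymbol, ← Real.rpow_neg_one]
  norm_num

/-- The symbol of `Δ (1 - (2π)⁻² Δ)⁻¹`. -/
def laplacianResolventSymbol (x : Config N) : ℂ :=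
  ((-(2 * Real.pi) ^ 2 : ℝ) : ℂ) * (resolventSymbol x * ((‖x‖ ^ 2 : ℝ) : ℂ))

theorem hasTemperateGrowth_norm_sq :
    (fun x : Config N => ((‖x‖ ^ 2 : ℝ) : ℂ)).HasTemperateGrowth := by fun_prop

theorem hasTemperateGrowth_laplacianResolventSymbol :
    (laplacianResolventSymbol (N := N)).HasTemperateGrowth :=
  (Function.HasTemperateGrowth.const _).mul
    (hasTemperateGrowth_resolventSymbol.mul hasTemperateGrowth_norm_sq)

theorem norm_resolventSymbol_le (x : Config N) : ‖resolventSymbol x‖ ≤ 1 := by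
  rw [resolventSymbol_eq, Complex.norm_real, Real.norm_eq_abs, abs_of_nonneg (by positivity)]
  exact inv_le_one_of_one_le₀ (by nlinarith [sq_nonneg ‖x‖])

theorem norm_laplacianResolventSymbol_le (x : Config N) :
    ‖laplacianResolventSymbol x‖ ≤ (2 * Real.pi) ^ 2 := by
  rw [laplacianResolventSymbol, norm_mul, resolventSymbol_eq, ← Complex.ofReal_mul,
    Complex.norm_real, Complex.norm_real, norm_neg, Real.norm_of_nonneg (by positivity)]
  refine mul_le_of_le_one_right (by positivity) ?_
  rw [Real.norm_of_nonneg (by positivity), inv_mul_le_one₀ (by positivity)]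
  linarith

theorem laplacianResolventSymbol_eq_smul : laplacianResolventSymbol (N := N) =
    ((-(2 * Real.pi) ^ 2 : ℝ) : ℂ) • (resolventSymbol * fun x => ((‖x‖ ^ 2 : ℝ) : ℂ)) := rfl

theorem laplacian_resolvent (v : 𝓢'(Config N, ℂ)) :
    Δ (fourierMultiplierCLM ℂ resolventSymbol v) =
      fourierMultiplierCLM ℂ laplacianResolventSymbol v := by
  rw [laplacian_eq_fourierMultiplierCLM, fourierMultiplierCLM_fourierMultiplierCLM_apply
    hasTemperateGrowth_resolventSymbol hasTemperateGrowth_norm_sq,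
    laplacianResolventSymbol_eq_smul, fourierMultiplierCLM_smul
    (hasTemperateGrowth_resolventSymbol.mul hasTemperateGrowth_norm_sq),
    smul_apply]
  rfl

/-- `ψ` is the Bessel potential of some `u` in `L²`. If Schwartz functions `S n` tend to `u`, their
Bessel potentials tend to `ψ` and the Laplacians of these to `Δψ`, because both multipliers are
bounded. -/
theorem exists_schwartz_approximation {ψ : WaveFunction N}
    (h : MemSobolev 2 2 (ψ : 𝓢'(Config N, ℂ))) :
    ∃ φ : ℕ → 𝓢(Config N, ℂ), Tendsto (fun n => schwartzL2 (φ n)) atTop (𝓝 ψ) ∧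
      Tendsto (fun n => schwartzL2 (Δ (φ n))) atTop (𝓝 (laplacianL2 ψ h)) := by
  obtain ⟨u, hu⟩ := id h
  obtain ⟨S, hS⟩ : ∃ S : ℕ → 𝓢(Config N, ℂ),
      Tendsto (fun n => schwartzL2 (S n)) atTop (𝓝 u) := by
    obtain ⟨s, hs, hlim⟩ := mem_closure_iff_seq_limit.1 (denseRange_toLp u)
    choose S hS using hs
    exact ⟨S, by simpa only [schwartzL2, hS] using hlim⟩
  have hψ : (ψ : 𝓢'(Config N, ℂ)) =
      fourierMultiplierCLM ℂ resolventSymbol (u : 𝓢'(Config N, ℂ)) :=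
    ((besselPotential_neg_apply_eq_iff 2 (u : 𝓢'(Config N, ℂ)) (ψ : 𝓢'(Config N, ℂ))).2 hu).symm
  have hL : (laplacianL2 ψ h : 𝓢'(Config N, ℂ)) =
      fourierMultiplierCLM ℂ laplacianResolventSymbol (u : 𝓢'(Config N, ℂ)) := by
    rw [← laplacianL2_spec, hψ, laplacian_resolvent]
  have h0 : Tendsto (fun n => ‖schwartzL2 (S n) - u‖) atTop (𝓝 0) :=
    tendsto_iff_norm_sub_tendsto_zero.1 hS
  have hlap : ∀ n, schwartzL2 (Δ (SchwartzMap.fourierMultiplierCLM ℂ resolventSymbol (S n))) =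
      schwartzL2 (SchwartzMap.fourierMultiplierCLM ℂ laplacianResolventSymbol (S n)) := by
    intro n
    apply toTemperedDistribution_injective
    rw [schwartzL2_toTemperedDistribution, schwartzL2_toTemperedDistribution,
      ← laplacian_toTemperedDistributionCLM_eq,
      ← fourierMultiplierCLM_toTemperedDistributionCLM_eq hasTemperateGrowth_resolventSymbol,
      ← fourierMultiplierCLM_toTemperedDistributionCLM_eq
        hasTemperateGrowth_laplacianResolventSymbol, laplacian_resolvent]
  refine ⟨fun n => SchwartzMap.fourierMultiplierCLM ℂ resolventSymbol (S n), ?_, ?_⟩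
  · have h1 := h0.const_mul 1
    rw [mul_zero] at h1
    exact tendsto_iff_norm_sub_tendsto_zero.2 (squeeze_zero (fun _ => norm_nonneg _) (fun n =>
      norm_schwartzL2_multiplier_sub_le hasTemperateGrowth_resolventSymbol
        norm_resolventSymbol_le hψ (S n)) h1)
  · have h1 := h0.const_mul ((2 * Real.pi) ^ 2)
    rw [mul_zero] at h1
    refine tendsto_iff_norm_sub_tendsto_zero.2 (squeeze_zero (fun _ => norm_nonneg _) (fun n => ?_)
      h1)
    rw [hlap]
    exact norm_schwartzL2_multiplier_sub_le hasTemperateGrowth_laplacianResolventSymbol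
      norm_laplacianResolventSymbol_le hL (S n)

end Approximation

/-! ### Approximation by compactly supported smooth functions. -/

section Cutoff

variable {N : ℕ}

/-- The Laplacian of a smooth function on configuration space. -/
def configLaplacian (u : Config N → ℂ) (x : Config N) : ℂ := ∑ p, cpd p (cpd p u) x

theorem schwartz_laplacian_apply (φ : 𝓢(Config N, ℂ)) (x : Config N) :
    Δ φ x = configLaplacian φ x := by
  rw [SchwartzMap.laplacian_eq_sum (EuclideanSpace.basisFun (Fin N × Fin 3) ℝ)]
  simp only [EuclideanSpace.basisFun_apply]
  rw [sum_apply]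
  rfl

theorem cpd_comp_smul (u : Config N → ℂ) (c : ℝ) (p : Fin N × Fin 3) :
    cpd p (fun x => u (c • x)) = fun x => (c : ℂ) * cpd p u (c • x) := by
  funext x
  simp only [cpd, pd]
  rw [fderiv_comp_smul]
  simp

theorem cpd_cpd_mul {u w : Config N → ℂ} (hu : ContDiff ℝ ∞ u) (hw : ContDiff ℝ ∞ w)
    (p : Fin N × Fin 3) (x : Config N) : cpd p (cpd p fun x => u x * w x) x =
      cpd p (cpd p u) x * w x + 2 * (cpd p u x * cpd p w x) + u x * cpd p (cpd p w) x := by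
  have hu' := contDiff_cpd hu p
  have hw' := contDiff_cpd hw p
  have h1 : cpd p (fun x => u x * w x) = fun x => cpd p u x * w x + u x * cpd p w x :=
    pd_mul hu hw _
  have h2 : cpd p (fun x => cpd p u x * w x + u x * cpd p w x) = fun x =>
      cpd p (fun x => cpd p u x * w x) x + cpd p (fun x => u x * cpd p w x) x :=
    pd_add (hu'.mul hw) (hu.mul hw') _
  have h3 : cpd p (fun x => cpd p u x * w x) = fun x =>
    cpd p (cpd p u) x * w x + cpd p u x * cpd p w x := pd_mul hu' hw _
  have h4 : cpd p (fun x => u x * cpd p w x) = fun x =>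
    cpd p u x * cpd p w x + u x * cpd p (cpd p w) x := pd_mul hu hw' _
  rw [h1, h2, h3, h4]
  ring

/-- Multiply by `θ(x / (n + 1))`: each derivative falling on `θ` brings a factor `1 / (n + 1)`, and
dominated convergence handles the rest. -/
theorem exists_compact_approximation (φ : 𝓢(Config N, ℂ)) :
    ∃ χ : ℕ → Config N → ℂ, (∀ n, ContDiff ℝ ∞ (χ n)) ∧ (∀ n, HasCompactSupport (χ n)) ∧
      Tendsto (fun n => eLpNorm (fun x => χ n x - φ x) 2 volume) atTop (𝓝 0) ∧
      Tendsto (fun n => eLpNorm (fun x => configLaplacian (χ n) x - Δ φ x) 2 volume) atTop (𝓝 0) := by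
  set b : ContDiffBump (0 : Config N) := ⟨1, 2, one_pos, one_lt_two⟩
  set θ : Config N → ℂ := fun x => ((b x : ℝ) : ℂ)
  have hθ : ContDiff ℝ ∞ θ := contDiff_ofReal b.contDiff
  have hθc : HasCompactSupport θ := b.hasCompactSupport.comp_left (g := fun r : ℝ => (r : ℂ)) rfl
  have hθ1 : ∀ x, ‖θ x - 1‖ ≤ 1 := fun x => by
    have h1 := b.nonneg (x := x)
    have h2 := b.le_one (x := x)
    simp only [θ]
    rw [← Complex.ofReal_one, ← Complex.ofReal_sub, Complex.norm_real, Real.norm_eq_abs, abs_le]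
    constructor <;> linarith
  set a : ℕ → ℝ := fun n => ((n : ℝ) + 1)⁻¹
  have ha : Tendsto a atTop (𝓝 0) := by
    simpa [a, one_div] using tendsto_one_div_add_atTop_nhds_zero_nat (𝕜 := ℝ)
  have ha0 : ∀ n, 0 < a n := fun n => by positivity
  have ha1 : ∀ n, a n ≤ 1 := fun n =>
    inv_le_one_of_one_le₀ (by linarith [n.cast_nonneg (α := ℝ)])
  have hsm : ∀ n, ContDiff ℝ ∞ (fun x : Config N => a n • x) := fun n => contDiff_const_smul _
  have hθn : ∀ n, ContDiff ℝ ∞ (fun x => θ (a n • x)) := fun n => hθ.comp (hsm n)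
  have hφ : ContDiff ℝ ∞ φ := φ.smooth'
  have hlim1 : ∀ x, ∀ᶠ n in atTop, θ (a n • x) = 1 := fun x => by
    have h1 : Tendsto (fun n => a n * ‖x‖) atTop (𝓝 0) := by simpa using ha.mul_const ‖x‖
    filter_upwards [h1.eventually_le_const one_pos] with n hn
    have : b (a n • x) = 1 := b.one_of_mem_closedBall (by
      rw [Metric.mem_closedBall, dist_zero_right, norm_smul, Real.norm_of_nonneg (ha0 n).le]
      exact hn)
    simp [θ, this]
  choose C₁ hC₁ using fun p => (hasCompactSupport_cpd hθc p).exists_bound_of_continuous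
    (contDiff_cpd hθ p).continuous
  choose C₂ hC₂ using fun p =>
    (hasCompactSupport_cpd (hasCompactSupport_cpd hθc p) p).exists_bound_of_continuous
      (contDiff_cpd (contDiff_cpd hθ p) p).continuous
  refine ⟨fun n x => θ (a n • x) * φ x, fun n => (hθn n).mul hφ, fun n => ?_, ?_, ?_⟩
  · exact (hθc.comp_smul (ha0 n).ne').mul_right
  · refine tendsto_eLpNorm_two_zero (G := fun x => ‖φ x‖) (fun n => ?_) (φ.memLp 2).norm
      (fun n => ae_of_all _ fun x => ?_) (ae_of_all _ fun x => ?_)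
    · exact (((hθn n).mul hφ).continuous.sub hφ.continuous).aestronglyMeasurable
    · rw [← sub_one_mul, norm_mul]
      exact mul_le_of_le_one_left (norm_nonneg _) (hθ1 _)
    · refine tendsto_const_nhds.congr' ?_
      filter_upwards [hlim1 x] with n hn
      simp [hn]
  · have hval : ∀ n x, configLaplacian (fun x => θ (a n • x) * φ x) x - Δ φ x =
        ∑ p, (((a n : ℂ) * ((a n : ℂ) * cpd p (cpd p θ) (a n • x))) * φ x +
          2 * (((a n : ℂ) * cpd p θ (a n • x)) * cpd p φ x) +
          (θ (a n • x) - 1) * cpd p (cpd p φ) x) := by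
      intro n x
      rw [schwartz_laplacian_apply, configLaplacian, configLaplacian,
        ← Finset.sum_sub_distrib]
      refine Finset.sum_congr rfl fun p _ => ?_
      have h1 := cpd_comp_smul θ (a n) p
      have h2 : cpd p (fun x => (a n : ℂ) * cpd p θ (a n • x)) = fun x =>
          (a n : ℂ) * cpd p (fun x => cpd p θ (a n • x)) x :=
        pd_const_mul ((contDiff_cpd hθ p).comp (hsm n)) _ _
      rw [cpd_cpd_mul (hθn n) hφ, h1, h2, cpd_comp_smul]
      ring
    refine tendsto_eLpNorm_two_zero (G := fun x => ∑ p, (C₂ p * ‖φ x‖ +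
      2 * (C₁ p * ‖cpd p φ x‖) + ‖cpd p (cpd p φ) x‖)) (fun n => ?_) ?_
      (fun n => ae_of_all _ fun x => ?_) (ae_of_all _ fun x => ?_)
    · refine Continuous.aestronglyMeasurable ?_
      refine Continuous.sub ?_ (Δ φ).continuous
      exact continuous_finsetSum _ fun p _ =>
        (contDiff_cpd (contDiff_cpd ((hθn n).mul hφ) p) p).continuous
    · refine memLp_finsetSum _ fun p _ => ?_
      have h1 : MemLp (fun x => ‖cpd p φ x‖) 2 volume :=
        ((∂_{(EuclideanSpace.single p 1 : Config N)} φ).memLp 2 volume).norm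
      have h2 : MemLp (fun x => ‖cpd p (cpd p φ) x‖) 2 volume :=
        ((∂_{(EuclideanSpace.single p 1 : Config N)}
          (∂_{(EuclideanSpace.single p 1 : Config N)} φ)).memLp 2 volume).norm
      exact (((φ.memLp 2).norm.const_mul _).add ((h1.const_mul _).const_mul _)).add h2
    · rw [hval]
      refine (norm_sum_le _ _).trans (Finset.sum_le_sum fun p _ => ?_)
      refine (norm_add₃_le).trans ?_
      have hn : ‖(a n : ℂ)‖ ≤ 1 := by
        rw [Complex.norm_real, Real.norm_of_nonneg (ha0 n).le]
        exact ha1 n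
      simp only [norm_mul, Complex.norm_ofNat]
      have h1 := hC₁ p (a n • x)
      have h2 := hC₂ p (a n • x)
      have h3 := hθ1 (a n • x)
      have h4 := norm_nonneg (cpd p θ (a n • x))
      have h5 := norm_nonneg (cpd p (cpd p θ) (a n • x))
      have h6 := norm_nonneg (a n : ℂ)
      gcongr
      · calc ‖(a n : ℂ)‖ * (‖(a n : ℂ)‖ * ‖cpd p (cpd p θ) (a n • x)‖) ≤ 1 * (1 * C₂ p) := by
              gcongr
          _ = C₂ p := by ring
      · calc ‖(a n : ℂ)‖ * ‖cpd p θ (a n • x)‖ ≤ 1 * C₁ p := by gcongr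
          _ = C₁ p := by ring
      · exact mul_le_of_le_one_left (norm_nonneg _) h3
    · simp only [hval]
      have hz : (0 : ℂ) = ∑ _p : Fin N × Fin 3, 0 := Finset.sum_const_zero.symm
      refine Tendsto.mono_right (tendsto_finsetSum _ fun p _ => ?_) (le_of_eq (congrArg 𝓝 hz.symm))
      have hac : Tendsto (fun n => (a n : ℂ)) atTop (𝓝 0) := by
        exact_mod_cast (Complex.continuous_ofReal.tendsto 0).comp ha
      have hy : Tendsto (fun n => a n • x) atTop (𝓝 0) := by simpa using ha.smul_const x
      have h1 := ((contDiff_cpd hθ p).continuous.tendsto 0).comp hy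
      have h2 := ((contDiff_cpd (contDiff_cpd hθ p) p).continuous.tendsto 0).comp hy
      have h3 := (hθ.continuous.tendsto 0).comp hy
      have h4 : θ 0 = 1 := by
        have : b 0 = 1 := b.one_of_mem_closedBall (by simp [b])
        simp [θ, this]
      rw [h4] at h3
      have h5 := (((hac.mul (hac.mul h2)).mul_const (φ x)).add
        (((hac.mul h1).mul_const (cpd p φ x)).const_mul 2)).add
        ((h3.sub_const 1).mul_const (cpd p (cpd p φ) x))
      simpa using h5

theorem exists_smooth_approximation {ψ : WaveFunction N}
    (h : MemSobolev 2 2 (ψ : 𝓢'(Config N, ℂ))) :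
    ∃ χ : ℕ → Config N → ℂ, (∀ n, ContDiff ℝ ∞ (χ n)) ∧ (∀ n, HasCompactSupport (χ n)) ∧
      Tendsto (fun n => eLpNorm (fun x => χ n x - ψ x) 2 volume) atTop (𝓝 0) ∧
      Tendsto (fun n => eLpNorm (fun x => configLaplacian (χ n) x - laplacianL2 ψ h x) 2 volume)
        atTop (𝓝 0) := by
  obtain ⟨φ, hφ, hφ'⟩ := exists_schwartz_approximation h
  have key : ∀ n : ℕ, ∃ χ : Config N → ℂ, ContDiff ℝ ∞ χ ∧ HasCompactSupport χ ∧
      eLpNorm (fun x => χ x - φ n x) 2 volume ≤ ENNReal.ofReal (1 / (n + 1)) ∧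
      eLpNorm (fun x => configLaplacian χ x - Δ (φ n) x) 2 volume ≤ ENNReal.ofReal (1 / (n + 1)) := by
    intro n
    obtain ⟨χ, h1, h2, h3, h4⟩ := exists_compact_approximation (φ n)
    have hpos : 0 < ENNReal.ofReal (1 / ((n : ℝ) + 1)) := by
      rw [ENNReal.ofReal_pos]
      positivity
    obtain ⟨m, hm, hm'⟩ := ((h3.eventually_le_const hpos).and (h4.eventually_le_const hpos)).exists
    exact ⟨χ m, h1 m, h2 m, hm, hm'⟩
  choose χ h1 h2 h3 h4 using key
  have hr : Tendsto (fun n : ℕ => ENNReal.ofReal (1 / ((n : ℝ) + 1))) atTop (𝓝 0) := by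
    simpa using ENNReal.tendsto_ofReal (tendsto_one_div_add_atTop_nhds_zero_nat (𝕜 := ℝ))
  have hL : ∀ (s : 𝓢(Config N, ℂ)) (v : WaveFunction N),
      eLpNorm (fun x => s x - v x) 2 volume = ‖schwartzL2 s - v‖ₑ := by
    intro s v
    rw [Lp.enorm_def]
    refine eLpNorm_congr_ae ?_
    filter_upwards [Lp.coeFn_sub (schwartzL2 s) v, coeFn_schwartzL2 s] with x hx hx'
    rw [hx, Pi.sub_apply, hx']
  have tri : ∀ (w : Config N → ℂ) (s : 𝓢(Config N, ℂ)) (v : WaveFunction N), Continuous w →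
      eLpNorm (fun x => w x - v x) 2 volume ≤ eLpNorm (fun x => w x - s x) 2 volume + ‖schwartzL2 s - v‖ₑ := by
    intro w s v hw
    have e : (fun x => w x - v x) = (fun x => w x - s x) + fun x => s x - v x := by
      funext x
      simp
    rw [← hL, e]
    exact eLpNorm_add_le (hw.sub s.continuous).aestronglyMeasurable
      (s.continuous.aestronglyMeasurable.sub (Lp.aestronglyMeasurable v)) one_le_two
  have e1 : Tendsto (fun n => ‖schwartzL2 (φ n) - ψ‖ₑ) atTop (𝓝 0) := by
    simpa using (hφ.sub_const ψ).enorm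
  have e2 : Tendsto (fun n => ‖schwartzL2 (Δ (φ n)) - laplacianL2 ψ h‖ₑ) atTop (𝓝 0) := by
    simpa using (hφ'.sub_const (laplacianL2 ψ h)).enorm
  refine ⟨χ, h1, h2, ?_, ?_⟩
  · refine tendsto_of_tendsto_of_tendsto_of_le_of_le tendsto_const_nhds
      ((hr.add e1).mono_right (by rw [add_zero])) (fun n => zero_le) fun n =>
      (tri _ (φ n) _ (h1 n).continuous).trans (add_le_add_left (h3 n) _)
  · refine tendsto_of_tendsto_of_tendsto_of_le_of_le tendsto_const_nhds
      ((hr.add e2).mono_right (by rw [add_zero])) (fun n => zero_le) fun n =>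
      (tri _ (Δ (φ n)) _ ?_).trans (add_le_add_left (h4 n) _)
    exact continuous_finsetSum _ fun p _ => (contDiff_cpd (contDiff_cpd (h1 n) p) p).continuous

end Cutoff

/-! ### Limits of norms and pairings in `L²`. -/

section Limits

variable {N : ℕ}

theorem integral_norm_sq_eq_eLpNorm {α : Type*} [MeasurableSpace α] {μ : Measure α} {F : α → ℂ}
    (hF : MemLp F 2 μ) : ∫ x, ‖F x‖ ^ 2 ∂μ = (eLpNorm F 2 μ).toReal ^ 2 := by
  rw [hF.eLpNorm_eq_integral_rpow_norm two_ne_zero ENNReal.ofNat_ne_top, ENNReal.toReal_ofReal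
    (by positivity)]
  simp only [ENNReal.toReal_ofNat, Real.rpow_ofNat]
  have : 0 ≤ ∫ x, ‖F x‖ ^ 2 ∂μ := integral_nonneg fun x => by positivity
  rw [← Real.rpow_natCast, ← Real.rpow_mul this]
  norm_num

theorem tendsto_integral_norm_sq {α : Type*} [MeasurableSpace α] {μ : Measure α} {F : ℕ → α → ℂ}
    (hF : ∀ n, MemLp (F n) 2 μ) {v : Lp ℂ 2 μ}
    (h : Tendsto (fun n => eLpNorm (fun x => F n x - v x) 2 μ) atTop (𝓝 0)) :
    Tendsto (fun n => ∫ x, ‖F n x‖ ^ 2 ∂μ) atTop (𝓝 (‖v‖ ^ 2)) := by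
  have h1 : Tendsto (fun n => (hF n).toLp (F n)) atTop (𝓝 v) := by
    rw [tendsto_iff_edist_tendsto_0]
    refine h.congr fun n => ?_
    rw [Lp.edist_def]
    refine eLpNorm_congr_ae ?_
    filter_upwards [(hF n).coeFn_toLp] with x hx
    rw [Pi.sub_apply, hx]
  refine (h1.norm.pow 2).congr fun n => ?_
  rw [integral_norm_sq_eq_eLpNorm (hF n), Lp.norm_toLp]

theorem tendsto_integral_mul {α : Type*} [MeasurableSpace α] {μ : Measure α} {F : ℕ → α → ℂ}
    {v w : α → ℂ} (hF : ∀ n, MemLp (F n) 2 μ) (hv : MemLp v 2 μ) (hw : MemLp w 2 μ)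
    (h : Tendsto (fun n => eLpNorm (fun x => F n x - v x) 2 μ) atTop (𝓝 0)) :
    Tendsto (fun n => ∫ x, F n x * w x ∂μ) atTop (𝓝 (∫ x, v x * w x ∂μ)) := by
  refine tendsto_integral_of_L1' _ (hv.integrable_mul hw).aestronglyMeasurable
    (Eventually.of_forall fun n => (hF n).integrable_mul hw) ?_
  have h1 := ENNReal.Tendsto.mul_const (b := eLpNorm w 2 μ) h (Or.inr hw.2.ne)
  rw [zero_mul] at h1
  refine tendsto_of_tendsto_of_tendsto_of_le_of_le tendsto_const_nhds h1 (fun n => zero_le)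
    fun n => ?_
  have := eLpNorm_smul_le_mul_eLpNorm (p := 2) (q := 2) (r := 1) hw.1
    ((hF n).1.sub hv.1)
  refine le_trans (le_of_eq ?_) this
  congr 1
  funext x
  simp [sub_mul]

end Limits

/-! ### Permutations of the particles. -/

section Permutation

variable {N : ℕ}

/-- The permutation of the particles as an isometry. -/
def permuteEquiv (σ : Equiv.Perm (Fin N)) : Config N ≃ₗᵢ[ℝ] Config N :=
  LinearIsometryEquiv.piLpCongrLeft 2 ℝ ℝ (Equiv.prodCongr σ.symm (Equiv.refl (Fin 3)))

theorem permuteEquiv_apply (σ : Equiv.Perm (Fin N)) (x : Config N) :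
    permuteEquiv σ x = permute σ x := by
  ext p
  rfl

theorem measurePreserving_permute (σ : Equiv.Perm (Fin N)) :
    MeasurePreserving (permute σ : Config N → Config N) volume volume := by
  have h := (permuteEquiv σ).measurePreserving
  rwa [show (permuteEquiv σ : Config N → Config N) = permute σ from
    funext (permuteEquiv_apply σ)] at h

theorem integral_comp_permute (σ : Equiv.Perm (Fin N)) (g : Config N → ℂ) :
    ∫ x, g (permute σ x) = ∫ x, g x := by
  have h := (permuteEquiv σ).measurePreserving.integral_comp
    (permuteEquiv σ).toHomeomorph.measurableEmbedding g
  simpa only [permuteEquiv_apply] using h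

theorem contDiff_comp_permute {η : Config N → ℂ} (hη : ContDiff ℝ ∞ η) (σ : Equiv.Perm (Fin N)) :
    ContDiff ℝ ∞ (fun x => η (permute σ x)) := by
  have h := hη.comp (permuteEquiv σ).contDiff
  exact h

theorem cpd_comp_permute {η : Config N → ℂ} (hη : ContDiff ℝ ∞ η) (σ : Equiv.Perm (Fin N))
    (k : Fin N) (a : Fin 3) :
    cpd (σ k, a) (fun x => η (permute σ x)) = fun x => cpd (k, a) η (permute σ x) := by
  funext x
  have h1 : permute σ (EuclideanSpace.single (σ k, a) (1 : ℝ)) =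
      EuclideanSpace.single (k, a) (1 : ℝ) := by
    ext ⟨l, c⟩
    simp [permute, Prod.ext_iff]
  have h2 : HasFDerivAt (fun x => η (permute σ x))
      ((fderiv ℝ η (permute σ x)).comp
        ((permuteEquiv σ).toContinuousLinearEquiv : Config N →L[ℝ] Config N)) x := by
    have h3 := (hη.differentiable (by simp) (permute σ x)).hasFDerivAt
    exact HasFDerivAt.comp x h3 (permuteEquiv σ).toContinuousLinearEquiv.hasFDerivAt
  rw [cpd, pd, h2.fderiv, cpd, pd, ← h1]
  rfl

end Permutation

/-! ### Mixed derivatives tested against smooth functions. -/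

section PairDerivatives

variable {N : ℕ}

theorem integral_cpd_cpd_mul {u s : Config N → ℂ} (hu : ContDiff ℝ ∞ u) (hc : HasCompactSupport u)
    (hs : ContDiff ℝ ∞ s) (p q : Fin N × Fin 3) :
    ∫ x, cpd p (cpd q u) x * s x = ∫ x, u x * cpd q (cpd p s) x := by
  have h1 : ∫ x, u x * cpd q (cpd p s) x = -∫ x, cpd q u x * cpd p s x :=
    integral_mul_pd hu (contDiff_cpd hs p) hc _
  have h2 : ∫ x, cpd q u x * cpd p s x = -∫ x, cpd p (cpd q u) x * s x :=
    integral_mul_pd (contDiff_cpd hu q) hs (hasCompactSupport_cpd hc q) _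
  rw [h1, h2, neg_neg]

/-- Move both derivatives to `u` and use `2 Re (z w) ≤ |z|² + |w|²`. The left side has no
derivatives of `u`, so it survives a limit in which `u` converges only in `L²`. -/
theorem two_re_integral_sub_le {u s : Config N → ℂ} (hu : ContDiff ℝ ∞ u)
    (hc : HasCompactSupport u) (hs : ContDiff ℝ ∞ s) (hs2 : MemLp s 2 volume)
    (p q : Fin N × Fin 3) :
    2 * (∫ x, u x * cpd q (cpd p s) x).re - ∫ x, ‖s x‖ ^ 2 ≤
      ∫ x, ‖cpd p (cpd q u) x‖ ^ 2 := by
  have hg : ContDiff ℝ ∞ (cpd p (cpd q u)) := contDiff_cpd (contDiff_cpd hu q) p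
  have hgc := hasCompactSupport_cpd (hasCompactSupport_cpd hc q) p
  have i1 : Integrable (fun x => cpd p (cpd q u) x * s x) :=
    integrable_of_smooth (hg.mul hs) hgc.mul_right
  have i2 : Integrable (fun x => ‖s x‖ ^ 2) := (memLp_two_iff_integrable_sq_norm hs2.1).1 hs2
  have i3 : Integrable (fun x => ‖cpd p (cpd q u) x‖ ^ 2) := integrable_norm_sq hg hgc
  have hre : (∫ x, cpd p (cpd q u) x * s x).re = ∫ x, (cpd p (cpd q u) x * s x).re :=
    (integral_re i1).symm
  rw [← integral_cpd_cpd_mul hu hc hs, hre, ← integral_const_mul, sub_le_iff_le_add,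
    ← integral_add i3 i2]
  refine integral_mono (i1.re.const_mul 2) (i3.add i2) fun x => ?_
  have h1 := Complex.re_le_norm (cpd p (cpd q u) x * s x)
  rw [norm_mul] at h1
  simp only
  nlinarith [sq_nonneg (‖cpd p (cpd q u) x‖ - ‖s x‖)]

theorem mixed_derivative_apply (p q : Fin N × Fin 3) (φ : WaveFunction N) (η : 𝓢(Config N, ℂ)) :
    (∂_{(EuclideanSpace.single p 1 : Config N)}
      (∂_{(EuclideanSpace.single q 1 : Config N)} (φ : 𝓢'(Config N, ℂ)))) η =
      ∫ x, φ x * cpd q (cpd p η) x := by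
  rw [TemperedDistribution.lineDerivOp_apply_apply, TemperedDistribution.lineDerivOp_apply_apply,
    LineDeriv.lineDerivOp_neg, neg_neg, Lp.toTemperedDistribution_apply]
  refine integral_congr_ae (ae_of_all _ fun x => ?_)
  simp only [smul_eq_mul]
  rw [mul_comm]
  rfl

end PairDerivatives

/-! ### Convergence of the approximate energies to `‖H_N ψ‖²`. -/

section HamiltonianLimit

variable {N : ℕ}

/-- Convergence of the interacting part of the Hamiltonian along a sequence of wave functions. -/
theorem tendsto_eLpNorm_mul_sub {U : ℕ → Config N → ℂ} {χ : ℕ → Config N → ℂ} {W : Config N → ℂ}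
    {ψ : WaveFunction N} {C : ℝ} (hU : ∀ n, Continuous (U n)) (hχ : ∀ n, Continuous (χ n))
    (hW : Measurable W) (hUC : ∀ n x, ‖U n x‖ ≤ C) (hWC : ∀ᵐ x, ‖W x‖ ≤ C)
    (hlim : ∀ᵐ x, Tendsto (fun n => U n x) atTop (𝓝 (W x)))
    (h : Tendsto (fun n => eLpNorm (fun x => χ n x - ψ x) 2 volume) atTop (𝓝 0)) :
    Tendsto (fun n => eLpNorm (fun x => U n x * χ n x - W x * ψ x) 2 volume) atTop (𝓝 0) := by
  have hψ := (Lp.memLp ψ)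
  have h1 : Tendsto (fun n => eLpNorm (fun x => (U n x - W x) * ψ x) 2 volume) atTop (𝓝 0) := by
    refine tendsto_eLpNorm_two_zero (G := fun x => (2 * C) * ‖ψ x‖) (fun n => ?_)
      (hψ.norm.const_mul _) (fun n => ?_) ?_
    · exact ((hU n).aestronglyMeasurable.sub hW.aestronglyMeasurable).mul hψ.1
    · filter_upwards [hWC] with x hx
      rw [norm_mul]
      have := norm_sub_le (U n x) (W x)
      have := hUC n x
      gcongr
      linarith
    · filter_upwards [hlim] with x hx
      simpa using (hx.sub_const (W x)).mul_const (ψ x)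
  have h2 : Tendsto (fun n => ENNReal.ofReal C * eLpNorm (fun x => χ n x - ψ x) 2 volume) atTop
      (𝓝 0) := by
    simpa using ENNReal.Tendsto.const_mul h (Or.inr ENNReal.ofReal_ne_top)
  refine tendsto_of_tendsto_of_tendsto_of_le_of_le tendsto_const_nhds
    ((h2.add h1).mono_right (by rw [add_zero])) (fun n => zero_le) fun n => ?_
  -- The first part is small by the uniform bound on `U n`, the second by dominated convergence for
  -- the fixed function `ψ`.
  have e : (fun x => U n x * χ n x - W x * ψ x) =
      (fun x => U n x * (χ n x - ψ x)) + fun x => (U n x - W x) * ψ x := by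
    funext x
    simp only [Pi.add_apply]
    ring
  rw [e]
  refine (eLpNorm_add_le ?_ ?_ one_le_two).trans (add_le_add_left ?_ _)
  · exact (hU n).aestronglyMeasurable.mul ((hχ n).aestronglyMeasurable.sub hψ.1)
  · exact ((hU n).aestronglyMeasurable.sub hW.aestronglyMeasurable).mul hψ.1
  · refine eLpNorm_le_mul_eLpNorm_of_ae_le_mul (ae_of_all _ fun x => ?_) 2
    rw [norm_mul]
    exact mul_le_mul_of_nonneg_right (hUC n x) (norm_nonneg _)

theorem measurable_position (i : Fin N) : Measurable (fun x : Config N => position x i) := by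
  have : Continuous (fun x : Config N => position x i) := by
    unfold position
    fun_prop
  exact this.measurable

theorem measurable_interaction {V : Space3 → ℝ} (hV : Measurable V) :
    Measurable (interaction V N) := by
  unfold interaction
  refine Finset.measurable_sum _ fun i _ => Finset.measurable_sum _ fun j _ => ?_
  exact (hV.comp (((measurable_position i).sub (measurable_position j)).const_smul (N : ℝ))).const_mul _

/-- The `L²` norm of the smooth approximations of `H ψ`. -/
theorem tendsto_integral_norm_sq_sum_particleOp {V : Space3 → ℝ} (hV : Measurable V)
    {ψ : WaveFunction N} (hψ : ψ ∈ (hamiltonian V N).domain) {χ : ℕ → Config N → ℂ}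
    (hχ : ∀ n, ContDiff ℝ ∞ (χ n)) (hχc : ∀ n, HasCompactSupport (χ n))
    (h : Tendsto (fun n => eLpNorm (fun x => χ n x - ψ x) 2 volume) atTop (𝓝 0))
    (hΔ : Tendsto (fun n => eLpNorm (fun x => configLaplacian (χ n) x - laplacianL2 ψ hψ.1 x) 2
      volume) atTop (𝓝 0))
    {v : ℕ → ℝ → ℝ} (hv : ∀ n, ContDiff ℝ ∞ (v n)) {B : ℝ} (hB : ∀ n q, |v n q| ≤ B)
    (hlim : ∀ i j : Fin N, i ≠ j → ∀ᵐ x : Config N, Tendsto (fun n => v n (sqDist i j x)) atTop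
      (𝓝 ((N : ℝ) ^ 2 * V ((N : ℝ) • (position x i - position x j))))) :
    Tendsto (fun n => ∫ x, ‖∑ i, particleOp (v n) i (χ n) x‖ ^ 2) atTop
      (𝓝 (‖hamiltonian V N ⟨ψ, hψ⟩‖ ^ 2)) := by
  set U : ℕ → Config N → ℂ := fun n x => ∑ i, ∑ j ∈ Finset.Ioi i, pairFun (v n) i j x
  have hUs : ∀ n, ContDiff ℝ ∞ (U n) := fun n =>
    ContDiff.sum fun i _ => ContDiff.sum fun j _ => contDiff_pairFun (hv n) i j
  set C : ℝ := ∑ i : Fin N, ∑ _j ∈ Finset.Ioi i, B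
  have hUC : ∀ n x, ‖U n x‖ ≤ C := fun n x =>
    (norm_sum_le _ _).trans (Finset.sum_le_sum fun i _ => (norm_sum_le _ _).trans
      (Finset.sum_le_sum fun j _ => by
        rw [pairFun, Complex.norm_real]
        exact hB _ _))
  have hUlim : ∀ᵐ x, Tendsto (fun n => U n x) atTop (𝓝 ((interaction V N x : ℝ) : ℂ)) := by
    have h1 : ∀ᵐ x : Config N, ∀ i j : Fin N, i ≠ j → Tendsto (fun n => v n (sqDist i j x)) atTop
        (𝓝 ((N : ℝ) ^ 2 * V ((N : ℝ) • (position x i - position x j)))) := by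
      rw [ae_all_iff]
      intro i
      rw [ae_all_iff]
      intro j
      by_cases hij : i = j
      · exact ae_of_all _ fun x hne => absurd hij hne
      · filter_upwards [hlim i j hij] with x hx _ using hx
    filter_upwards [h1] with x hx
    have h2 : Tendsto (fun n => ∑ i, ∑ j ∈ Finset.Ioi i, v n (sqDist i j x)) atTop
        (𝓝 (interaction V N x)) :=
      tendsto_finsetSum _ fun i _ => tendsto_finsetSum _ fun j hj =>
        hx i j (Finset.mem_Ioi.1 hj).ne
    have h3 := (Complex.continuous_ofReal.tendsto _).comp h2
    refine h3.congr fun n => ?_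
    simp [U, pairFun]
  have hWC : ∀ᵐ x, ‖((interaction V N x : ℝ) : ℂ)‖ ≤ C := by
    filter_upwards [hUlim] with x hx
    exact le_of_tendsto hx.norm (Eventually.of_forall fun n => hUC n x)
  have hW : Measurable fun x => ((interaction V N x : ℝ) : ℂ) :=
    Complex.measurable_ofReal.comp (measurable_interaction hV)
  have h1 := tendsto_eLpNorm_mul_sub (fun n => (hUs n).continuous) (fun n => (hχ n).continuous)
    hW hUC hWC hUlim h
  have hcl : ∀ n, ContDiff ℝ ∞ (configLaplacian (χ n)) := fun n =>
    ContDiff.sum fun p _ => contDiff_cpd (contDiff_cpd (hχ n) p) p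
  have hval : ∀ n x, ∑ i, particleOp (v n) i (χ n) x =
      -configLaplacian (χ n) x + U n x * χ n x := fun n x => sum_particleOp _ _ _
  have hH : hamiltonian V N ⟨ψ, hψ⟩ =ᵐ[volume] fun x =>
      -laplacianL2 ψ hψ.1 x + (interaction V N x : ℂ) * ψ x := by
    have e : hamiltonian V N ⟨ψ, hψ⟩ = -laplacianL2 ψ hψ.1 + MemLp.toLp _ hψ.2 := rfl
    rw [e]
    filter_upwards [Lp.coeFn_add (-laplacianL2 ψ hψ.1) (MemLp.toLp _ hψ.2),
      Lp.coeFn_neg (laplacianL2 ψ hψ.1), MemLp.coeFn_toLp hψ.2] with x h1 h2 h3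
    rw [h1, Pi.add_apply, h2, Pi.neg_apply, h3]
  refine tendsto_integral_norm_sq (fun n => ?_) ?_
  · refine Continuous.memLp_of_hasCompactSupport ?_ ?_
    · simp only [hval]
      exact (hcl n).continuous.neg.add ((hUs n).continuous.mul (hχ n).continuous)
    · simp only [hval]
      refine HasCompactSupport.add (HasCompactSupport.neg ?_) (hχc n).mul_left
      have hs : HasCompactSupport (∑ p, cpd p (cpd p (χ n))) :=
        Finset.sum_induction _ HasCompactSupport (fun _ _ => HasCompactSupport.add)
          HasCompactSupport.zero fun p _ => hasCompactSupport_cpd (hasCompactSupport_cpd (hχc n) p) p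
      have e : configLaplacian (χ n) = ∑ p, cpd p (cpd p (χ n)) := by
        funext x
        simp [configLaplacian]
      rwa [← e] at hs
  · refine tendsto_of_tendsto_of_tendsto_of_le_of_le tendsto_const_nhds
      ((hΔ.add h1).mono_right (by rw [add_zero])) (fun n => zero_le) fun n => ?_
    have e : (fun x => ∑ i, particleOp (v n) i (χ n) x - hamiltonian V N ⟨ψ, hψ⟩ x) =ᵐ[volume]
        -(fun x => configLaplacian (χ n) x - laplacianL2 ψ hψ.1 x) +
          fun x => U n x * χ n x - (interaction V N x : ℂ) * ψ x := by
      filter_upwards [hH] with x hx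
      rw [hval, hx]
      simp only [Pi.add_apply, Pi.neg_apply]
      ring
    rw [eLpNorm_congr_ae e]
    have hm : AEStronglyMeasurable (fun x => configLaplacian (χ n) x - laplacianL2 ψ hψ.1 x)
        volume := (hcl n).continuous.aestronglyMeasurable.sub (Lp.aestronglyMeasurable _)
    refine (eLpNorm_add_le hm.neg ?_ one_le_two).trans (by rw [eLpNorm_neg])
    exact ((hUs n).mul (hχ n)).continuous.aestronglyMeasurable.sub
      (hW.aestronglyMeasurable.mul (Lp.aestronglyMeasurable _))

end HamiltonianLimit

/-! ### Division by the correlation factor. -/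

section PairQuotient

variable {N : ℕ}

/-- Quotients by pair functions converge in `L²`. -/
theorem tendsto_eLpNorm_div_sub {F : ℕ → Config N → ℂ} {χ : ℕ → Config N → ℂ} {f : Config N → ℂ}
    {ψ : WaveFunction N} (hF : ∀ n, Continuous (F n)) (hχ : ∀ n, Continuous (χ n))
    (hf : Measurable f) (hFl : ∀ n x, 9 / 10 ≤ ‖F n x‖)
    (hlim : ∀ x, Tendsto (fun n => F n x) atTop (𝓝 (f x)))
    (h : Tendsto (fun n => eLpNorm (fun x => χ n x - ψ x) 2 volume) atTop (𝓝 0)) :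
    Tendsto (fun n => eLpNorm (fun x => χ n x / F n x - ψ x / f x) 2 volume) atTop (𝓝 0) := by
  have hfl : ∀ x, 9 / 10 ≤ ‖f x‖ := fun x =>
    ge_of_tendsto (hlim x).norm (Eventually.of_forall fun n => hFl n x)
  have hne : ∀ n x, F n x ≠ 0 := fun n x h0 => by
    have := hFl n x
    rw [h0, norm_zero] at this
    linarith
  have hfne : ∀ x, f x ≠ 0 := fun x h0 => by
    have := hfl x
    rw [h0, norm_zero] at this
    linarith
  have hinv : ∀ z : ℂ, 9 / 10 ≤ ‖z‖ → ‖z⁻¹‖ ≤ 2 := fun z hz => by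
    rw [norm_inv]
    calc ‖z‖⁻¹ ≤ (9 / 10 : ℝ)⁻¹ := inv_anti₀ (by norm_num) hz
      _ ≤ 2 := by norm_num
  have h1 := tendsto_eLpNorm_mul_sub (U := fun n x => (F n x)⁻¹) (W := fun x => (f x)⁻¹) (C := 2)
    (fun n => (hF n).inv₀ (hne n)) hχ hf.inv (fun n x => hinv _ (hFl n x))
    (ae_of_all _ fun x => hinv _ (hfl x)) (ae_of_all _ fun x => (hlim x).inv₀ (hfne x)) h
  refine h1.congr fun n => ?_
  congr 1
  funext x
  rw [div_eq_inv_mul, div_eq_inv_mul]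

theorem memLp_div {f : Config N → ℂ} (hf : Measurable f) (hfl : ∀ x, 9 / 10 ≤ ‖f x‖)
    (ψ : WaveFunction N) : MemLp (fun x => ψ x / f x) 2 volume := by
  refine ((Lp.memLp ψ).norm.const_mul 2).mono'
    ((Lp.aestronglyMeasurable ψ).aemeasurable.div hf.aemeasurable).aestronglyMeasurable (ae_of_all _ fun x => ?_)
  rw [norm_div, div_le_iff₀ (by linarith [hfl x])]
  nlinarith [norm_nonneg (ψ x), hfl x]

end PairQuotient

/-! ### Symmetry and passage to the limit. -/

section Main

variable {N : ℕ} {V f : Space3 → ℝ}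

/-- The correlation factor `f(N(x_i - x_j))`. -/
def correlation (f : Space3 → ℝ) (i j : Fin N) (x : Config N) : ℂ :=
  (f ((N : ℝ) • (position x i - position x j)) : ℂ)

theorem measurable_correlation (hf : Measurable f) (i j : Fin N) :
    Measurable (correlation f i j) :=
  Complex.measurable_ofReal.comp
    (hf.comp (((measurable_position i).sub (measurable_position j)).const_smul (N : ℝ)))

theorem exists_perm_pair {i j k l : Fin N} (hij : i ≠ j) (hkl : k ≠ l) :
    ∃ σ : Equiv.Perm (Fin N), σ i = k ∧ σ j = l := by
  -- The first swap brings `i` to `k`; the second takes the image of `j` to `l` and fixes `k`.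
  refine ⟨(Equiv.swap i k).trans (Equiv.swap (Equiv.swap i k j) l), ?_, ?_⟩
  · have h1 : k ≠ Equiv.swap i k j := by
      intro h
      have : Equiv.swap i k i = Equiv.swap i k j := by rw [Equiv.swap_apply_left]; exact h
      exact hij ((Equiv.swap i k).injective this)
    simp [Equiv.swap_apply_of_ne_of_ne h1 hkl]
  · simp

/-- By symmetry, pairings with derivatives do not depend on the pair of particles. -/
theorem integral_pair_eq {ψ : WaveFunction N} (hψ : IsPermSymmetric ψ) {η : Config N → ℂ}
    (hη : ContDiff ℝ ∞ η) (σ : Equiv.Perm (Fin N)) (k l : Fin N) (a b : Fin 3) :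
    ∫ x, ψ x / correlation f (σ k) (σ l) x *
        cpd (σ l, b) (cpd (σ k, a) fun x => η (permute σ x)) x =
      ∫ x, ψ x / correlation f k l x * cpd (l, b) (cpd (k, a) η) x := by
  rw [← integral_comp_permute σ fun x =>
    ψ x / correlation f k l x * cpd (l, b) (cpd (k, a) η) x]
  refine integral_congr_ae ?_
  filter_upwards [hψ σ] with x hx
  rw [cpd_comp_permute hη, cpd_comp_permute (contDiff_cpd hη _), hx]
  rfl

/-- The quadratic form bound tested against Schwartz functions. -/
theorem sum_two_re_pair_le (hV : Measurable V) {ψ : WaveFunction N} (hs : IsPermSymmetric ψ)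
    (hψ : ψ ∈ (hamiltonian V N).domain) {K : ℕ → ℝ → ℝ} {δ : ℕ → ℝ} {B : ℝ}
    (hK : ∀ n, SmallProfile (K n) (δ n)) (hf : Measurable f)
    (hKf : ∀ (i j : Fin N) (x : Config N), Tendsto (fun n => K n (sqDist i j x)) atTop
      (𝓝 (f ((N : ℝ) • (position x i - position x j)))))
    (hB : ∀ n q, |profilePotential (K n) q| ≤ B)
    (hKV : ∀ i j : Fin N, i ≠ j → ∀ᵐ x : Config N,
      Tendsto (fun n => profilePotential (K n) (sqDist i j x)) atTop
        (𝓝 ((N : ℝ) ^ 2 * V ((N : ℝ) • (position x i - position x j)))))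
    {k l : Fin N} (hkl : k ≠ l) (η : Fin 3 × Fin 3 → 𝓢(Config N, ℂ)) :
    ∑ c, (2 * (∫ x, ψ x / correlation f k l x * cpd (l, c.2) (cpd (k, c.1) (η c)) x).re -
      ‖(η c).toLp 2‖ ^ 2) ≤ 2 / N ^ 2 * ‖hamiltonian V N ⟨ψ, hψ⟩‖ ^ 2 := by
  obtain ⟨χ, hχ, hχc, hlim, hΔ⟩ := exists_smooth_approximation hψ.1
  have hE := tendsto_integral_norm_sq_sum_particleOp hV hψ hχ hχc hlim hΔ
    (fun n => (hK n).contDiff_profilePotential) hB hKV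
  have hpc : ∀ n i j, ContDiff ℝ ∞ (pairFun (N := N) (K n) i j) := fun n i j =>
    contDiff_pairFun (hK n).smooth i j
  have hpl : ∀ n i j (x : Config N), 9 / 10 ≤ ‖pairFun (K n) i j x‖ := fun n i j x => by
    rw [pairFun, Complex.norm_real, Real.norm_eq_abs]
    exact ((hK n).lower _).trans (le_abs_self _)
  have hpne : ∀ n i j (x : Config N), pairFun (K n) i j x ≠ 0 := fun n i j x h0 => by
    have := hpl n i j x
    rw [h0, norm_zero] at this
    linarith
  have hplim : ∀ (i j : Fin N) (x : Config N), Tendsto (fun n => pairFun (K n) i j x) atTop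
      (𝓝 (correlation f i j x)) := fun i j x =>
    (Complex.continuous_ofReal.tendsto _).comp (hKf i j x)
  have hcl : ∀ (i j : Fin N) (x : Config N), 9 / 10 ≤ ‖correlation f i j x‖ := fun i j x =>
    ge_of_tendsto (hplim i j x).norm (Eventually.of_forall fun n => hpl n i j x)
  have hus : ∀ n i j, ContDiff ℝ ∞ (fun x => χ n x / pairFun (K n) i j x) := fun n i j => by
    simp only [div_eq_mul_inv]
    exact (hχ n).mul ((hpc n i j).inv (hpne n i j))
  have huc : ∀ n i j, HasCompactSupport (fun x => χ n x / pairFun (K n) i j x) := fun n i j => by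
    simp only [div_eq_mul_inv]
    exact (hχc n).mul_right
  -- For each pair `(i, j)` the test functions are transported from `(k, l)` by a permutation, so
  -- that all pairings have the same limit although the `χ n` need not be symmetric.
  choose! σ hσk hσl using fun i j (hij : i ≠ j) => exists_perm_pair hkl hij
  have hηs : ∀ c, ContDiff ℝ ∞ (η c) := fun c => (η c).smooth'
  set s : Fin N → Fin N → Fin 3 × Fin 3 → Config N → ℂ := fun i j c x => η c (permute (σ i j) x)
  have hss : ∀ i j c, ContDiff ℝ ∞ (s i j c) := fun i j c => contDiff_comp_permute (hηs c) _
  have hs2 : ∀ i j c, MemLp (s i j c) 2 volume := fun i j c =>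
    ((η c).memLp 2).comp_measurePreserving (measurePreserving_permute _)
  have hsn : ∀ i j c, ∫ x, ‖s i j c x‖ ^ 2 = ‖(η c).toLp 2‖ ^ 2 := fun i j c => by
    rw [integral_norm_sq_eq_eLpNorm (hs2 i j c), SchwartzMap.norm_toLp]
    congr 2
    exact eLpNorm_comp_measurePreserving ((η c).memLp 2).1 (measurePreserving_permute _)
  set Q : ℕ → Fin N → Fin N → Fin 3 × Fin 3 → ℝ := fun n i j c =>
    2 * (∫ x, χ n x / pairFun (K n) i j x * cpd (j, c.2) (cpd (i, c.1) (s i j c)) x).re -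
      ‖(η c).toLp 2‖ ^ 2
  set Q' : Fin 3 × Fin 3 → ℝ := fun c =>
    2 * (∫ x, ψ x / correlation f k l x * cpd (l, c.2) (cpd (k, c.1) (η c)) x).re -
      ‖(η c).toLp 2‖ ^ 2
  have hQ : ∀ i j, i ≠ j → ∀ c, Tendsto (fun n => Q n i j c) atTop (𝓝 (Q' c)) := by
    intro i j hij c
    have hw : cpd (j, c.2) (cpd (i, c.1) (s i j c)) =
        fun x => cpd (l, c.2) (cpd (k, c.1) (η c)) (permute (σ i j) x) := by
      have h1 : cpd (i, c.1) (s i j c) = fun x => cpd (k, c.1) (η c) (permute (σ i j) x) := by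
        rw [← cpd_comp_permute (hηs c), hσk i j hij]
      rw [h1, ← cpd_comp_permute (contDiff_cpd (hηs c) _), hσl i j hij]
    have hw2 : MemLp (cpd (j, c.2) (cpd (i, c.1) (s i j c))) 2 volume := by
      rw [hw]
      have h2 : MemLp (cpd (l, c.2) (cpd (k, c.1) (η c))) 2 volume :=
        (∂_{(EuclideanSpace.single (l, c.2) 1 : Config N)}
          (∂_{(EuclideanSpace.single (k, c.1) 1 : Config N)} (η c))).memLp 2 volume
      exact h2.comp_measurePreserving (measurePreserving_permute _)
    have h3 := tendsto_integral_mul (fun n => (hus n i j).continuous.memLp_of_hasCompactSupport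
      (huc n i j)) (memLp_div (measurable_correlation hf i j) (hcl i j) ψ) hw2
      (tendsto_eLpNorm_div_sub (fun n => (hpc n i j).continuous) (fun n => (hχ n).continuous)
        (measurable_correlation hf i j) (fun n => hpl n i j) (hplim i j) hlim)
    have h4 := integral_pair_eq (f := f) hs (hηs c) (σ i j) k l c.1 c.2
    rw [hσk i j hij, hσl i j hij] at h4
    rw [h4] at h3
    exact (((Complex.continuous_re.tendsto _).comp h3).const_mul 2).sub_const _
  have hle : ∀ n, N * ∑ i : Fin N, ∑ j ∈ Finset.univ.erase i, ∑ c, Q n i j c ≤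
      2 * (N - 1) * ∫ x, ‖∑ i, particleOp (profilePotential (K n)) i (χ n) x‖ ^ 2 := by
    intro n
    refine le_trans ?_ (sum_pairs_le (hK n) (hχ n) (hχc n))
    refine mul_le_mul_of_nonneg_left ?_ (Nat.cast_nonneg N)
    refine Finset.sum_le_sum fun i _ => Finset.sum_le_sum fun j _ => ?_
    rw [Fintype.sum_prod_type]
    refine Finset.sum_le_sum fun a _ => Finset.sum_le_sum fun b _ => ?_
    have := two_re_integral_sub_le (hus n i j) (huc n i j) (hss i j (a, b)) (hs2 i j (a, b))
      (i, a) (j, b)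
    rw [hsn] at this
    exact this
  have hlimQ : Tendsto (fun n => N * ∑ i : Fin N, ∑ j ∈ Finset.univ.erase i, ∑ c, Q n i j c) atTop
      (𝓝 (N * ∑ i : Fin N, ∑ j ∈ Finset.univ.erase i, ∑ c, Q' c)) :=
    (tendsto_finsetSum _ fun i _ => tendsto_finsetSum _ fun j hj => tendsto_finsetSum _ fun c _ =>
      hQ i j (Finset.ne_of_mem_erase hj).symm c).const_mul _
  have hfin := le_of_tendsto_of_tendsto' hlimQ (hE.const_mul (2 * ((N : ℝ) - 1))) hle
  have hN : 2 ≤ N := by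
    have := Fin.val_ne_of_ne hkl
    omega
  have hN' : (2 : ℝ) ≤ N := by exact_mod_cast hN
  simp only [Finset.sum_const, Finset.card_erase_of_mem (Finset.mem_univ _), Finset.card_univ,
    Fintype.card_fin, nsmul_eq_mul] at hfin
  rw [Nat.cast_sub (by omega), Nat.cast_one] at hfin
  change ∑ c, Q' c ≤ _
  rw [div_mul_eq_mul_div, le_div_iff₀ (by positivity)]
  have h5 : (0 : ℝ) < N - 1 := by linarith
  -- There are `N (N - 1)` ordered pairs, all with the same limit, so the factor `N - 1` cancels and
  -- `N²` remains.
  refine le_of_mul_le_mul_left ?_ h5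
  linarith

end Main

end GrossPitaevskii

end

open GrossPitaevskii in
theorem proposition5p2 :
    ∃ ρ₀ : ℝ, 0 < ρ₀ ∧
      ∀ V : Space3 → ℝ, Measurable V → (∀ x, 0 ≤ V x) → IsRadial V → HasCompactSupport V →
        (∃ M : ℝ, ∀ x, V x ≤ M) → strength V ≤ ρ₀ →
      ∀ f : Space3 → ℝ, IsScatteringSolution V f →
      ∀ (N : ℕ) (hN : 2 ≤ N) (ψ : WaveFunction N), IsPermSymmetric ψ →
        ∃ φ : WaveFunction N,
          (φ =ᵐ[volume] fun x =>
            ψ x / (f ((N : ℝ) • (position x ⟨0, by omega⟩ - position x ⟨1, by omega⟩)) : ℂ)) ∧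
          (N : ℝ≥0∞) ^ 2 / 2 * mixedGradientSq ⟨0, by omega⟩ ⟨1, by omega⟩ φ
            ≤ hamiltonianSqForm V N ψ := by
  -- The constant is the one needed for the second derivative in `SmoothSource.smallProfile`: the
  -- source is bounded by `strength V / 2` over `τ`, and mollification doubles this.
  refine ⟨1 / 3000, by norm_num, fun V hV hV0 hVr hVc hM hρ f hf N hN ψ hs => ?_⟩
  obtain ⟨K, δ, B, hK, hKf, hB, hKV⟩ :=
    hf.exists_smallProfile hV hV0 hVr hVc hM hρ (N := N) (by omega)
  have hfm := hf.continuous.measurable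
  set k : Fin N := ⟨0, by omega⟩
  set l : Fin N := ⟨1, by omega⟩
  have hkl : k ≠ l := by simp [k, l]
  -- The uniform lower bound on the profiles passes to `f`, so the quotient is in `L²` for every
  -- `ψ`, in the domain or not.
  have hcl : ∀ x : Config N, 9 / 10 ≤ ‖correlation f k l x‖ := fun x => by
    rw [correlation, Complex.norm_real]
    exact (ge_of_tendsto (hKf k l x) (Eventually.of_forall fun n => (hK n).lower _)).trans
      (le_abs_self _)
  have hφ := memLp_div (measurable_correlation hfm k l) hcl ψ
  refine ⟨hφ.toLp _, hφ.coeFn_toLp, ?_⟩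
  unfold hamiltonianSqForm
  split_ifs with hψ
  · have h1 := sum_distL2NormSq_le (u := fun c : Fin 3 × Fin 3 =>
      ∂_{(EuclideanSpace.single (k, c.1) 1 : Config N)}
        (∂_{(EuclideanSpace.single (l, c.2) 1 : Config N)}
          ((hφ.toLp _ : WaveFunction N) : 𝓢'(Config N, ℂ))))
      (c := 2 / N ^ 2 * ‖hamiltonian V N ⟨ψ, hψ⟩‖ ^ 2) fun η => by
        refine le_trans (le_of_eq (Finset.sum_congr rfl fun c _ => ?_))
          (sum_two_re_pair_le hV hs hψ hK hfm hKf hB hKV hkl η)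
        rw [mixed_derivative_apply]
        congr 3
        refine integral_congr_ae ?_
        filter_upwards [hφ.coeFn_toLp] with x hx
        rw [hx]
    rw [Fintype.sum_prod_type] at h1
    have hNpos : (0 : ℝ) < N := by
      have : 0 < N := by omega
      exact_mod_cast this
    calc (N : ℝ≥0∞) ^ 2 / 2 * mixedGradientSq k l (hφ.toLp _)
        ≤ ENNReal.ofReal (N ^ 2 / 2) *
          ENNReal.ofReal (2 / N ^ 2 * ‖hamiltonian V N ⟨ψ, hψ⟩‖ ^ 2) := by
          gcongr
          · rw [ENNReal.ofReal_div_of_pos two_pos, ENNReal.ofReal_pow hNpos.le,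
              ENNReal.ofReal_natCast, ENNReal.ofReal_ofNat]
          · exact h1
      _ = ‖hamiltonian V N ⟨ψ, hψ⟩‖ₑ ^ 2 := by
          rw [← ENNReal.ofReal_mul (by positivity), ← ofReal_norm,
            ← ENNReal.ofReal_pow (norm_nonneg _)]
          congr 1
          field_simp
  · exact le_top
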